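/- Let $n\in\{4,5\}$ and $\kappa>0$. Write $x=(x',x_n)\in\mathbb R^{n-1}\times\mathbb R$ and $V(x)=|x'|^2$. Let $$H=\Big\{(\phi,\psi)\in H^1(\mathbb R^n;\mathbb C)^2:\ \int_{\mathbb R^n}V(|\phi|^2+|\psi|^2)\,dx<\infty\Big\},$$ $$\|(\phi,\psi)\|_{\dot H}^2=\|\nabla\phi\|_{L^2}^2+\|\nabla\psi\|_{L^2}^2+\int_{\mathbb R^n}V(|\phi|^2+|\psi|^2)\,dx,$$ $$I(\phi,\psi)=\tfrac12\big(\|\nabla\phi\|_{L^2}^2+\kappa\|\nabla\psi\|_{L^2}^2\big)+\tfrac12\int_{\mathbb R^n}V(|\phi|^2+|\psi|^2)\,dx-\tfrac12\,\mathrm{Re}\int_{\mathbb R^n}\phi^2\overline{\psi}\,dx .$$ For $\chi,\mu_1,\mu_2>0$ put $$S(\mu_1,\mu_2)=\{(\phi,\psi)\in H:\ \|\phi\|_{L^2}^2=\mu_1,\ \|\psi\|_{L^2}^2=\mu_2\},\qquad B(\chi)=\Big\{(\phi,\psi)\in H:\ \|(\phi,\psi)\|_{\dot H}^2\le \frac{\chi}{\min\{1,\kappa\}}\Big\},$$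 $$d^\chi_{\mu_1,\mu_2}=\inf_{S(\mu_1,\mu_2)\cap B(\chi)}I,\qquad \mathcal D^\chi_{\mu_1,\mu_2}=\{(u,v)\in S(\mu_1,\mu_2)\cap B(\chi):\ I(u,v)=d^\chi_{\mu_1,\mu_2}\}.$$ Theorem. For every $\chi>0$ there is a constant $\mu^\star>0$, depending only on $\chi$, $\kappa$ and $n$, such that for all $\mu_1,\mu_2>0$ with $\mu_1+\mu_2<\mu^\star$ the functional $I$ is bounded below on $S(\mu_1,\mu_2)\cap B(\chi)$ and $d^\chi_{\mu_1,\mu_2}$ is attained, i.e. $\mathcal D^\chi_{\mu_1,\mu_2}\neq\emptyset$. Moreover, every minimizer gives a normalized solution of the elliptic system: for each $(u,v)\in\mathcal D^\chi_{\mu_1,\mu_2}$ there are $\lambda_1,\lambda_2\in\mathbb R$ such that $(u,v)$ is a weak solution (against test functions in $C_0^\infty(\mathbb R^n)$) of $$-\Delta u+\lambda_1u+Vu=\overline u\,v,\qquad -\kappa\Delta v+\lambda_2v+Vv=\tfrac12u^2,$$ and $(\phi,\psi)=(|u|,|v|)$ also belongs to $\mathcal D^\chi_{\mu_1,\mu_2}$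 and is, with the same $\lambda_1,\lambda_2$, a weak solution of $$-\Delta\phi+\lambda_1\phi+V\phi=\phi\psi,\qquad -\kappa\Delta\psi+\lambda_2\psi+V\psi=\tfrac12\phi^2 .$$ (For real-valued $u$ the two systems coincide.) -/

import Mathlib

open MeasureTheory
open scoped ContDiff ComplexConjugate

noncomputable section

namespace PartialConfinement

/-- `ℝⁿ` with its Euclidean norm and Lebesgue measure. -/
abbrev Space (n : ℕ) : Type := EuclideanSpace ℝ (Fin n)

/-- The `i`-th (classical) partial derivative of a real-differentiable `f : ℝⁿ → F`. -/
def partialDeriv {n : ℕ} {F : Type*} [NormedAddCommGroup F] [NormedSpace ℝ F]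
    (i : Fin n) (f : Space n → F) (x : Space n) : F :=
  fderiv ℝ f x (EuclideanSpace.single i 1)

/-- `g` is an `i`-th weak partial derivative of `u`: both are locally integrable and
`∫ (∂ᵢ f) u = - ∫ f g` for every real test function `f ∈ C_c^∞(ℝⁿ)`. -/
def HasWeakPartial {n : ℕ} (i : Fin n) (u g : Space n → ℂ) : Prop :=
  LocallyIntegrable u volume ∧ LocallyIntegrable g volume ∧
    ∀ f : Space n → ℝ, ContDiff ℝ ∞ f → HasCompactSupport f →
      ∫ x, partialDeriv i f x • u x = - ∫ x, f x • g x

open Classical in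
/-- A chosen `i`-th weak partial derivative of `u` (it is unique up to null sets);
the value is `0` if there is none. -/
def weakPartial {n : ℕ} (i : Fin n) (u : Space n → ℂ) : Space n → ℂ :=
  if h : ∃ g, HasWeakPartial i u g then h.choose else 0

theorem hasWeakPartial_weakPartial {n : ℕ} {i : Fin n} {u : Space n → ℂ}
    (h : ∃ g, HasWeakPartial i u g) : HasWeakPartial i u (weakPartial i u) := by
  classical
  unfold weakPartial
  rw [dif_pos h]
  exact h.choose_spec

/-- The complex Sobolev space `H¹(ℝⁿ)`: `u ∈ L²` with all weak partial derivatives in `L²`. -/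
def MemH1 {n : ℕ} (u : Space n → ℂ) : Prop :=
  MemLp u 2 volume ∧ ∀ i, ∃ g, HasWeakPartial i u g ∧ MemLp g 2 volume

/-- The partially confining potential `V₂(x) = |x'|² = x₁² + ⋯ + x_{n-1}²`, where
`x = (x', x_n)`. -/
def potential {n : ℕ} (x : Space n) : ℝ :=
  ∑ i ∈ Finset.univ.filter (fun i : Fin n => i.val + 1 < n), x i ^ 2

/-- `‖∇u‖²` in `L²`. -/
def gradNormSq {n : ℕ} (u : Space n → ℂ) : ℝ :=
  ∑ i, ∫ x, ‖weakPartial i u x‖ ^ 2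

/-- `‖u‖²` in `L²`. -/
def mass {n : ℕ} (u : Space n → ℂ) : ℝ :=
  ∫ x, ‖u x‖ ^ 2

/-- `∫ V₂ |u|²`. -/
def potentialEnergy {n : ℕ} (u : Space n → ℂ) : ℝ :=
  ∫ x, potential x * ‖u x‖ ^ 2

/-- The energy space `H`: pairs of `H¹` functions such that `V₂ |φ|²` and `V₂ |ψ|²` are
integrable. -/
def energySpace (n : ℕ) : Set ((Space n → ℂ) × (Space n → ℂ)) :=
  {p | (MemH1 p.1 ∧ Integrable (fun x => potential x * ‖p.1 x‖ ^ 2) volume) ∧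
       (MemH1 p.2 ∧ Integrable (fun x => potential x * ‖p.2 x‖ ^ 2) volume)}

/-- `K(φ, ψ) = Re ∫ φ² ψ̄`. -/
def interaction {n : ℕ} (p : (Space n → ℂ) × (Space n → ℂ)) : ℝ :=
  (∫ x, p.1 x ^ 2 * conj (p.2 x)).re

/-- The functional `I`. -/
def energy {n : ℕ} (κ : ℝ) (p : (Space n → ℂ) × (Space n → ℂ)) : ℝ :=
  1 / 2 * (gradNormSq p.1 + κ * gradNormSq p.2)
    + 1 / 2 * (potentialEnergy p.1 + potentialEnergy p.2) - 1 / 2 * interaction p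

/-- The constraint `S(μ₁, μ₂)`: pairs in `H` with prescribed masses. -/
def massConstraint (n : ℕ) (μ₁ μ₂ : ℝ) : Set ((Space n → ℂ) × (Space n → ℂ)) :=
  {p | p ∈ energySpace n ∧ mass p.1 = μ₁ ∧ mass p.2 = μ₂}

/-- The square of the homogeneous norm of `H`. -/
def homNormSq {n : ℕ} (p : (Space n → ℂ) × (Space n → ℂ)) : ℝ :=
  gradNormSq p.1 + gradNormSq p.2 + (potentialEnergy p.1 + potentialEnergy p.2)

/-- `B(χ)`: pairs in `H` with squared homogeneous norm at most `χ / ε₀`, `ε₀ = min {1, κ}`. -/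
def energyBall (n : ℕ) (κ χ : ℝ) : Set ((Space n → ℂ) × (Space n → ℂ)) :=
  {p | p ∈ energySpace n ∧ homNormSq p ≤ χ / min 1 κ}

/-- The local infimum of `I` over `S(μ₁, μ₂) ∩ B(χ)`. -/
def localInf (n : ℕ) (κ χ μ₁ μ₂ : ℝ) : ℝ :=
  sInf (energy κ '' (massConstraint n μ₁ μ₂ ∩ energyBall n κ χ))

/-- The set of local minimizers. -/
def localMinimizers (n : ℕ) (κ χ μ₁ μ₂ : ℝ) : Set ((Space n → ℂ) × (Space n → ℂ)) :=
  {p | p ∈ massConstraint n μ₁ μ₂ ∩ energyBall n κ χ ∧ energy κ p = localInf n κ χ μ₁ μ₂}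

/-- `u ∈ H¹` solves `-a Δu + lam u + V₂ u = F` weakly, i.e. against every test function
`f ∈ C_c^∞(ℝⁿ)`. -/
def WeakEq {n : ℕ} (a lam : ℝ) (u F : Space n → ℂ) : Prop :=
  MemH1 u ∧ ∀ f : Space n → ℂ, ContDiff ℝ ∞ f → HasCompactSupport f →
    ∫ x, ((a : ℂ) * ∑ i, weakPartial i u x * partialDeriv i f x
        + (lam : ℂ) * u x * f x + (potential x : ℂ) * u x * f x)
      = ∫ x, F x * f x

/-- Weak solutions of the elliptic system
`-Δφ + lam₁ φ + V₂ φ = φ ψ`, `-κ Δψ + lam₂ ψ + V₂ ψ = φ² / 2`. -/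
def IsWeakSolution {n : ℕ} (κ lam₁ lam₂ : ℝ) (p : (Space n → ℂ) × (Space n → ℂ)) : Prop :=
  WeakEq 1 lam₁ p.1 (fun x => p.1 x * p.2 x) ∧
  WeakEq κ lam₂ p.2 (fun x => 1 / 2 * p.1 x ^ 2)

/-- Weak solutions of the complex form of the elliptic system,
`-Δφ + lam₁ φ + V₂ φ = φ̄ ψ`, `-κ Δψ + lam₂ ψ + V₂ ψ = φ² / 2`.
For real-valued `φ` it is the same system as in `IsWeakSolution`. -/
def IsComplexWeakSolution {n : ℕ} (κ lam₁ lam₂ : ℝ)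
    (p : (Space n → ℂ) × (Space n → ℂ)) : Prop :=
  WeakEq 1 lam₁ p.1 (fun x => conj (p.1 x) * p.2 x) ∧
  WeakEq κ lam₂ p.2 (fun x => 1 / 2 * p.1 x ^ 2)

/-- The pair of moduli `(|φ|, |ψ|)`. -/
def modulusPair {n : ℕ} (p : (Space n → ℂ) × (Space n → ℂ)) :
    (Space n → ℂ) × (Space n → ℂ) :=
  (fun x => (‖p.1 x‖ : ℂ), fun x => (‖p.2 x‖ : ℂ))

end PartialConfinement

end

/-!
# Local minimizers for a quadratically coupled system with partial confinement

The transversal oscillator `-κ Δ' + |x'|²` has bottom `√κ (n - 1)` (`oscillator_le`), so without the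
interaction the energy of a pair with masses `μ₁, μ₂` is at least
`E₀ = (n - 1) (μ₁ + √κ μ₂) / 2`. Gaussians which are ground states transversally and very wide in
the free variable beat this bound (`exists_trial`): the overhead is of order `a`, the gain from the
interaction of order `a^{1/4}`. Conversely the cubic Gagliardo--Nirenberg inequality
(`exists_cube_le`) makes the interaction on the ball of higher order than the masses, so that for
small masses every competitor with energy at most `E₀` stays in the ball of half the radius
(`exists_small_mass`). In particular minimizers are interior, which gives the Euler--Lagrange
equations by rescaled variations (`isComplexWeakSolution_of_minimizer`).

For existence, a minimizing sequence is replaced by its moduli (`gradNormSq_norm_le`, proved with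
difference quotients). Since its energy is below `E₀`, the interaction is bounded below, so some slab
in the free variable carries a fixed amount of it (`exists_slab_ge`); the potential controls the
transversal tails (`exists_translate_ge`). After a translation the weak limit `(φ, ψ)` is
nonnegative with positive interaction. By Rellich's theorem all quantities split into those of the
weak limit and those of the remainder (`tendsto_interaction_add_sub` and its companions), and
recombinations of arbitrary pairs with rescaled remainders are admissible trial sequences
(`Remainder.localInf_le`). These exclude a loss of mass:
* if both components lose mass, mass is exchanged between the limit and the remainder in both
  directions; quadratic terms change linearly and the interaction gains to second order
  (`exchange_contradiction`);
* if only the first component loses mass, the remainder does not interact, and it is better to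
  scale `φ` up (`Remainder.false_of_right_eq_zero`);
* if only the second component loses mass, the lost mass is better put on a wide Gaussian
  interacting with `φ` (`Remainder.false_of_left_eq_zero`).

The moduli of a minimizer have no larger gradient terms and no smaller interaction, so each of these
is unchanged, and so are the Lagrange multipliers, which are determined by them
(`modulusPair_minimizer`).
-/

open MeasureTheory Filter Topology
open scoped ContDiff ComplexConjugate ENNReal

noncomputable section

namespace PartialConfinement

variable {n : ℕ}

/-- The real inner product `Re ∫ f ḡ` of `L²(ℝⁿ; ℂ)`. -/
def reInner (f g : Space n → ℂ) : ℝ := ∫ x, inner ℝ (f x) (g x)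

theorem integrable_normSq {f : Space n → ℂ} (hf : MemLp f 2 volume) :
    Integrable (fun x => ‖f x‖ ^ 2) := (memLp_two_iff_integrable_sq_norm hf.1).1 hf

theorem integrable_inner {f g : Space n → ℂ} (hf : MemLp f 2 volume) (hg : MemLp g 2 volume) :
    Integrable (fun x => (inner ℝ (f x) (g x) : ℝ)) := by
  have := L2.integrable_inner (𝕜 := ℝ) hf.toLp hg.toLp
  refine this.congr ?_
  filter_upwards [hf.coeFn_toLp, hg.coeFn_toLp] with x h1 h2
  rw [h1, h2]

theorem inner_toLp {f g : Space n → ℂ} (hf : MemLp f 2 volume) (hg : MemLp g 2 volume) :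
    (inner ℝ hf.toLp hg.toLp : ℝ) = reInner f g := by
  rw [L2.inner_def]
  refine integral_congr_ae ?_
  filter_upwards [hf.coeFn_toLp, hg.coeFn_toLp] with x h1 h2
  rw [h1, h2]

theorem reInner_self (f : Space n → ℂ) : reInner f f = mass f := by
  simp [reInner, mass]

theorem norm_toLp_sq {f : Space n → ℂ} (hf : MemLp f 2 volume) : ‖hf.toLp‖ ^ 2 = mass f := by
  rw [← reInner_self, ← inner_toLp hf hf, real_inner_self_eq_norm_sq]

theorem norm_toLp_eq_sqrt {f : Space n → ℂ} (hf : MemLp f 2 volume) :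
    ‖hf.toLp‖ = √(mass f) := by
  rw [← norm_toLp_sq hf, Real.sqrt_sq (norm_nonneg _)]

theorem mass_nonneg (f : Space n → ℂ) : 0 ≤ mass f := integral_nonneg fun _ => by positivity

theorem reInner_comm (f g : Space n → ℂ) : reInner f g = reInner g f := by
  simp only [reInner, real_inner_comm]

theorem mass_congr {f g : Space n → ℂ} (h : f =ᵐ[volume] g) : mass f = mass g :=
  integral_congr_ae (h.mono fun x hx => by simp only [hx])

theorem reInner_congr {f g f' g' : Space n → ℂ} (h : f =ᵐ[volume] f') (h' : g =ᵐ[volume] g') :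
    reInner f g = reInner f' g' :=
  integral_congr_ae (by filter_upwards [h, h'] with x h1 h2; rw [h1, h2])

/-- Cauchy–Schwarz. -/
theorem abs_reInner_le {f g : Space n → ℂ} (hf : MemLp f 2 volume) (hg : MemLp g 2 volume) :
    |reInner f g| ≤ √(mass f) * √(mass g) := by
  rw [← inner_toLp hf hg, ← norm_toLp_eq_sqrt hf, ← norm_toLp_eq_sqrt hg]
  exact abs_real_inner_le_norm _ _

theorem reInner_add_left {f g h : Space n → ℂ} (hf : MemLp f 2 volume) (hg : MemLp g 2 volume)
    (hh : MemLp h 2 volume) : reInner (f + g) h = reInner f h + reInner g h := by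
  unfold reInner
  rw [← integral_add (integrable_inner hf hh) (integrable_inner hg hh)]
  simp only [Pi.add_apply, inner_add_left]

theorem reInner_smul_left (c : ℝ) (f g : Space n → ℂ) :
    reInner ((c : ℂ) • f) g = c * reInner f g := by
  unfold reInner
  rw [← integral_const_mul]
  congr 1 with x
  rw [Pi.smul_apply, ← real_inner_smul_left, smul_eq_mul, Complex.real_smul]

theorem mass_smul (c : ℂ) (f : Space n → ℂ) : mass (c • f) = ‖c‖ ^ 2 * mass f := by
  unfold mass
  rw [← integral_const_mul]
  congr 1 with x
  rw [Pi.smul_apply, norm_smul, mul_pow]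

theorem mass_add {f g : Space n → ℂ} (hf : MemLp f 2 volume) (hg : MemLp g 2 volume) :
    mass (f + g) = mass f + 2 * reInner f g + mass g := by
  rw [← norm_toLp_sq (hf.add hg), ← norm_toLp_sq hf, ← norm_toLp_sq hg, ← inner_toLp hf hg,
    MemLp.toLp_add, norm_add_sq_real]

theorem mass_add_le {f g : Space n → ℂ} (hf : MemLp f 2 volume) (hg : MemLp g 2 volume) :
    mass (f + g) ≤ 2 * mass f + 2 * mass g := by
  rw [← norm_toLp_sq (hf.add hg), ← norm_toLp_sq hf, ← norm_toLp_sq hg, MemLp.toLp_add hf hg]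
  nlinarith [parallelogram_law_with_norm ℝ hf.toLp hg.toLp, norm_nonneg (hf.toLp - hg.toLp)]

/-! ### Squared norms as lower Lebesgue integrals -/

theorem lintegral_enorm_sq {f : Space n → ℂ} (hf : MemLp f 2 volume) :
    ∫⁻ x, ‖f x‖ₑ ^ 2 = ENNReal.ofReal (mass f) := by
  rw [mass, ofReal_integral_eq_lintegral_ofReal (integrable_normSq hf)
    (ae_of_all _ fun _ => by positivity)]
  congr 1 with x
  rw [← ofReal_norm, ENNReal.ofReal_pow (norm_nonneg _)]

theorem memLp_two_of_lintegral {f : Space n → ℂ} (hf : AEStronglyMeasurable f volume)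
    (h : ∫⁻ x, ‖f x‖ₑ ^ 2 < ⊤) : MemLp f 2 volume := by
  refine ⟨hf, ?_⟩
  rw [eLpNorm_lt_top_iff_lintegral_rpow_enorm_lt_top (by simp) (by simp)]
  simpa using h

theorem mass_le_of_lintegral {f : Space n → ℂ} {C : ℝ} (hC : 0 ≤ C)
    (hf : AEStronglyMeasurable f volume)
    (h : ∫⁻ x, ‖f x‖ₑ ^ 2 ≤ ENNReal.ofReal C) : mass f ≤ C := by
  have hm := memLp_two_of_lintegral hf (h.trans_lt ENNReal.ofReal_lt_top)
  rw [lintegral_enorm_sq hm] at h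
  exact (ENNReal.ofReal_le_ofReal_iff hC).1 h

/-- Minkowski's integral inequality in its simplest form: averaging over a probability measure
does not increase the squared `L²` norm. -/
theorem lintegral_enorm_integral_sq_le {Y : Type*} [MeasurableSpace Y] {ν : Measure Y}
    [IsProbabilityMeasure ν] {F : Space n → Y → ℂ}
    (hF : AEStronglyMeasurable (Function.uncurry F) (volume.prod ν)) :
    ∫⁻ x, ‖∫ y, F x y ∂ν‖ₑ ^ 2 ≤ ∫⁻ y, ∫⁻ x, ‖F x y‖ₑ ^ 2 ∂volume ∂ν := by
  have key : ∀ᵐ x, ‖∫ y, F x y ∂ν‖ₑ ^ 2 ≤ ∫⁻ y, ‖F x y‖ₑ ^ 2 ∂ν := by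
    filter_upwards [hF.prodMk_left] with x hx
    have h1 : ‖∫ y, F x y ∂ν‖ₑ ≤ eLpNorm (F x) 2 ν :=
      (enorm_integral_le_lintegral_enorm _).trans (by
        rw [← eLpNorm_one_eq_lintegral_enorm]
        exact eLpNorm_le_eLpNorm_of_exponent_le (by norm_num) hx)
    calc ‖∫ y, F x y ∂ν‖ₑ ^ 2 ≤ eLpNorm (F x) 2 ν ^ 2 := by gcongr
      _ = _ := by
        rw [eLpNorm_eq_lintegral_rpow_enorm_toReal (by simp) (by simp), ← ENNReal.rpow_natCast,
          ← ENNReal.rpow_mul]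
        simp
  refine (lintegral_mono_ae key).trans_eq ?_
  exact lintegral_lintegral_swap (hF.enorm.pow_const 2)

/-! ### Weak convergence in `L²` -/

/-- Weak convergence of a sequence in `L²`. -/
def WeakLim (u : ℕ → Space n → ℂ) (f : Space n → ℂ) : Prop :=
  ∀ g, MemLp g 2 volume → Tendsto (fun k => reInner (u k) g) atTop (𝓝 (reInner f g))

/-- Bounded sequences of `L²` have weakly convergent subsequences: sequential Banach--Alaoglu for the
separable Hilbert space `L²`, identified with its dual. -/
theorem exists_weakLim {u : ℕ → Space n → ℂ} {C : ℝ} (hu : ∀ k, MemLp (u k) 2 volume)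
    (hC : ∀ k, mass (u k) ≤ C) :
    ∃ f, MemLp f 2 volume ∧ ∃ s : ℕ → ℕ, StrictMono s ∧ WeakLim (fun k => u (s k)) f := by
  let E := Lp ℂ 2 (volume : Measure (Space n))
  let D := InnerProductSpace.toDual ℝ E
  have : Fact ((1 : ℝ≥0∞) ≤ 2) := ⟨by norm_num⟩
  have : Fact ((2 : ℝ≥0∞) ≠ ⊤) := ⟨by norm_num⟩
  have hb : ∀ k, WeakDual.toStrongDual.symm (D (hu k).toLp) ∈
      WeakDual.toStrongDual ⁻¹' Metric.closedBall (0 : StrongDual ℝ E) (√C) := by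
    intro k
    simp only [Set.mem_preimage, LinearEquiv.apply_symm_apply, mem_closedBall_zero_iff]
    rw [LinearIsometryEquiv.norm_map, norm_toLp_eq_sqrt]
    exact Real.sqrt_le_sqrt (hC k)
  obtain ⟨l, -, s, hs, hl⟩ := WeakDual.isSeqCompact_closedBall ℝ E 0 (√C) hb
  let f : E := D.symm (WeakDual.toStrongDual l)
  refine ⟨f, Lp.memLp f, s, hs, fun g hg => ?_⟩
  have h1 := (WeakDual.eval_continuous (hg.toLp)).tendsto l |>.comp hl
  have h2 : ∀ k, reInner (u k) g = D (hu k).toLp hg.toLp := fun k => by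
    rw [InnerProductSpace.toDual_apply_apply, inner_toLp]
  have h3 : reInner f g = l hg.toLp := by
    have : l hg.toLp = inner ℝ f hg.toLp := by
      rw [← InnerProductSpace.toDual_apply_apply (𝕜 := ℝ)]
      simp only [f]
      erw [LinearIsometryEquiv.apply_symm_apply]
      rfl
    rw [this]
    conv_rhs => rw [← Lp.toLp_coeFn f (Lp.memLp f)]
    rw [inner_toLp]
  simp only [h2, h3]
  exact h1

/-- A bounded sequence of `L²` whose squared norms on all balls tend to zero converges weakly
to zero. -/
theorem WeakLim.of_local {r : ℕ → Space n → ℂ} {C : ℝ} (hr : ∀ k, MemLp (r k) 2 volume)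
    (hC : ∀ k, mass (r k) ≤ C)
    (hloc : ∀ R : ℝ, Tendsto (fun k => ∫ x in Metric.ball 0 R, ‖r k x‖ ^ 2) atTop (𝓝 0)) :
    WeakLim r 0 := by
  intro g hg
  have hC0 : 0 ≤ C := (mass_nonneg _).trans (hC 0)
  have hz : reInner (0 : Space n → ℂ) g = 0 := by simp [reInner]
  rw [hz, Metric.tendsto_atTop]
  intro ε hε
  -- the tail of `g`
  have htail : Tendsto (fun R : ℕ => ∫ x in (Metric.ball (0 : Space n) R)ᶜ, ‖g x‖ ^ 2) atTop
      (𝓝 0) := by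
    have := tendsto_setIntegral_of_antitone (μ := volume) (f := fun x => ‖g x‖ ^ 2)
      (s := fun R : ℕ => (Metric.ball (0 : Space n) R)ᶜ)
      (fun R => Metric.isOpen_ball.measurableSet.compl)
      (fun a b hab => Set.compl_subset_compl.2 (Metric.ball_subset_ball (by exact_mod_cast hab)))
      ⟨0, (integrable_normSq hg).integrableOn⟩
    have he : (⋂ R : ℕ, (Metric.ball (0 : Space n) R)ᶜ) = ∅ := by
      ext x
      simp only [Set.mem_iInter, Set.mem_compl_iff, Metric.mem_ball, dist_zero_right,
        Set.mem_empty_iff_false, iff_false, not_forall, not_not]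
      exact exists_nat_gt _
    simpa [he] using this
  set δ : ℝ := (ε / (4 * (√C + √(mass g) + 1))) ^ 2 with hδ
  have hden : 0 < 4 * (√C + √(mass g) + 1) := by positivity
  have hδ0 : 0 < δ := by positivity
  obtain ⟨R, hR⟩ := (htail.eventually (gt_mem_nhds hδ0)).exists
  have hloc' := (hloc R).eventually (gt_mem_nhds hδ0)
  obtain ⟨N, hN⟩ := eventually_atTop.1 hloc'
  refine ⟨N, fun k hk => ?_⟩
  rw [dist_zero_right, Real.norm_eq_abs]
  set B := Metric.ball (0 : Space n) R
  -- local smallness handles the ball, the tail of `g` its complement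
  have hB : MeasurableSet B := Metric.isOpen_ball.measurableSet
  have hsplit : reInner (r k) g = reInner (B.indicator (r k)) g + reInner (r k) (Bᶜ.indicator g) := by
    unfold reInner
    rw [← integral_add (integrable_inner ((hr k).indicator hB) hg)
      (integrable_inner (hr k) (hg.indicator hB.compl))]
    congr 1 with x
    by_cases hx : x ∈ B <;> simp [hx]
  have hm1 : mass (B.indicator (r k)) = ∫ x in B, ‖r k x‖ ^ 2 := by
    rw [← integral_indicator hB]
    unfold mass
    congr 1 with x
    by_cases hx : x ∈ B <;> simp [hx]
  have hm2 : mass (Bᶜ.indicator g) = ∫ x in Bᶜ, ‖g x‖ ^ 2 := by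
    rw [← integral_indicator hB.compl]
    unfold mass
    congr 1 with x
    by_cases hx : x ∈ B <;> simp [hx]
  have h1 := abs_reInner_le ((hr k).indicator hB) hg
  have h2 := abs_reInner_le (hr k) (hg.indicator hB.compl)
  have hs1 : √(mass (B.indicator (r k))) ≤ √δ := by
    rw [hm1]; exact Real.sqrt_le_sqrt (hN k hk).le
  have hs2 : √(mass (Bᶜ.indicator g)) ≤ √δ := by
    rw [hm2]; exact Real.sqrt_le_sqrt hR.le
  have hsC : √(mass (r k)) ≤ √C := Real.sqrt_le_sqrt (hC k)
  have hsd : √δ = ε / (4 * (√C + √(mass g) + 1)) := Real.sqrt_sq (by positivity)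
  have hsd' : √δ * (4 * (√C + √(mass g) + 1)) = ε := by rw [hsd]; field_simp
  calc |reInner (r k) g| ≤ |reInner (B.indicator (r k)) g| + |reInner (r k) (Bᶜ.indicator g)| := by
        rw [hsplit]; exact abs_add_le _ _
    _ ≤ √δ * √(mass g) + √C * √δ := by
        refine add_le_add (h1.trans (by gcongr)) (h2.trans (by gcongr))
    _ < ε := by nlinarith [Real.sqrt_nonneg δ, Real.sqrt_nonneg C, Real.sqrt_nonneg (mass g)]

/-- Weak convergence of a bounded sequence may be tested on smooth compactly supported functions. -/
theorem WeakLim.of_test {r : ℕ → Space n → ℂ} {C : ℝ} (hr : ∀ k, MemLp (r k) 2 volume)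
    (hC : ∀ k, mass (r k) ≤ C)
    (htest : ∀ f : Space n → ℂ, ContDiff ℝ ∞ f → HasCompactSupport f →
      Tendsto (fun k => reInner (r k) f) atTop (𝓝 0)) : WeakLim r 0 := by
  intro g hg
  have hC0 : 0 ≤ C := (mass_nonneg _).trans (hC 0)
  have hz : reInner (0 : Space n → ℂ) g = 0 := by simp [reInner]
  rw [hz, Metric.tendsto_atTop]
  intro ε hε
  -- approximation of `g` by a test function
  obtain ⟨f, hfc, hfs, hfg⟩ := hg.exist_eLpNorm_sub_le (by simp) (by norm_num)
    (ε := ε / (2 * (√C + 1))) (by positivity)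
  have hf : MemLp f 2 volume := hfs.continuous.memLp_of_hasCompactSupport hfc
  obtain ⟨N, hN⟩ := Metric.tendsto_atTop.1 (htest f hfs hfc) (ε / 2) (by positivity)
  refine ⟨N, fun k hk => ?_⟩
  have h1 := hN k hk
  rw [dist_zero_right, Real.norm_eq_abs] at h1 ⊢
  have hd : √(mass (g - f)) ≤ ε / (2 * (√C + 1)) := by
    rw [← norm_toLp_eq_sqrt (hg.sub hf), Lp.norm_toLp]
    exact ENNReal.toReal_le_of_le_ofReal (by positivity) hfg
  have h2 := abs_reInner_le (hr k) (hg.sub hf)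
  have hsC : √(mass (r k)) ≤ √C := Real.sqrt_le_sqrt (hC k)
  have hsplit : reInner (r k) g = reInner (r k) f + reInner (r k) (g - f) := by
    have := reInner_add_left hf (hg.sub hf) (hr k)
    rw [add_sub_cancel] at this
    rw [reInner_comm, this, reInner_comm f, reInner_comm (g - f)]
  have h3 : √C * (ε / (2 * (√C + 1))) ≤ ε / 2 := by
    rw [mul_div_assoc', div_le_div_iff₀ (by positivity) (by norm_num)]
    nlinarith [Real.sqrt_nonneg C]
  calc |reInner (r k) g| ≤ |reInner (r k) f| + |reInner (r k) (g - f)| := by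
        rw [hsplit]; exact abs_add_le _ _
    _ ≤ |reInner (r k) f| + √C * (ε / (2 * (√C + 1))) := by
        gcongr; exact h2.trans (by gcongr)
    _ < ε := by linarith

/-- The squared norm splits along a weak limit. -/
theorem tendsto_mass_add_sub {P : Space n → ℂ} {r : ℕ → Space n → ℂ} (hP : MemLp P 2 volume)
    (hr : ∀ k, MemLp (r k) 2 volume) (hw : WeakLim r 0) :
    Tendsto (fun k => mass (P + r k) - mass (r k)) atTop (𝓝 (mass P)) := by
  have h := (hw P hP).const_mul 2 |>.const_add (mass P)
  have hz : reInner (0 : Space n → ℂ) P = 0 := by simp [reInner]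
  rw [hz] at h
  simp only [mul_zero, add_zero] at h
  refine h.congr fun k => ?_
  rw [mass_add hP (hr k), reInner_comm]
  ring

/-- Weak lower semicontinuity of the norm, by testing against the limit itself. -/
theorem mass_le_of_weakLim {u : ℕ → Space n → ℂ} {f : Space n → ℂ} {C : ℝ}
    (hu : ∀ k, MemLp (u k) 2 volume) (hC : ∀ k, mass (u k) ≤ C) (hf : MemLp f 2 volume)
    (hw : WeakLim u f) : mass f ≤ C := by
  have h : mass f ≤ √C * √(mass f) := by
    refine le_of_tendsto (f := fun k => reInner (u k) f) (by simpa [reInner_self] using hw f hf)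
      (Eventually.of_forall fun k => ?_)
    refine (le_abs_self _).trans ((abs_reInner_le (hu k) hf).trans ?_)
    gcongr
    exact hC k
  have hC0 : 0 ≤ C := (mass_nonneg _).trans (hC 0)
  by_contra hlt
  push Not at hlt
  have h1 := Real.sqrt_lt_sqrt hC0 hlt
  have h2 := Real.mul_self_sqrt (mass_nonneg f)
  nlinarith [Real.sqrt_nonneg C]

/-! ### Complex pairings -/

theorem inner_eq_re_mul_conj (z w : ℂ) : (inner ℝ z w : ℝ) = (z * conj w).re := by
  rw [Complex.inner]
  simp [Complex.mul_re]
  ring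

theorem integrable_mul {f g : Space n → ℂ} (hf : MemLp f 2 volume) (hg : MemLp g 2 volume) :
    Integrable (fun x => f x * g x) := hf.integrable_mul hg

theorem memLp_conj {f : Space n → ℂ} {p : ℝ≥0∞} (hf : MemLp f p volume) :
    MemLp (fun x => conj (f x)) p volume := hf.star

/-- The real and imaginary parts of `∫ f g` as real inner products. -/
theorem integral_mul_eq {f g : Space n → ℂ} (hf : MemLp f 2 volume) (hg : MemLp g 2 volume) :
    ∫ x, g x * f x = (reInner f (fun x => conj (g x)) : ℂ)
      + (reInner f (fun x => conj (-Complex.I * g x)) : ℂ) * Complex.I := by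
  have h1 : reInner f (fun x => conj (g x)) = (∫ x, g x * f x).re := by
    rw [← RCLike.re_eq_complex_re, ← integral_re (integrable_mul hg hf)]
    refine integral_congr_ae (ae_of_all _ fun x => ?_)
    simp only [inner_eq_re_mul_conj, Complex.conj_conj, mul_comm (f x)]; rfl
  have h2 : reInner f (fun x => conj (-Complex.I * g x)) = (∫ x, g x * f x).im := by
    rw [← RCLike.im_eq_complex_im, ← integral_im (integrable_mul hg hf)]
    refine integral_congr_ae (ae_of_all _ fun x => ?_)
    simp only [inner_eq_re_mul_conj, Complex.conj_conj]
    simp [Complex.mul_re, Complex.mul_im]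
    ring
  rw [h1, h2, Complex.re_add_im]

theorem WeakLim.tendsto_integral_mul {u : ℕ → Space n → ℂ} {U h : Space n → ℂ}
    (hw : WeakLim u U) (hu : ∀ k, MemLp (u k) 2 volume) (hU : MemLp U 2 volume)
    (hh : MemLp h 2 volume) :
    Tendsto (fun k => ∫ x, h x * u k x) atTop (𝓝 (∫ x, h x * U x)) := by
  have h1 := hw _ (memLp_conj hh)
  have h2 := hw _ (memLp_conj (hh.const_mul (-Complex.I)))
  rw [integral_mul_eq hU hh]
  simp only [fun k => integral_mul_eq (hu k) hh]
  exact (Complex.continuous_ofReal.tendsto _ |>.comp h1).add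
    ((Complex.continuous_ofReal.tendsto _ |>.comp h2).mul_const _)

/-! ### Test functions -/

theorem continuous_partialDeriv {F : Type*} [NormedAddCommGroup F] [NormedSpace ℝ F] (i : Fin n)
    {f : Space n → F} (hf : ContDiff ℝ 1 f) : Continuous (partialDeriv i f) :=
  (hf.continuous_fderiv (by norm_num)).clm_apply continuous_const

theorem contDiff_partialDeriv {F : Type*} [NormedAddCommGroup F] [NormedSpace ℝ F] (i : Fin n)
    {f : Space n → F} (hf : ContDiff ℝ ∞ f) : ContDiff ℝ ∞ (partialDeriv i f) :=
  (hf.fderiv_right (m := ∞) (by norm_num)).clm_apply contDiff_const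

theorem hasCompactSupport_partialDeriv {F : Type*} [NormedAddCommGroup F] [NormedSpace ℝ F]
    (i : Fin n) {f : Space n → F} (hf : HasCompactSupport f) :
    HasCompactSupport (partialDeriv i f) := hf.fderiv_apply ℝ _

theorem memLp_test {F : Type*} [NormedAddCommGroup F] {p : ℝ≥0∞} {f : Space n → F}
    (hf : Continuous f) (hc : HasCompactSupport f) : MemLp f p volume :=
  hf.memLp_of_hasCompactSupport hc

theorem integrable_test_smul {u : Space n → ℂ} {f : Space n → ℝ} (hu : LocallyIntegrable u volume)
    (hf : Continuous f) (hc : HasCompactSupport f) : Integrable (fun x => f x • u x) := by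
  exact hu.integrable_smul_left_of_hasCompactSupport hf hc

/-! ### Calculus of weak partial derivatives -/

theorem HasWeakPartial.unique {i : Fin n} {u g g' : Space n → ℂ} (h : HasWeakPartial i u g)
    (h' : HasWeakPartial i u g') : g =ᵐ[volume] g' :=
  ae_eq_of_integral_contDiff_smul_eq h.2.1 h'.2.1 fun f hf hc => by
    have h1 := h.2.2 f hf hc
    rw [h'.2.2 f hf hc] at h1
    exact (neg_injective h1).symm

theorem HasWeakPartial.weakPartial_ae {i : Fin n} {u g : Space n → ℂ} (h : HasWeakPartial i u g) :
    weakPartial i u =ᵐ[volume] g := (hasWeakPartial_weakPartial ⟨g, h⟩).unique h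

theorem HasWeakPartial.add {i : Fin n} {u v g h : Space n → ℂ} (hu : HasWeakPartial i u g)
    (hv : HasWeakPartial i v h) : HasWeakPartial i (u + v) (g + h) := by
  refine ⟨hu.1.add hv.1, hu.2.1.add hv.2.1, fun f hf hc => ?_⟩
  have hd := hasCompactSupport_partialDeriv i hc
  have hdc := continuous_partialDeriv i (hf.of_le (by norm_num) : ContDiff ℝ 1 f)
  simp only [Pi.add_apply, smul_add]
  rw [integral_add (integrable_test_smul hu.1 hdc hd) (integrable_test_smul hv.1 hdc hd),
    integral_add (integrable_test_smul hu.2.1 hf.continuous hc)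
      (integrable_test_smul hv.2.1 hf.continuous hc), hu.2.2 f hf hc, hv.2.2 f hf hc, neg_add]

theorem HasWeakPartial.smul {i : Fin n} {u g : Space n → ℂ} (c : ℂ) (hu : HasWeakPartial i u g) :
    HasWeakPartial i (c • u) (c • g) := by
  refine ⟨hu.1.smul c, hu.2.1.smul c, fun f hf hc => ?_⟩
  simp only [Pi.smul_apply]
  simp_rw [smul_comm _ c]
  rw [integral_smul, integral_smul, hu.2.2 f hf hc, smul_neg]

theorem locallyIntegrable_comp_add {u : Space n → ℂ} (hu : LocallyIntegrable u volume)
    (y : Space n) : LocallyIntegrable (fun x => u (x + y)) volume := by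
  rw [locallyIntegrable_iff] at hu ⊢
  intro K hK
  have h1 := hu _ (hK.image (continuous_add_const y))
  have hmp := measurePreserving_add_right (volume : Measure (Space n)) y
  have h2 := (hmp.integrableOn_comp_preimage (Homeomorph.addRight y).measurableEmbedding
    (f := u) (s := (fun x => x + y) '' K)).2 h1
  rwa [Set.preimage_image_eq _ (add_left_injective y)] at h2

theorem HasWeakPartial.comp_add {i : Fin n} {u g : Space n → ℂ} (hu : HasWeakPartial i u g)
    (y : Space n) : HasWeakPartial i (fun x => u (x + y)) (fun x => g (x + y)) := by
  refine ⟨locallyIntegrable_comp_add hu.1 y, locallyIntegrable_comp_add hu.2.1 y,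
    fun f hf hc => ?_⟩
  have h1 := hu.2.2 (fun x => f (x - y)) (hf.comp (contDiff_id.sub contDiff_const))
    (hc.comp_homeomorph (Homeomorph.subRight y))
  have hd : ∀ x, partialDeriv i (fun x => f (x - y)) x = partialDeriv i f (x - y) := fun x => by
    unfold partialDeriv
    rw [fderiv_comp_sub]
  simp only [hd] at h1
  rw [← integral_add_right_eq_self _ y, ← integral_add_right_eq_self (fun x => f (x - y) • g x) y]
    at h1
  simpa using h1

/-- The Leibniz rule against a smooth real factor. -/
theorem HasWeakPartial.smooth_smul {i : Fin n} {u g : Space n → ℂ} {η : Space n → ℝ}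
    (hu : HasWeakPartial i u g) (hη : ContDiff ℝ ∞ η) :
    HasWeakPartial i (fun x => η x • u x) (fun x => η x • g x + partialDeriv i η x • u x) := by
  have hη1 : ContDiff ℝ 1 η := hη.of_le (by norm_num)
  refine ⟨hu.1.continuous_smul hη.continuous, (hu.2.1.continuous_smul hη.continuous).add
    (hu.1.continuous_smul (continuous_partialDeriv i hη1)), fun f hf hc => ?_⟩
  have h1 := hu.2.2 (fun x => f x * η x) (hf.mul hη) hc.mul_right
  have hd : ∀ x, partialDeriv i (fun x => f x * η x) x
      = partialDeriv i f x * η x + f x * partialDeriv i η x := fun x => by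
    unfold partialDeriv
    rw [fderiv_fun_mul (hf.differentiable (by norm_num) x) (hη.differentiable (by norm_num) x)]
    simp; ring
  have hf1 : ContDiff ℝ 1 f := hf.of_le (by norm_num)
  have i1 : Integrable (fun x => (partialDeriv i f x * η x) • u x) :=
    integrable_test_smul hu.1 ((continuous_partialDeriv i hf1).mul hη.continuous)
      (hasCompactSupport_partialDeriv i hc).mul_right
  have i2 : Integrable (fun x => (f x * partialDeriv i η x) • u x) :=
    integrable_test_smul hu.1 (hf.continuous.mul (continuous_partialDeriv i hη1)) hc.mul_right
  have i3 : Integrable (fun x => (f x * η x) • g x) :=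
    integrable_test_smul hu.2.1 (hf.continuous.mul hη.continuous) hc.mul_right
  simp only [hd, add_smul] at h1
  rw [integral_add i1 i2] at h1
  simp only [smul_add, ← mul_smul]
  rw [integral_add i3 i2, neg_add, ← h1]
  abel

theorem hasWeakPartial_of_contDiff {u : Space n → ℂ} (i : Fin n) (hu : ContDiff ℝ 1 u) :
    HasWeakPartial i u (partialDeriv i u) := by
  have hc1 := continuous_partialDeriv i hu
  refine ⟨hu.continuous.locallyIntegrable, hc1.locallyIntegrable, fun f hf hc => ?_⟩
  have hf1 : ContDiff ℝ 1 f := hf.of_le (by norm_num)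
  have h := integral_bilinear_fderiv_right_eq_neg_left_of_integrable (μ := volume)
    (B := ContinuousLinearMap.lsmul ℝ ℝ (E := ℂ)) (f := f) (g := u)
    (v := EuclideanSpace.single i 1)
    (integrable_test_smul hu.continuous.locallyIntegrable (continuous_partialDeriv i hf1)
      (hasCompactSupport_partialDeriv i hc))
    (integrable_test_smul hc1.locallyIntegrable hf.continuous hc)
    (integrable_test_smul hu.continuous.locallyIntegrable hf.continuous hc)
    (fun x _ => hf1.differentiable (by norm_num) x) (fun x _ => hu.differentiable (by norm_num) x)
  simp only [ContinuousLinearMap.lsmul_apply] at h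
  unfold partialDeriv
  rw [h, neg_neg]

theorem partialDeriv_re {f : Space n → ℂ} (hf : Differentiable ℝ f) (i : Fin n) (x : Space n) :
    partialDeriv i (fun x => (f x).re) x = (partialDeriv i f x).re := by
  have := (Complex.reCLM.hasFDerivAt.comp x (hf x).hasFDerivAt).fderiv
  unfold partialDeriv
  erw [this]
  rfl

theorem partialDeriv_im {f : Space n → ℂ} (hf : Differentiable ℝ f) (i : Fin n) (x : Space n) :
    partialDeriv i (fun x => (f x).im) x = (partialDeriv i f x).im := by
  have := (Complex.imCLM.hasFDerivAt.comp x (hf x).hasFDerivAt).fderiv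
  unfold partialDeriv
  erw [this]
  rfl

theorem partialDeriv_conj {f : Space n → ℂ} (hf : Differentiable ℝ f) (i : Fin n) (x : Space n) :
    partialDeriv i (fun x => conj (f x)) x = conj (partialDeriv i f x) := by
  have := ((Complex.conjCLE : ℂ →L[ℝ] ℂ).hasFDerivAt.comp x (hf x).hasFDerivAt).fderiv
  unfold partialDeriv
  erw [this]
  rfl

theorem HasWeakPartial.test_complex {i : Fin n} {u g : Space n → ℂ} (hu : HasWeakPartial i u g)
    {f : Space n → ℂ} (hf : ContDiff ℝ ∞ f) (hc : HasCompactSupport f) :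
    ∫ x, partialDeriv i f x * u x = - ∫ x, f x * g x := by
  have hd := hf.differentiable (by norm_num)
  have hf1 : ContDiff ℝ 1 f := hf.of_le (by norm_num)
  have hre : ContDiff ℝ ∞ (fun x => (f x).re) := Complex.reCLM.contDiff.comp hf
  have him : ContDiff ℝ ∞ (fun x => (f x).im) := Complex.imCLM.contDiff.comp hf
  have hrec : HasCompactSupport (fun x => (f x).re) := hc.comp_left (g := Complex.re) rfl
  have himc : HasCompactSupport (fun x => (f x).im) := hc.comp_left (g := Complex.im) rfl
  have h1 := hu.2.2 _ hre hrec
  have h2 := hu.2.2 _ him himc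
  have key : ∀ (F v : Space n → ℂ), Continuous F → HasCompactSupport F →
      LocallyIntegrable v volume → ∫ x, F x * v x =
        (∫ x, (F x).re • v x) + (∫ x, (F x).im • v x) * Complex.I := by
    intro F v hF hFc hv
    have i1 : Integrable (fun x => (F x).re • v x) := integrable_test_smul hv
      (Complex.continuous_re.comp hF) (hFc.comp_left (g := Complex.re) rfl)
    have i2 : Integrable (fun x => (F x).im • v x) := integrable_test_smul hv
      (Complex.continuous_im.comp hF) (hFc.comp_left (g := Complex.im) rfl)
    rw [← integral_mul_const, ← integral_add i1 (i2.mul_const _)]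
    congr 1 with x
    conv_lhs => rw [← Complex.re_add_im (F x)]
    simp only [Complex.real_smul]
    ring
  rw [key _ _ (continuous_partialDeriv i hf1) (hasCompactSupport_partialDeriv i hc) hu.1,
    key _ _ hf.continuous hc hu.2.1]
  simp only [partialDeriv_re hd, partialDeriv_im hd] at h1 h2
  rw [h1, h2]
  ring

/-- Weak limits of functions with bounded weak derivatives have a weak derivative obeying the
same bound. -/
theorem exists_hasWeakPartial_of_weakLim {i : Fin n} {u g : ℕ → Space n → ℂ} {U : Space n → ℂ}
    {C : ℝ} (hu : ∀ k, MemLp (u k) 2 volume) (hg : ∀ k, MemLp (g k) 2 volume)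
    (hug : ∀ k, HasWeakPartial i (u k) (g k)) (hC : ∀ k, mass (g k) ≤ C)
    (hU : MemLp U 2 volume) (hw : WeakLim u U) :
    ∃ G, HasWeakPartial i U G ∧ MemLp G 2 volume ∧ mass G ≤ C := by
  obtain ⟨G, hG, s, hs, hGw⟩ := exists_weakLim hg hC
  refine ⟨G, ⟨hU.locallyIntegrable (by norm_num), hG.locallyIntegrable (by norm_num),
    fun f hf hc => ?_⟩, hG, mass_le_of_weakLim (fun k => hg (s k)) (fun k => hC _) hG hGw⟩
  have hf1 : ContDiff ℝ 1 f := hf.of_le (by norm_num)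
  have m1 : MemLp (fun x => ((partialDeriv i f x : ℝ) : ℂ)) 2 volume :=
    memLp_test (Complex.continuous_ofReal.comp (continuous_partialDeriv i hf1))
      ((hasCompactSupport_partialDeriv i hc).comp_left (g := fun t : ℝ => (t : ℂ)) rfl)
  have m2 : MemLp (fun x => (f x : ℂ)) 2 volume :=
    memLp_test (Complex.continuous_ofReal.comp hf.continuous)
      (hc.comp_left (g := fun t : ℝ => (t : ℂ)) rfl)
  have t1 := (hw.tendsto_integral_mul hu hU m1).comp hs.tendsto_atTop
  have t2 := (hGw.tendsto_integral_mul (fun k => hg (s k)) hG m2).neg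
  simp only [Complex.real_smul]
  refine tendsto_nhds_unique t1 (t2.congr fun k => ?_)
  have := (hug (s k)).2.2 f hf hc
  simp only [Complex.real_smul] at this
  exact this.symm

/-! ### The space `H¹` -/

theorem MemH1.hasWeakPartial {u : Space n → ℂ} (hu : MemH1 u) (i : Fin n) :
    HasWeakPartial i u (weakPartial i u) := by
  obtain ⟨g, hg, -⟩ := hu.2 i
  exact hasWeakPartial_weakPartial ⟨g, hg⟩

theorem MemH1.memLp_weakPartial {u : Space n → ℂ} (hu : MemH1 u) (i : Fin n) :
    MemLp (weakPartial i u) 2 volume := by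
  obtain ⟨g, hg, hg2⟩ := hu.2 i
  exact hg2.ae_eq hg.weakPartial_ae.symm

theorem MemH1.add {u v : Space n → ℂ} (hu : MemH1 u) (hv : MemH1 v) : MemH1 (u + v) :=
  ⟨hu.1.add hv.1, fun i => ⟨_, (hu.hasWeakPartial i).add (hv.hasWeakPartial i),
    (hu.memLp_weakPartial i).add (hv.memLp_weakPartial i)⟩⟩

theorem MemH1.smul {u : Space n → ℂ} (c : ℂ) (hu : MemH1 u) : MemH1 (c • u) :=
  ⟨hu.1.const_smul c, fun i => ⟨_, (hu.hasWeakPartial i).smul c,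
    (hu.memLp_weakPartial i).const_smul c⟩⟩

theorem weakPartial_add {u v : Space n → ℂ} (hu : MemH1 u) (hv : MemH1 v) (i : Fin n) :
    weakPartial i (u + v) =ᵐ[volume] weakPartial i u + weakPartial i v :=
  ((hu.hasWeakPartial i).add (hv.hasWeakPartial i)).weakPartial_ae

theorem weakPartial_smul {u : Space n → ℂ} (c : ℂ) (hu : MemH1 u) (i : Fin n) :
    weakPartial i (c • u) =ᵐ[volume] c • weakPartial i u :=
  ((hu.hasWeakPartial i).smul c).weakPartial_ae

theorem gradNormSq_eq (u : Space n → ℂ) : gradNormSq u = ∑ i, mass (weakPartial i u) := rfl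

theorem gradNormSq_nonneg (u : Space n → ℂ) : 0 ≤ gradNormSq u :=
  Finset.sum_nonneg fun _ _ => mass_nonneg _

theorem mass_weakPartial_le (u : Space n → ℂ) (i : Fin n) :
    mass (weakPartial i u) ≤ gradNormSq u :=
  Finset.single_le_sum (f := fun i => mass (weakPartial i u)) (fun _ _ => mass_nonneg _)
    (Finset.mem_univ i)

theorem gradNormSq_smul {u : Space n → ℂ} (c : ℂ) (hu : MemH1 u) :
    gradNormSq (c • u) = ‖c‖ ^ 2 * gradNormSq u := by
  rw [gradNormSq_eq, gradNormSq_eq, Finset.mul_sum]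
  exact Finset.sum_congr rfl fun i _ => by
    rw [mass_congr (weakPartial_smul c hu i), mass_smul]

/-- The polar form of `gradNormSq`. -/
def gradInner (u v : Space n → ℂ) : ℝ := ∑ i, reInner (weakPartial i u) (weakPartial i v)

theorem gradNormSq_add {u v : Space n → ℂ} (hu : MemH1 u) (hv : MemH1 v) :
    gradNormSq (u + v) = gradNormSq u + 2 * gradInner u v + gradNormSq v := by
  simp only [gradNormSq_eq, gradInner, Finset.mul_sum, ← Finset.sum_add_distrib]
  exact Finset.sum_congr rfl fun i _ => by
    rw [mass_congr (weakPartial_add hu hv i), mass_add (hu.memLp_weakPartial i)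
      (hv.memLp_weakPartial i)]

theorem mass_comp_add (u : Space n → ℂ) (y : Space n) : mass (fun x => u (x + y)) = mass u :=
  integral_add_right_eq_self (fun x => ‖u x‖ ^ 2) y

theorem memLp_comp_add {u : Space n → ℂ} {p : ℝ≥0∞} (hu : MemLp u p volume) (y : Space n) :
    MemLp (fun x => u (x + y)) p volume :=
  hu.comp_measurePreserving (measurePreserving_add_right volume y)

theorem MemH1.comp_add {u : Space n → ℂ} (hu : MemH1 u) (y : Space n) :
    MemH1 (fun x => u (x + y)) :=
  ⟨memLp_comp_add hu.1 y, fun i => ⟨_, (hu.hasWeakPartial i).comp_add y,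
    memLp_comp_add (hu.memLp_weakPartial i) y⟩⟩

theorem gradNormSq_comp_add {u : Space n → ℂ} (hu : MemH1 u) (y : Space n) :
    gradNormSq (fun x => u (x + y)) = gradNormSq u :=
  Finset.sum_congr rfl fun i _ => by
    have := mass_congr ((hu.hasWeakPartial i).comp_add y).weakPartial_ae
    rw [mass_comp_add] at this
    exact this

/-! ### Mollification -/

/-- The mollification of `u` by a normalized bump function. -/
def moll (ρ : ContDiffBump (0 : Space n)) (u : Space n → ℂ) : Space n → ℂ :=
  convolution (ρ.normed volume) u (ContinuousLinearMap.lsmul ℝ ℝ) volume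

/-- The probability measure with density a normalized bump function. -/
def bumpMeasure (ρ : ContDiffBump (0 : Space n)) : Measure (Space n) :=
  volume.withDensity fun y => ENNReal.ofReal (ρ.normed volume y)

theorem measurable_bumpDensity (ρ : ContDiffBump (0 : Space n)) :
    Measurable fun y => ENNReal.ofReal (ρ.normed volume y) :=
  ρ.continuous_normed.measurable.ennreal_ofReal

instance isProbabilityMeasure_bumpMeasure (ρ : ContDiffBump (0 : Space n)) :
    IsProbabilityMeasure (bumpMeasure ρ) := by
  constructor
  rw [bumpMeasure, withDensity_apply _ MeasurableSet.univ, Measure.restrict_univ,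
    ← ofReal_integral_eq_lintegral_ofReal ρ.integrable_normed (ae_of_all _ ρ.nonneg_normed),
    ρ.integral_normed, ENNReal.ofReal_one]

theorem ae_bumpMeasure_norm_lt (ρ : ContDiffBump (0 : Space n)) :
    ∀ᵐ y ∂bumpMeasure ρ, ‖y‖ < ρ.rOut := by
  rw [bumpMeasure, ae_withDensity_iff (measurable_bumpDensity ρ)]
  refine ae_of_all _ fun y hy => ?_
  have : y ∈ Function.support (ρ.normed volume) := by
    intro h
    exact hy (by rw [h, ENNReal.ofReal_zero])
  rw [ρ.support_normed_eq] at this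
  simpa using this

theorem integrable_normed_smul (ρ : ContDiffBump (0 : Space n)) {u : Space n → ℂ}
    (hu : LocallyIntegrable u volume) (x : Space n) :
    Integrable (fun y => ρ.normed volume y • u (x - y)) :=
  (ρ.hasCompactSupport_normed (μ := volume)).convolutionExists_left
    (ContinuousLinearMap.lsmul ℝ ℝ) ρ.continuous_normed hu x

theorem integrable_sub_bumpMeasure (ρ : ContDiffBump (0 : Space n)) {u : Space n → ℂ}
    (hu : LocallyIntegrable u volume) (x : Space n) :
    Integrable (fun y => u (x - y)) (bumpMeasure ρ) := by
  rw [bumpMeasure, integrable_withDensity_iff_integrable_smul' (measurable_bumpDensity ρ)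
    (ae_of_all _ fun _ => ENNReal.ofReal_lt_top)]
  simpa only [ENNReal.toReal_ofReal (ρ.nonneg_normed _)] using integrable_normed_smul ρ hu x

theorem moll_eq_integral (ρ : ContDiffBump (0 : Space n)) (u : Space n → ℂ) (x : Space n) :
    moll ρ u x = ∫ y, u (x - y) ∂bumpMeasure ρ := by
  rw [bumpMeasure, integral_withDensity_eq_integral_toReal_smul (measurable_bumpDensity ρ)
    (ae_of_all _ fun _ => ENNReal.ofReal_lt_top)]
  simp only [ENNReal.toReal_ofReal (ρ.nonneg_normed _)]
  rfl

theorem moll_eq_integral_swap (ρ : ContDiffBump (0 : Space n)) (u : Space n → ℂ) (x : Space n) :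
    moll ρ u x = ∫ y, ρ.normed volume (x - y) • u y :=
  convolution_eq_swap _

theorem contDiff_moll (ρ : ContDiffBump (0 : Space n)) {u : Space n → ℂ}
    (hu : LocallyIntegrable u volume) : ContDiff ℝ ∞ (moll ρ u) :=
  (ρ.hasCompactSupport_normed (μ := volume)).contDiff_convolution_left _ ρ.contDiff_normed hu

theorem aestronglyMeasurable_comp_sub {u : Space n → ℂ} (hu : AEStronglyMeasurable u volume)
    (ρ : ContDiffBump (0 : Space n)) :
    AEStronglyMeasurable (Function.uncurry fun x y => u (x - y))
      (volume.prod (bumpMeasure ρ)) :=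
  (hu.comp_quasiMeasurePreserving (quasiMeasurePreserving_sub volume (bumpMeasure ρ)) :)

theorem lintegral_moll_sq_le (ρ : ContDiffBump (0 : Space n)) {u : Space n → ℂ}
    (hu : AEStronglyMeasurable u volume) :
    ∫⁻ x, ‖moll ρ u x‖ₑ ^ 2 ≤ ∫⁻ x, ‖u x‖ₑ ^ 2 := by
  simp only [moll_eq_integral]
  refine (lintegral_enorm_integral_sq_le (aestronglyMeasurable_comp_sub hu ρ)).trans_eq ?_
  have h : ∀ y, ∫⁻ x, ‖u (x - y)‖ₑ ^ 2 = ∫⁻ x, ‖u x‖ₑ ^ 2 := fun y =>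
    lintegral_sub_right_eq_self (fun x => ‖u x‖ₑ ^ 2) y
  simp only [h, lintegral_const, measure_univ, mul_one]

theorem memLp_moll (ρ : ContDiffBump (0 : Space n)) {u : Space n → ℂ} (hu : MemLp u 2 volume) :
    MemLp (moll ρ u) 2 volume :=
  memLp_two_of_lintegral
    (contDiff_moll ρ (hu.locallyIntegrable (by norm_num))).continuous.aestronglyMeasurable
    ((lintegral_moll_sq_le ρ hu.1).trans_lt (by
      rw [lintegral_enorm_sq hu]; exact ENNReal.ofReal_lt_top))

theorem mass_moll_le (ρ : ContDiffBump (0 : Space n)) {u : Space n → ℂ} (hu : MemLp u 2 volume) :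
    mass (moll ρ u) ≤ mass u :=
  mass_le_of_lintegral (mass_nonneg _) (memLp_moll ρ hu).1
    ((lintegral_moll_sq_le ρ hu.1).trans_eq (lintegral_enorm_sq hu))

/-- Mollification commutes with weak differentiation. -/
theorem partialDeriv_moll (ρ : ContDiffBump (0 : Space n)) {u g : Space n → ℂ} {i : Fin n}
    (hu : HasWeakPartial i u g) (x : Space n) :
    partialDeriv i (moll ρ u) x = moll ρ g x := by
  have hρ : ContDiff ℝ ∞ (ρ.normed volume) := ρ.contDiff_normed
  have hρ1 : ContDiff ℝ 1 (ρ.normed volume) := hρ.of_le (by norm_num)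
  have hc := ρ.hasCompactSupport_normed (μ := volume)
  have h1 := (hc.hasFDerivAt_convolution_left (ContinuousLinearMap.lsmul ℝ ℝ) hρ1 hu.1 x).fderiv
  have hex : Integrable (fun t => (ContinuousLinearMap.lsmul ℝ ℝ).precompL (Space n)
      (fderiv ℝ (ρ.normed volume) t) (u (x - t))) :=
    (hc.fderiv ℝ).convolutionExists_left _ (hρ1.continuous_fderiv (by norm_num)) hu.1 x
  have h2 : partialDeriv i (moll ρ u) x = ∫ t, partialDeriv i (ρ.normed volume) t • u (x - t) := by
    unfold partialDeriv moll
    rw [h1, convolution, ContinuousLinearMap.integral_apply hex]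
    rfl
  have h3 := hu.2.2 (fun y => ρ.normed volume (x - y)) (hρ.comp (contDiff_const.sub contDiff_id))
    (hc.comp_homeomorph (Homeomorph.subLeft x))
  have hd : ∀ y, partialDeriv i (fun y => ρ.normed volume (x - y)) y
      = -partialDeriv i (ρ.normed volume) (x - y) := fun y => by
    have hh := ((hρ1.differentiable (by norm_num) (x - y)).hasFDerivAt.comp y
      ((hasFDerivAt_const x y).sub (hasFDerivAt_id y))).fderiv
    unfold partialDeriv
    erw [hh]
    simp
  simp only [hd, neg_smul, integral_neg, neg_inj] at h3
  rw [moll_eq_integral_swap, ← h3, h2,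
    ← integral_sub_left_eq_self (fun y => partialDeriv i (ρ.normed volume) y • u (x - y)) volume x]
  simp

/-- A sequence of bump functions whose supports shrink to the origin. -/
def bumpSeq (k : ℕ) : ContDiffBump (0 : Space n) where
  rIn := 1 / (2 * (k + 1))
  rOut := 1 / (k + 1)
  rIn_pos := by positivity
  rIn_lt_rOut := by
    apply one_div_lt_one_div_of_lt <;> nlinarith [(Nat.cast_nonneg k : (0 : ℝ) ≤ k)]

theorem ae_tendsto_moll {u : Space n → ℂ} (hu : LocallyIntegrable u volume) :
    ∀ᵐ x, Tendsto (fun k => moll (bumpSeq k) u x) atTop (𝓝 (u x)) := by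
  refine ContDiffBump.ae_convolution_tendsto_right_of_locallyIntegrable (φ := bumpSeq) (K := 2)
    tendsto_one_div_add_atTop_nhds_zero_nat (Eventually.of_forall fun k => ?_) hu
  simp only [bumpSeq]
  rw [one_div, one_div, mul_inv]
  linarith

theorem memLp_dirDeriv {u : Space n → ℂ} (hu : MemH1 u) (y : Space n) :
    MemLp (fun x => ∑ i, (y i : ℂ) * weakPartial i u x) 2 volume :=
  memLp_finsetSum _ fun i _ => (hu.memLp_weakPartial i).const_mul _

/-- The directional derivatives of a mollification are mollified weak directional derivatives. -/
theorem fderiv_moll (ρ : ContDiffBump (0 : Space n)) {u : Space n → ℂ} (hu : MemH1 u)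
    (x y : Space n) :
    fderiv ℝ (moll ρ u) x y = moll ρ (fun x => ∑ i, (y i : ℂ) * weakPartial i u x) x := by
  have hy : y = ∑ i, y i • (EuclideanSpace.single i 1 : Space n) := by
    have := (EuclideanSpace.basisFun (Fin n) ℝ).sum_repr y
    simpa using this.symm
  conv_lhs => rw [hy, map_sum]
  rw [moll_eq_integral, integral_finsetSum _ fun i _ =>
    ((integrable_sub_bumpMeasure ρ (hu.hasWeakPartial i).2.1 x).const_mul _)]
  refine Finset.sum_congr rfl fun i _ => ?_
  rw [map_smul, integral_const_mul, ← moll_eq_integral, ← partialDeriv_moll ρ (hu.hasWeakPartial i)]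
  simp [partialDeriv]

/-- For the smooth mollification the increment is the average of the derivative along the segment. -/
theorem lintegral_moll_translate_le (ρ : ContDiffBump (0 : Space n)) {u : Space n → ℂ}
    (hu : MemH1 u) (y : Space n) :
    ∫⁻ x, ‖moll ρ u (x + y) - moll ρ u x‖ₑ ^ 2
      ≤ ∫⁻ x, ‖∑ i, (y i : ℂ) * weakPartial i u x‖ₑ ^ 2 := by
  have hv : ContDiff ℝ ∞ (moll ρ u) := contDiff_moll ρ (hu.1.locallyIntegrable (by norm_num))
  have hv1 : Continuous (fderiv ℝ (moll ρ u)) := hv.continuous_fderiv (by norm_num)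
  let ν : Measure ℝ := volume.restrict (Set.Ioc 0 1)
  have : IsProbabilityMeasure ν := ⟨by simp [ν]⟩
  have hc : Continuous (Function.uncurry fun (x : Space n) (s : ℝ) =>
      fderiv ℝ (moll ρ u) (x + s • y) y) :=
    (hv1.comp (continuous_fst.add (continuous_snd.smul continuous_const))).clm_apply
      continuous_const
  have hftc : ∀ x, moll ρ u (x + y) - moll ρ u x
      = ∫ s, fderiv ℝ (moll ρ u) (x + s • y) y ∂ν := by
    intro x
    rw [← intervalIntegral.integral_of_le zero_le_one,
      intervalIntegral.integral_eq_sub_of_hasDerivAt (f := fun s : ℝ => moll ρ u (x + s • y))]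
    · simp
    · intro s _
      have h1 : HasDerivAt (fun s : ℝ => x + s • y) y s := by
        simpa using ((hasDerivAt_id s).smul_const y).const_add x
      exact (hv.differentiable (by norm_num) _).hasFDerivAt.comp_hasDerivAt s h1
    · exact (hc.comp (Continuous.prodMk_right x)).intervalIntegrable _ _
  simp only [hftc]
  refine (lintegral_enorm_integral_sq_le hc.aestronglyMeasurable).trans ?_
  have h : ∀ s : ℝ, ∫⁻ x, ‖fderiv ℝ (moll ρ u) (x + s • y) y‖ₑ ^ 2
      ≤ ∫⁻ x, ‖∑ i, (y i : ℂ) * weakPartial i u x‖ₑ ^ 2 := fun s => by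
    rw [lintegral_add_right_eq_self (fun x => ‖fderiv ℝ (moll ρ u) x y‖ₑ ^ 2)]
    simp only [fderiv_moll ρ hu]
    exact lintegral_moll_sq_le ρ (memLp_dirDeriv hu y).1
  refine (lintegral_mono h).trans_eq ?_
  simp

/-- The increments of an `H¹` function are controlled by its directional derivative. -/
theorem lintegral_translate_le {u : Space n → ℂ} (hu : MemH1 u) (y : Space n) :
    ∫⁻ x, ‖u (x + y) - u x‖ₑ ^ 2 ≤ ∫⁻ x, ‖∑ i, (y i : ℂ) * weakPartial i u x‖ₑ ^ 2 := by
  have hl := hu.1.locallyIntegrable (by norm_num)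
  have h1 := ae_tendsto_moll hl
  have h2 : ∀ᵐ x, Tendsto (fun k => moll (bumpSeq k) u (x + y)) atTop (𝓝 (u (x + y))) :=
    (measurePreserving_add_right volume y).quasiMeasurePreserving.ae h1
  have h3 : ∀ᵐ x, ‖u (x + y) - u x‖ₑ ^ 2
      = liminf (fun k => ‖moll (bumpSeq k) u (x + y) - moll (bumpSeq k) u x‖ₑ ^ 2) atTop := by
    filter_upwards [h1, h2] with x hx1 hx2
    exact (((ENNReal.continuous_pow 2).tendsto _).comp
      ((continuous_enorm.tendsto _).comp (hx2.sub hx1))).liminf_eq.symm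
  rw [lintegral_congr_ae h3]
  refine (lintegral_liminf_le fun k => ?_).trans ?_
  · have := (contDiff_moll (bumpSeq k) hl).continuous
    exact ((this.comp (continuous_add_const y)).sub this).measurable.enorm.pow_const 2
  · refine liminf_le_of_le (by isBoundedDefault) fun b hb => ?_
    obtain ⟨k, hk⟩ := hb.exists
    exact hk.trans (lintegral_moll_translate_le _ hu y)

theorem mass_dirDeriv_le {u : Space n → ℂ} (hu : MemH1 u) (y : Space n) :
    mass (fun x => ∑ i, (y i : ℂ) * weakPartial i u x) ≤ ‖y‖ ^ 2 * gradNormSq u := by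
  unfold mass gradNormSq
  rw [← integral_finsetSum _ fun i _ => integrable_normSq (hu.memLp_weakPartial i),
    ← integral_const_mul]
  refine integral_mono (integrable_normSq (memLp_dirDeriv hu y))
    ((integrable_finsetSum _ fun i _ => integrable_normSq (hu.memLp_weakPartial i)).const_mul _)
    fun x => ?_
  calc ‖∑ i, (y i : ℂ) * weakPartial i u x‖ ^ 2
      ≤ (∑ i, |y i| * ‖weakPartial i u x‖) ^ 2 := by
        gcongr
        refine (norm_sum_le _ _).trans_eq (Finset.sum_congr rfl fun i _ => ?_)
        rw [norm_mul, Complex.norm_real, Real.norm_eq_abs]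
    _ ≤ (∑ i, |y i| ^ 2) * ∑ i, ‖weakPartial i u x‖ ^ 2 := Finset.sum_mul_sq_le_sq_mul_sq _ _ _
    _ = ‖y‖ ^ 2 * ∑ i, ‖weakPartial i u x‖ ^ 2 := by
        rw [EuclideanSpace.norm_sq_eq]; simp

theorem lintegral_translate_le_grad {u : Space n → ℂ} (hu : MemH1 u) (y : Space n) :
    ∫⁻ x, ‖u (x + y) - u x‖ₑ ^ 2 ≤ ENNReal.ofReal (‖y‖ ^ 2 * gradNormSq u) := by
  refine (lintegral_translate_le hu y).trans ?_
  rw [lintegral_enorm_sq (memLp_dirDeriv hu y)]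
  exact ENNReal.ofReal_le_ofReal (mass_dirDeriv_le hu y)

/-- Mollification converges at the rate of the support radius, uniformly on bounded sets of `H¹`.
This is the source of compactness in `WeakLim.tendsto_local`. -/
theorem mass_sub_moll_le (ρ : ContDiffBump (0 : Space n)) {u : Space n → ℂ} (hu : MemH1 u) :
    mass (u - moll ρ u) ≤ ρ.rOut ^ 2 * gradNormSq u := by
  have hl := hu.1.locallyIntegrable (by norm_num)
  refine mass_le_of_lintegral (mul_nonneg (sq_nonneg _) (gradNormSq_nonneg u))
    (hu.1.sub (memLp_moll ρ hu.1)).1 ?_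
  have h1 : ∀ x, (u - moll ρ u) x = ∫ y, (u x - u (x - y)) ∂bumpMeasure ρ := fun x => by
    rw [integral_sub (integrable_const _) (integrable_sub_bumpMeasure ρ hl x), integral_const,
      Pi.sub_apply, moll_eq_integral]
    simp
  simp only [h1]
  refine (lintegral_enorm_integral_sq_le
    ((hu.1.1.comp_fst).sub (aestronglyMeasurable_comp_sub hu.1.1 ρ))).trans ?_
  have h2 : ∀ᵐ y ∂bumpMeasure ρ, ∫⁻ x, ‖u x - u (x - y)‖ₑ ^ 2
      ≤ ENNReal.ofReal (ρ.rOut ^ 2 * gradNormSq u) := by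
    filter_upwards [ae_bumpMeasure_norm_lt ρ] with y hy
    have h3 := lintegral_translate_le_grad hu (-y)
    have h4 : ∀ x, ‖u x - u (x - y)‖ₑ = ‖u (x + -y) - u x‖ₑ := fun x => by
      rw [← enorm_neg, neg_sub, sub_eq_add_neg x y]
    simp only [h4]
    refine h3.trans (ENNReal.ofReal_le_ofReal ?_)
    rw [norm_neg]
    have := gradNormSq_nonneg u
    gcongr
  refine (lintegral_mono_ae h2).trans_eq ?_
  simp

/-! ### Cutoff functions -/

/-- A smooth cutoff function at scale `R`, equal to `1` on the ball of radius `R`. -/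
def cutoff (R : ℝ) (x : Space n) : ℝ :=
  (⟨1, 2, one_pos, one_lt_two⟩ : ContDiffBump (0 : Space n)) (R⁻¹ • x)

theorem contDiff_cutoff (R : ℝ) : ContDiff ℝ ∞ (cutoff R : Space n → ℝ) :=
  (ContDiffBump.contDiff _).comp (contDiff_const_smul R⁻¹)

theorem hasCompactSupport_cutoff {R : ℝ} (hR : R ≠ 0) :
    HasCompactSupport (cutoff R : Space n → ℝ) :=
  (ContDiffBump.hasCompactSupport _).comp_homeomorph (Homeomorph.smulOfNeZero R⁻¹ (inv_ne_zero hR))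

theorem cutoff_nonneg (R : ℝ) (x : Space n) : 0 ≤ cutoff R x := ContDiffBump.nonneg _

theorem cutoff_le_one (R : ℝ) (x : Space n) : cutoff R x ≤ 1 := ContDiffBump.le_one _

theorem cutoff_eq_one {R : ℝ} (hR : 0 < R) {x : Space n} (hx : ‖x‖ ≤ R) : cutoff R x = 1 := by
  refine ContDiffBump.one_of_mem_closedBall _ ?_
  simp only [mem_closedBall_zero_iff, norm_smul, norm_inv, Real.norm_eq_abs, abs_of_pos hR]
  rw [inv_mul_le_iff₀ hR]
  simpa using hx

/-- The derivatives of `cutoff R` are `O(1 / R)`. -/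
theorem exists_partialDeriv_cutoff_le (n : ℕ) : ∃ M : ℝ, 0 ≤ M ∧ ∀ (i : Fin n) (R : ℝ), 0 < R →
    ∀ x : Space n, |partialDeriv i (cutoff R) x| ≤ M / R := by
  let b : ContDiffBump (0 : Space n) := ⟨1, 2, one_pos, one_lt_two⟩
  have hb : ContDiff ℝ 1 b := b.contDiff
  have hc : Continuous (fderiv ℝ b) := hb.continuous_fderiv (by norm_num)
  obtain ⟨M, hM⟩ := hc.bounded_above_of_compact_support (b.hasCompactSupport.fderiv ℝ)
  refine ⟨M, (norm_nonneg _).trans (hM 0), fun i R hR x => ?_⟩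
  have h1 : HasFDerivAt (cutoff R : Space n → ℝ)
      ((fderiv ℝ b (R⁻¹ • x)).comp (R⁻¹ • ContinuousLinearMap.id ℝ (Space n))) x :=
    (hb.differentiable (by norm_num) _).hasFDerivAt.comp x ((hasFDerivAt_id x).const_smul R⁻¹)
  rw [partialDeriv, h1.fderiv]
  simp only [ContinuousLinearMap.comp_apply, _root_.smul_apply,
    ContinuousLinearMap.id_apply, map_smul, smul_eq_mul, abs_mul, abs_inv, abs_of_pos hR]
  rw [mul_comm, ← div_eq_mul_inv]
  gcongr
  refine ((fderiv ℝ b (R⁻¹ • x)).le_opNorm _).trans ?_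
  simpa using hM (R⁻¹ • x)

theorem tendsto_cutoff (x : Space n) :
    Tendsto (fun k : ℕ => cutoff ((k : ℝ) + 1) x) atTop (𝓝 1) := by
  refine tendsto_const_nhds.congr' ?_
  obtain ⟨N, hN⟩ := exists_nat_ge ‖x‖
  filter_upwards [eventually_ge_atTop N] with k hk
  have : (N : ℝ) ≤ k := by exact_mod_cast hk
  exact (cutoff_eq_one (by positivity) (by linarith)).symm

/-! ### The Sobolev inequality in `H¹` -/

theorem norm_fderiv_sq_le (f : Space n → ℂ) (x : Space n) :
    ‖fderiv ℝ f x‖ ^ 2 ≤ ∑ i, ‖partialDeriv i f x‖ ^ 2 := by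
  have h : ‖fderiv ℝ f x‖ ≤ √(∑ i, ‖partialDeriv i f x‖ ^ 2) := by
    refine ContinuousLinearMap.opNorm_le_bound _ (Real.sqrt_nonneg _) fun y => ?_
    have hy : y = ∑ i, y i • (EuclideanSpace.single i 1 : Space n) := by
      have := (EuclideanSpace.basisFun (Fin n) ℝ).sum_repr y
      simpa using this.symm
    conv_lhs => rw [hy, map_sum]
    rw [EuclideanSpace.norm_eq, mul_comm]
    calc ‖∑ i, fderiv ℝ f x (y i • EuclideanSpace.single i 1)‖
        ≤ ∑ i, ‖y i‖ * ‖partialDeriv i f x‖ := by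
          refine (norm_sum_le _ _).trans_eq (Finset.sum_congr rfl fun i _ => ?_)
          rw [map_smul, norm_smul, partialDeriv]
      _ ≤ _ := Real.sum_mul_le_sqrt_mul_sqrt _ _ _
  calc ‖fderiv ℝ f x‖ ^ 2 ≤ √(∑ i, ‖partialDeriv i f x‖ ^ 2) ^ 2 := by gcongr
    _ = _ := Real.sq_sqrt (Finset.sum_nonneg fun _ _ => by positivity)

theorem eLpNorm_two_eq {F : Type*} [NormedAddCommGroup F] (f : Space n → F) :
    eLpNorm f 2 volume = (∫⁻ x, ‖f x‖ₑ ^ 2) ^ (1 / 2 : ℝ) := by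
  rw [eLpNorm_eq_lintegral_rpow_enorm_toReal (by simp) (by simp)]
  simp

theorem eLpNorm_fderiv_le {f : Space n → ℂ} (hf : ContDiff ℝ 1 f) (hc : HasCompactSupport f)
    {A : ℝ} (hA : ∑ i, mass (partialDeriv i f) ≤ A) :
    eLpNorm (fderiv ℝ f) 2 volume ≤ ENNReal.ofReal (√A) := by
  have hm : ∀ i, MemLp (partialDeriv i f) 2 volume := fun i =>
    memLp_test (continuous_partialDeriv i hf) (hasCompactSupport_partialDeriv i hc)
  have h0 : 0 ≤ ∑ i, mass (partialDeriv i f) := Finset.sum_nonneg fun _ _ => mass_nonneg _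
  rw [eLpNorm_two_eq, Real.sqrt_eq_rpow, ← ENNReal.ofReal_rpow_of_nonneg (h0.trans hA)
    (by norm_num)]
  gcongr
  calc ∫⁻ x, ‖fderiv ℝ f x‖ₑ ^ 2 ≤ ∫⁻ x, ∑ i, ‖partialDeriv i f x‖ₑ ^ 2 := by
        refine lintegral_mono fun x => ?_
        have := ENNReal.ofReal_le_ofReal (norm_fderiv_sq_le f x)
        rw [ENNReal.ofReal_sum_of_nonneg (fun _ _ => by positivity),
          ENNReal.ofReal_pow (norm_nonneg _), ofReal_norm] at this
        simpa only [ENNReal.ofReal_pow (norm_nonneg _), ofReal_norm] using this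
    _ = ∑ i, ENNReal.ofReal (mass (partialDeriv i f)) := by
        rw [lintegral_finsetSum' _ fun i _ => (hm i).1.enorm.pow_const 2]
        exact Finset.sum_congr rfl fun i _ => lintegral_enorm_sq (hm i)
    _ ≤ ENNReal.ofReal A := by
        rw [← ENNReal.ofReal_sum_of_nonneg fun _ _ => mass_nonneg _]
        exact ENNReal.ofReal_le_ofReal hA

theorem mass_le_mass {f g : Space n → ℂ} {c : ℝ} (hg : MemLp g 2 volume)
    (hf : MemLp f 2 volume) (h : ∀ x, ‖f x‖ ≤ c * ‖g x‖) : mass f ≤ c ^ 2 * mass g := by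
  unfold mass
  rw [← integral_const_mul]
  refine integral_mono (integrable_normSq hf) ((integrable_normSq hg).const_mul _) fun x => ?_
  simp only [← mul_pow]
  exact pow_le_pow_left₀ (norm_nonneg _) (h x) 2

/-- The **Gagliardo–Nirenberg–Sobolev inequality** `‖u‖_{2n/(n-2)} ≤ C ‖∇u‖₂` for `u ∈ H¹`. -/
theorem exists_sobolev (hn : 0 < n) {q : NNReal} (hq : (q : ℝ)⁻¹ = 2⁻¹ - (n : ℝ)⁻¹) :
    ∃ C : ℝ, 0 ≤ C ∧ ∀ u : Space n → ℂ, MemH1 u →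
      eLpNorm u q volume ≤ ENNReal.ofReal (C * √(gradNormSq u)) := by
  obtain ⟨M, hM0, hM⟩ := exists_partialDeriv_cutoff_le n
  let C := SNormLESNormFDerivOfEqConst ℂ (volume : Measure (Space n)) ((2 : NNReal) : ℝ)
  refine ⟨C * √2, by positivity, fun u hu => ?_⟩
  have hl := hu.1.locallyIntegrable (by norm_num)
  -- the inequality for compactly supported `C¹` functions is applied to truncated mollifications
  -- and passes to the limit by Fatou's lemma
  let v : ℕ → Space n → ℂ := fun k x => cutoff ((k : ℝ) + 1) x • moll (bumpSeq k) u x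
  have hvs : ∀ k, ContDiff ℝ ∞ (v k) := fun k => (contDiff_cutoff _).smul (contDiff_moll _ hl)
  have hvs1 : ∀ k, ContDiff ℝ 1 (v k) := fun k => (hvs k).of_le (by norm_num)
  have hvc : ∀ k, HasCompactSupport (v k) := fun k =>
    (hasCompactSupport_cutoff (by positivity)).smul_right
  have hlim : ∀ᵐ x, Tendsto (fun k => v k x) atTop (𝓝 (u x)) := by
    filter_upwards [ae_tendsto_moll hl] with x hx
    simpa only [v, one_smul] using (tendsto_cutoff x).smul hx
  -- the second summand of the bound comes from the derivative of the cutoff and tends to zero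
  let A : ℕ → ℝ := fun k => 2 * gradNormSq u + n * (2 * (M / (k + 1)) ^ 2 * mass u)
  have hA : ∀ k, ∑ i, mass (partialDeriv i (v k)) ≤ A k := by
    intro k
    have hi : ∀ i : Fin n, mass (partialDeriv i (v k)) ≤
        2 * mass (weakPartial i u) + 2 * (M / (k + 1)) ^ 2 * mass u := by
      intro i
      have hmi := memLp_moll (bumpSeq k) (hu.memLp_weakPartial i)
      have hmu := memLp_moll (bumpSeq k) hu.1
      have hcut : Continuous (partialDeriv i (cutoff ((k : ℝ) + 1) : Space n → ℝ)) :=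
        continuous_partialDeriv i ((contDiff_cutoff _).of_le (by norm_num))
      have hcont : Continuous (cutoff ((k : ℝ) + 1) : Space n → ℝ) := (contDiff_cutoff _).continuous
      have b1 : ∀ x, ‖cutoff ((k : ℝ) + 1) x • moll (bumpSeq k) (weakPartial i u) x‖
          ≤ 1 * ‖moll (bumpSeq k) (weakPartial i u) x‖ := fun x => by
        rw [norm_smul, Real.norm_eq_abs, abs_of_nonneg (cutoff_nonneg _ _)]
        gcongr
        exact cutoff_le_one _ _
      have b2 : ∀ x, ‖partialDeriv i (cutoff ((k : ℝ) + 1)) x • moll (bumpSeq k) u x‖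
          ≤ M / (k + 1) * ‖moll (bumpSeq k) u x‖ := fun x => by
        rw [norm_smul, Real.norm_eq_abs]
        gcongr
        exact hM i _ (by positivity) x
      have m1 : MemLp (fun x => cutoff ((k : ℝ) + 1) x • moll (bumpSeq k) (weakPartial i u) x) 2
          volume := MemLp.of_le_mul hmi (hcont.aestronglyMeasurable.smul hmi.1) (ae_of_all _ b1)
      have m2 : MemLp (fun x => partialDeriv i (cutoff ((k : ℝ) + 1)) x • moll (bumpSeq k) u x) 2
          volume := MemLp.of_le_mul hmu (hcut.aestronglyMeasurable.smul hmu.1) (ae_of_all _ b2)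
      have hd : partialDeriv i (v k)
          = (fun x => cutoff ((k : ℝ) + 1) x • moll (bumpSeq k) (weakPartial i u) x)
            + fun x => partialDeriv i (cutoff ((k : ℝ) + 1)) x • moll (bumpSeq k) u x := by
        ext x
        have hd1 := ((contDiff_cutoff (n := n) ((k : ℝ) + 1)).differentiable (by norm_num) x)
        have hd2 := ((contDiff_moll (bumpSeq k) hl).differentiable (by norm_num) x)
        have := (hd1.hasFDerivAt.smul hd2.hasFDerivAt).fderiv
        rw [Pi.add_apply, ← partialDeriv_moll _ (hu.hasWeakPartial i)]
        unfold partialDeriv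
        erw [this]
        simp
      rw [hd]
      have c1 := mass_le_mass hmi m1 b1
      have c2 := mass_le_mass hmu m2 b2
      have c3 := mass_moll_le (bumpSeq k) (hu.memLp_weakPartial i)
      have c4 := mass_moll_le (bumpSeq k) hu.1
      have c5 : (M / (k + 1)) ^ 2 * mass (moll (bumpSeq k) u) ≤ (M / (k + 1)) ^ 2 * mass u := by
        gcongr
      linarith [mass_add_le m1 m2]
    refine (Finset.sum_le_sum fun i _ => hi i).trans_eq ?_
    rw [Finset.sum_add_distrib, ← Finset.mul_sum, ← gradNormSq_eq]
    simp [A]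
  have hk : ∀ k, eLpNorm (v k) q volume ≤ C * ENNReal.ofReal (√(A k)) := fun k =>
    (eLpNorm_le_eLpNorm_fderiv_of_eq (F := ℂ) volume (hvs1 k) (hvc k) (p := 2) (p' := q)
      (by norm_num) (by simpa using hn) (by simpa using hq)).trans
      (mul_le_mul_right (eLpNorm_fderiv_le (hvs1 k) (hvc k) (hA k)) _)
  have hAlim : Tendsto A atTop (𝓝 (2 * gradNormSq u)) := by
    have h0 : Tendsto (fun k : ℕ => M / ((k : ℝ) + 1)) atTop (𝓝 0) :=
      tendsto_const_div_atTop_nhds_zero_nat M |>.comp (tendsto_add_atTop_nat 1) |>.congr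
        fun k => by simp
    have := (((h0.pow 2).const_mul 2).mul_const (mass u)).const_mul (n : ℝ)
      |>.const_add (2 * gradNormSq u)
    simpa [A] using this
  have hlim2 : Tendsto (fun k => (C : ℝ≥0∞) * ENNReal.ofReal (√(A k))) atTop
      (𝓝 (C * ENNReal.ofReal (√(2 * gradNormSq u)))) :=
    ENNReal.Tendsto.const_mul (ENNReal.tendsto_ofReal ((Real.continuous_sqrt.tendsto _).comp hAlim))
      (Or.inr ENNReal.coe_ne_top)
  calc eLpNorm u q volume ≤ liminf (fun k => eLpNorm (v k) q volume) atTop :=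
        Lp.eLpNorm_lim_le_liminf_eLpNorm (fun k => (hvs k).continuous.aestronglyMeasurable) u hlim
    _ ≤ liminf (fun k => (C : ℝ≥0∞) * ENNReal.ofReal (√(A k))) atTop :=
        liminf_le_liminf (Eventually.of_forall hk)
    _ = C * ENNReal.ofReal (√(2 * gradNormSq u)) := hlim2.liminf_eq
    _ = ENNReal.ofReal (C * √2 * √(gradNormSq u)) := by
        rw [Real.sqrt_mul (by norm_num), mul_assoc,
          ENNReal.ofReal_mul (NNReal.coe_nonneg C), ENNReal.ofReal_coe_nnreal]

/-- Interpolation between `L²` and `L^{2n/(n-2)}`: the `L³` norm on a measurable set, in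
dimensions below `6`. -/
theorem exists_cube_le (hn3 : 3 ≤ n) (hn5 : n ≤ 5) : ∃ C : ℝ, 0 < C ∧ ∀ u : Space n → ℂ, MemH1 u →
    MemLp u 3 volume ∧ ∀ T : Set (Space n), MeasurableSet T →
      ∫ x in T, ‖u x‖ ^ 3 ≤ C * (∫ x in T, ‖u x‖ ^ 2) ^ ((6 - n : ℝ) / 4)
        * gradNormSq u ^ ((n : ℝ) / 4) := by
  have hnR : (3 : ℝ) ≤ n := by exact_mod_cast hn3
  have hnR5 : (n : ℝ) ≤ 5 := by exact_mod_cast hn5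
  let q : NNReal := ⟨2 * n / (n - 2), by apply div_nonneg <;> linarith⟩
  have hqv : (q : ℝ) = 2 * n / (n - 2) := rfl
  have hn2 : (n : ℝ) - 2 ≠ 0 := by linarith
  have hn0 : (n : ℝ) ≠ 0 := by linarith
  have hq : (q : ℝ)⁻¹ = 2⁻¹ - (n : ℝ)⁻¹ := by rw [hqv]; field_simp
  have hq0 : 0 < (q : ℝ) := by rw [hqv]; apply div_pos <;> linarith
  obtain ⟨C, hC0, hC⟩ := exists_sobolev (n := n) (by omega) hq
  refine ⟨C ^ ((n : ℝ) / 2) + 1, by positivity, fun u hu => ?_⟩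
  have key : ∀ T : Set (Space n), MeasurableSet T → ∫⁻ x in T, ‖u x‖ₑ ^ 3 ≤ ENNReal.ofReal
      (C ^ ((n : ℝ) / 2) * (∫ x in T, ‖u x‖ ^ 2) ^ ((6 - n : ℝ) / 4)
        * gradNormSq u ^ ((n : ℝ) / 4)) := by
    intro T hT
    have hG := gradNormSq_nonneg u
    have hm0 : 0 ≤ ∫ x in T, ‖u x‖ ^ 2 := integral_nonneg fun _ => by positivity
    have h2 : ∫⁻ x in T, ‖u x‖ₑ ^ 2 = ENNReal.ofReal (∫ x in T, ‖u x‖ ^ 2) := by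
      rw [ofReal_integral_eq_lintegral_ofReal (integrable_normSq hu.1).integrableOn
        (ae_of_all _ fun _ => by positivity)]
      congr 1 with x
      rw [← ofReal_norm, ENNReal.ofReal_pow (norm_nonneg _)]
    have hqe : (∫⁻ x in T, ‖u x‖ₑ ^ (q : ℝ)) ≤ eLpNorm u q volume ^ (q : ℝ) := by
      rw [eLpNorm_eq_lintegral_rpow_enorm_toReal (by exact_mod_cast hq0.ne') (by simp),
        ENNReal.coe_toReal, ← ENNReal.rpow_mul, one_div_mul_cancel hq0.ne', ENNReal.rpow_one]
      exact setLIntegral_le_lintegral _ _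
    -- Hölder with the weights `(6 - n) / 4` and `(n - 2) / 4`, as
    -- `3 = 2 (6 - n) / 4 + q (n - 2) / 4` for the Sobolev exponent `q = 2 n / (n - 2)`
    have hHol := ENNReal.lintegral_mul_norm_pow_le (μ := volume.restrict T)
      (f := fun x => ‖u x‖ₑ ^ 2) (g := fun x => ‖u x‖ₑ ^ (q : ℝ))
      (hu.1.1.enorm.pow_const 2).restrict (hu.1.1.enorm.pow_const _).restrict
      (p := (6 - n : ℝ) / 4) (q := ((n : ℝ) - 2) / 4) (by linarith) (by linarith) (by ring)
    have hpt : ∀ x, ‖u x‖ₑ ^ 3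
        = (‖u x‖ₑ ^ 2) ^ ((6 - n : ℝ) / 4) * (‖u x‖ₑ ^ (q : ℝ)) ^ (((n : ℝ) - 2) / 4) := by
      intro x
      rw [← ENNReal.rpow_natCast, ← ENNReal.rpow_natCast, ← ENNReal.rpow_mul, ← ENNReal.rpow_mul,
        ← ENNReal.rpow_add_of_nonneg _ _ (by apply mul_nonneg <;> [norm_num; linarith])
          (by apply mul_nonneg <;> linarith)]
      congr 1
      rw [hqv]
      push_cast
      field_simp
      ring
    simp only [hpt]
    refine hHol.trans ?_
    rw [h2, ENNReal.ofReal_rpow_of_nonneg hm0 (by linarith), mul_comm (C ^ ((n : ℝ) / 2)),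
      mul_assoc, ENNReal.ofReal_mul (by positivity)]
    gcongr
    calc (∫⁻ x in T, ‖u x‖ₑ ^ (q : ℝ)) ^ (((n : ℝ) - 2) / 4)
        ≤ (ENNReal.ofReal (C * √(gradNormSq u)) ^ (q : ℝ)) ^ (((n : ℝ) - 2) / 4) := by
          gcongr
          · linarith
          · exact hqe.trans (by gcongr; exact hC u hu)
      _ = _ := by
          rw [← ENNReal.rpow_mul, ENNReal.ofReal_rpow_of_nonneg (by positivity)
            (by apply mul_nonneg <;> linarith)]
          have : (q : ℝ) * (((n : ℝ) - 2) / 4) = n / 2 := by rw [hqv]; field_simp; ring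
          rw [this, Real.mul_rpow hC0 (Real.sqrt_nonneg _), Real.sqrt_eq_rpow, ← Real.rpow_mul hG]
          congr 3
          ring
  have hL3 : MemLp u 3 volume := by
    refine ⟨hu.1.1, ?_⟩
    rw [eLpNorm_lt_top_iff_lintegral_rpow_enorm_lt_top (by simp) (by simp)]
    have := key Set.univ MeasurableSet.univ
    rw [Measure.restrict_univ] at this
    simpa using this.trans_lt ENNReal.ofReal_lt_top
  refine ⟨hL3, fun T hT => ?_⟩
  have hm0 : 0 ≤ ∫ x in T, ‖u x‖ ^ 2 := integral_nonneg fun _ => by positivity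
  have hG := gradNormSq_nonneg u
  have h := key T hT
  have h3 : ∫⁻ x in T, ‖u x‖ₑ ^ 3 = ENNReal.ofReal (∫ x in T, ‖u x‖ ^ 3) := by
    rw [ofReal_integral_eq_lintegral_ofReal
      (show IntegrableOn (fun x => ‖u x‖ ^ 3) T volume from
        (hL3.integrable_norm_pow (p := 3) (by norm_num)).integrableOn)
      (ae_of_all _ fun _ => by positivity)]
    congr 1 with x
    rw [← ofReal_norm, ENNReal.ofReal_pow (norm_nonneg _)]
  rw [h3, ENNReal.ofReal_le_ofReal_iff (by positivity)] at h
  refine h.trans ?_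
  gcongr
  linarith

/-! ### Local compactness -/

theorem integral_norm_mul_norm_le {f g : Space n → ℂ} (hf : MemLp f 2 volume)
    (hg : MemLp g 2 volume) : ∫ x, ‖f x‖ * ‖g x‖ ≤ √(mass f) * √(mass g) := by
  have hf' : MemLp (fun x => (‖f x‖ : ℂ)) 2 volume := hf.norm.ofReal
  have hg' : MemLp (fun x => (‖g x‖ : ℂ)) 2 volume := hg.norm.ofReal
  have h := (le_abs_self _).trans (abs_reInner_le hf' hg')
  have e1 : mass (fun x => (‖f x‖ : ℂ)) = mass f := by simp [mass]
  have e2 : mass (fun x => (‖g x‖ : ℂ)) = mass g := by simp [mass]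
  rw [e1, e2] at h
  refine le_trans (le_of_eq ?_) h
  refine integral_congr_ae (ae_of_all _ fun x => ?_)
  simp [Complex.inner, mul_comm]

theorem norm_integral_mul_le {f g : Space n → ℂ} (hf : MemLp f 2 volume)
    (hg : MemLp g 2 volume) : ‖∫ x, f x * g x‖ ≤ √(mass f) * √(mass g) := by
  refine (norm_integral_le_integral_norm _).trans (le_trans (le_of_eq ?_)
    (integral_norm_mul_norm_le hf hg))
  simp

theorem memLp_normed_complex (ρ : ContDiffBump (0 : Space n)) (x : Space n) :
    MemLp (fun y => ((ρ.normed volume (x - y) : ℝ) : ℂ)) 2 volume :=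
  memLp_test (Complex.continuous_ofReal.comp
    (ρ.continuous_normed.comp (continuous_const.sub continuous_id)))
    (((ρ.hasCompactSupport_normed (μ := volume)).comp_homeomorph
      (Homeomorph.subLeft x)).comp_left (g := fun t : ℝ => (t : ℂ)) rfl)

theorem mass_normed_complex (ρ : ContDiffBump (0 : Space n)) (x : Space n) :
    mass (fun y => ((ρ.normed volume (x - y) : ℝ) : ℂ)) = ∫ y, ρ.normed volume y ^ 2 := by
  unfold mass
  simp only [Complex.norm_real, Real.norm_eq_abs, sq_abs]
  exact integral_sub_left_eq_self (fun y => ρ.normed volume y ^ 2) volume x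

theorem moll_eq_integral_mul (ρ : ContDiffBump (0 : Space n)) (u : Space n → ℂ) (x : Space n) :
    moll ρ u x = ∫ y, ((ρ.normed volume (x - y) : ℝ) : ℂ) * u y := by
  simp only [moll_eq_integral_swap, Complex.real_smul]

/-- **Rellich's theorem**: a bounded sequence of `H¹` tending weakly to zero in `L²` tends to zero
in `L²` of every ball. -/
theorem WeakLim.tendsto_local {r : ℕ → Space n → ℂ} {C : ℝ} (hr : ∀ k, MemH1 (r k))
    (hm : ∀ k, mass (r k) ≤ C) (hg : ∀ k, gradNormSq (r k) ≤ C) (hw : WeakLim r 0) (R : ℝ) :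
    Tendsto (fun k => ∫ x in Metric.ball 0 R, ‖r k x‖ ^ 2) atTop (𝓝 0) := by
  have hC0 : 0 ≤ C := (mass_nonneg _).trans (hm 0)
  -- mollification at a fixed scale turns weak convergence into bounded pointwise convergence
  have hmoll : ∀ m : ℕ, Tendsto
      (fun k => ∫ x in Metric.ball 0 R, ‖moll (bumpSeq m) (r k) x‖ ^ 2) atTop (𝓝 0) := by
    intro m
    have h0 : (0 : ℝ) = ∫ x in Metric.ball (0 : Space n) R, (0 : ℝ) := by simp
    rw [h0]
    have hfin : IsFiniteMeasure (volume.restrict (Metric.ball (0 : Space n) R)) :=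
      ⟨by simpa using measure_ball_lt_top⟩
    refine tendsto_integral_of_dominated_convergence
      (fun _ => (∫ y, (bumpSeq m : ContDiffBump (0 : Space n)).normed volume y ^ 2) * C)
      (fun k => ((contDiff_moll _ ((hr k).1.locallyIntegrable
        (by norm_num))).continuous.norm.pow 2).aestronglyMeasurable)
      (integrable_const _) (fun k => ae_of_all _ fun x => ?_) (ae_of_all _ fun x => ?_)
    · rw [Real.norm_eq_abs, abs_of_nonneg (by positivity), moll_eq_integral_mul]
      have h1 := norm_integral_mul_le (memLp_normed_complex (bumpSeq m) x) (hr k).1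
      calc _ ≤ (√(mass (fun y => (((bumpSeq m : ContDiffBump (0 : Space n)).normed volume
            (x - y) : ℝ) : ℂ))) * √(mass (r k))) ^ 2 := by gcongr
        _ ≤ _ := by
          rw [mul_pow, Real.sq_sqrt (mass_nonneg _), Real.sq_sqrt (mass_nonneg _),
            mass_normed_complex]
          have : 0 ≤ ∫ y, (bumpSeq m : ContDiffBump (0 : Space n)).normed volume y ^ 2 :=
            integral_nonneg fun _ => by positivity
          gcongr
          exact hm k
    · have h1 := hw.tendsto_integral_mul (fun k => (hr k).1) (MemLp.zero)
        (memLp_normed_complex (bumpSeq m) x)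
      simp only [← moll_eq_integral_mul] at h1
      simpa [moll_eq_integral_mul] using (h1.norm.pow 2)
  rw [Metric.tendsto_atTop]
  intro ε hε
  -- the mollification error is uniform in the sequence, so the scale is chosen first
  have hsmall : Tendsto (fun m : ℕ => 2 * ((1 / ((m : ℝ) + 1)) ^ 2 * C)) atTop (𝓝 0) := by
    simpa using ((tendsto_one_div_add_atTop_nhds_zero_nat (𝕜 := ℝ).pow 2).mul_const C).const_mul 2
  obtain ⟨m, hmε⟩ := (hsmall.eventually (gt_mem_nhds (half_pos hε))).exists
  obtain ⟨N, hN⟩ := eventually_atTop.1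
    ((hmoll m).eventually (gt_mem_nhds (show (0 : ℝ) < ε / 4 by positivity)))
  refine ⟨N, fun k hk => ?_⟩
  rw [dist_zero_right, Real.norm_eq_abs, abs_of_nonneg (integral_nonneg fun _ => by positivity)]
  have hd := (mass_sub_moll_le (bumpSeq m) (hr k)).trans
    (mul_le_mul_of_nonneg_left (hg k) (by positivity))
  have hmm := memLp_moll (bumpSeq m) (hr k).1
  have i1 := (integrable_normSq hmm)
  have i2 := (integrable_normSq ((hr k).1.sub hmm))
  have h1 : ∫ x in Metric.ball 0 R, ‖r k x‖ ^ 2 ≤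
      ∫ x in Metric.ball 0 R, (2 * ‖moll (bumpSeq m) (r k) x‖ ^ 2
        + 2 * ‖(r k - moll (bumpSeq m) (r k)) x‖ ^ 2) := by
    refine integral_mono (integrable_normSq (hr k).1).integrableOn
      ((i1.const_mul 2).add (i2.const_mul 2)).integrableOn fun x => ?_
    have h2 : ‖r k x‖ ≤ ‖moll (bumpSeq m) (r k) x‖ + ‖(r k - moll (bumpSeq m) (r k)) x‖ := by
      simpa using norm_add_le (moll (bumpSeq m) (r k) x) ((r k - moll (bumpSeq m) (r k)) x)
    have := pow_le_pow_left₀ (norm_nonneg _) h2 2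
    simp only
    nlinarith [sq_nonneg (‖moll (bumpSeq m) (r k) x‖ - ‖(r k - moll (bumpSeq m) (r k)) x‖)]
  rw [integral_add (i1.const_mul 2).integrableOn (i2.const_mul 2).integrableOn,
    integral_const_mul, integral_const_mul] at h1
  have h3 : ∫ x in Metric.ball 0 R, ‖(r k - moll (bumpSeq m) (r k)) x‖ ^ 2
      ≤ mass (r k - moll (bumpSeq m) (r k)) :=
    setIntegral_le_integral i2 (ae_of_all _ fun _ => by positivity)
  have h4 := hN k hk
  have h5 : (bumpSeq m : ContDiffBump (0 : Space n)).rOut = 1 / ((m : ℝ) + 1) := rfl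
  rw [h5] at hd
  linarith

/-- Weak limits of real nonnegative functions are real and nonnegative. -/
theorem WeakLim.eq_norm {u : ℕ → Space n → ℂ} {U : Space n → ℂ} (hw : WeakLim u U)
    (hU : MemLp U 2 volume) (hu : ∀ k, u k =ᵐ[volume] fun x => (‖u k x‖ : ℂ)) :
    U =ᵐ[volume] fun x => (‖U x‖ : ℂ) := by
  -- `P` is the pointwise projection of `U` to the cone of nonnegative functions
  let P : Space n → ℂ := fun x => ((max (U x).re 0 : ℝ) : ℂ)
  have hPm : AEStronglyMeasurable P volume :=
    Complex.continuous_ofReal.comp_aestronglyMeasurable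
      ((Complex.continuous_re.comp_aestronglyMeasurable hU.1).sup aestronglyMeasurable_const)
  have hP : MemLp P 2 volume := hU.mono hPm (ae_of_all _ fun x => by
    simp only [P, Complex.norm_real, Real.norm_eq_abs]
    rw [abs_of_nonneg (le_max_right _ _)]
    exact max_le ((le_abs_self _).trans (Complex.abs_re_le_norm _)) (norm_nonneg _))
  have hh := hU.sub hP
  -- `U - P` is polar to the cone, and `U` is a weak limit of elements of the cone
  have h1 : reInner U (U - P) ≤ 0 := by
    refine le_of_tendsto (hw _ hh) (Eventually.of_forall fun k => ?_)
    refine integral_nonpos_of_ae ((hu k).mono fun x hx => ?_)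
    simp only [Pi.zero_apply]
    rw [hx]
    simp only [Pi.sub_apply, P, Complex.inner, Complex.conj_ofReal, Complex.re_mul_ofReal,
      Complex.sub_re, Complex.ofReal_re]
    exact mul_nonpos_of_nonpos_of_nonneg (sub_nonpos.2 (le_max_left _ _)) (norm_nonneg _)
  have h2 : reInner P (U - P) = 0 := by
    refine integral_eq_zero_of_ae (ae_of_all _ fun x => ?_)
    simp only [Pi.sub_apply, P, Complex.inner, Complex.conj_ofReal, Complex.re_mul_ofReal,
      Complex.sub_re, Complex.ofReal_re, Pi.zero_apply]
    rcases le_total (U x).re 0 with h | h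
    · rw [max_eq_right h, mul_zero]
    · rw [max_eq_left h, sub_self, zero_mul]
  have h3 : mass (U - P) = 0 := by
    have h4 := reInner_add_left hh hP hh
    rw [sub_add_cancel, reInner_self] at h4
    exact le_antisymm (by linarith) (mass_nonneg _)
  rw [mass, integral_eq_zero_iff_of_nonneg (fun _ => by positivity) (integrable_normSq hh)] at h3
  filter_upwards [h3] with x hx
  have h5 : U x = P x := by
    have : ‖(U - P) x‖ = 0 := by simpa using hx
    exact sub_eq_zero.1 (norm_eq_zero.1 this)
  rw [h5]
  simp only [P, Complex.norm_real, Real.norm_eq_abs]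
  rw [abs_of_nonneg (le_max_right _ _)]

/-! ### Difference quotients and moduli -/

/-- An `L²` function whose difference quotients in a coordinate direction are bounded in `L²` has
a weak derivative in that direction. -/
theorem exists_hasWeakPartial_of_translate {i : Fin n} {w : Space n → ℂ} {C : ℝ} (hC : 0 ≤ C)
    (hw : MemLp w 2 volume)
    (h : ∀ t : ℝ, ∫⁻ x, ‖w (x + t • EuclideanSpace.single i 1) - w x‖ₑ ^ 2
      ≤ ENNReal.ofReal (t ^ 2 * C)) :
    ∃ G, HasWeakPartial i w G ∧ MemLp G 2 volume ∧ mass G ≤ C := by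
  let e : Space n := EuclideanSpace.single i 1
  let t : ℕ → ℝ := fun k => 1 / ((k : ℝ) + 1)
  have ht0 : ∀ k, 0 < t k := fun k => by positivity
  have ht1 : ∀ k, t k ≤ 1 := fun k => by
    simp only [t]
    rw [div_le_one (by positivity)]
    linarith [(Nat.cast_nonneg k : (0 : ℝ) ≤ k)]
  -- the weak derivative is a weak limit of difference quotients
  let D : ℕ → Space n → ℂ := fun k => ((t k)⁻¹ : ℂ) • ((fun x => w (x + t k • e)) - w)
  have hDm : ∀ k, MemLp ((fun x => w (x + t k • e)) - w) 2 volume := fun k =>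
    (memLp_comp_add hw _).sub hw
  have hD : ∀ k, MemLp (D k) 2 volume := fun k => (hDm k).const_smul _
  have hDC : ∀ k, mass (D k) ≤ C := fun k => by
    have h1 := mass_le_of_lintegral (by positivity) (hDm k).1 (h (t k))
    rw [mass_smul, norm_inv, Complex.norm_real, Real.norm_eq_abs, abs_of_pos (ht0 k), inv_pow]
    rw [inv_mul_le_iff₀ (by have := ht0 k; positivity)]
    exact h1
  obtain ⟨G, hG, s, hs, hGw⟩ := exists_weakLim hD hDC
  refine ⟨G, ⟨hw.locallyIntegrable (by norm_num), hG.locallyIntegrable (by norm_num),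
    fun f hf hc => ?_⟩, hG, mass_le_of_weakLim (fun k => hD (s k)) (fun k => hDC _) hG hGw⟩
  have hl := hw.locallyIntegrable (by norm_num)
  have hf1 : ContDiff ℝ 1 f := hf.of_le (by norm_num)
  obtain ⟨K, hK⟩ := hf1.lipschitzWith_of_hasCompactSupport hc (by norm_num)
  obtain ⟨R, hR⟩ := hc.isCompact.isBounded.subset_closedBall (0 : Space n)
  have he : ‖e‖ = 1 := by simp [e]
  -- moving the difference quotient to the test function
  have hmove : ∀ k, ∫ x, (f x : ℂ) * D k x
      = ∫ x, ((t k)⁻¹ * (f (x - t k • e) - f x)) • w x := by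
    intro k
    have i1 : Integrable (fun x => f (x - t k • e) • w x) :=
      integrable_test_smul hl (hf.continuous.comp (continuous_id.sub continuous_const))
        (hc.comp_homeomorph (Homeomorph.subRight (t k • e)))
    have i2 : Integrable (fun x => f x • w x) := integrable_test_smul hl hf.continuous hc
    have i3 : Integrable (fun x => f x • w (x + t k • e)) :=
      integrable_test_smul (locallyIntegrable_comp_add hl _) hf.continuous hc
    have e1 : ∫ x, f (x - t k • e) • w x = ∫ x, f x • w (x + t k • e) := by
      rw [← integral_add_right_eq_self _ (t k • e)]
      simp
    calc ∫ x, (f x : ℂ) * D k x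
        = ∫ x, (t k)⁻¹ • (f x • w (x + t k • e) - f x • w x) := by
          refine integral_congr_ae (ae_of_all _ fun x => ?_)
          simp only [D, Pi.smul_apply, Pi.sub_apply, smul_eq_mul, Complex.real_smul,
            Complex.ofReal_inv]
          ring
      _ = ∫ x, (t k)⁻¹ • (f (x - t k • e) • w x - f x • w x) := by
          rw [integral_smul, integral_smul, integral_sub i3 i2, integral_sub i1 i2, e1]
      _ = _ := by
          refine integral_congr_ae (ae_of_all _ fun x => ?_)
          simp only [← sub_smul, smul_smul]
  have hlim : Tendsto (fun k => ∫ x, ((t k)⁻¹ * (f (x - t k • e) - f x)) • w x) atTop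
      (𝓝 (∫ x, (-partialDeriv i f x) • w x)) := by
    refine tendsto_integral_of_dominated_convergence
      (fun x => (Metric.closedBall (0 : Space n) (R + 1)).indicator (fun x => K * ‖w x‖) x)
      (fun k => ?_) ?_ (fun k => ae_of_all _ fun x => ?_) (ae_of_all _ fun x => ?_)
    · exact (((hf.continuous.comp (continuous_id.sub continuous_const)).sub
        hf.continuous).const_smul (t k)⁻¹).aestronglyMeasurable.smul hw.1
    · rw [integrable_indicator_iff measurableSet_closedBall]
      exact ((hl.integrableOn_isCompact (isCompact_closedBall _ _)).norm).const_mul _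
    · by_cases hx : x ∈ Metric.closedBall (0 : Space n) (R + 1)
      · rw [Set.indicator_of_mem hx, norm_smul, norm_mul, norm_inv, Real.norm_eq_abs,
          abs_of_pos (ht0 k)]
        gcongr
        rw [inv_mul_le_iff₀ (ht0 k)]
        have := hK.dist_le_mul (x - t k • e) x
        rw [dist_eq_norm, dist_eq_norm, sub_sub_cancel_left, norm_neg, norm_smul, he] at this
        simp only [Real.norm_eq_abs, abs_of_pos (ht0 k)] at this ⊢
        linarith
      · rw [Set.indicator_of_notMem hx]
        rw [mem_closedBall_zero_iff, not_le] at hx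
        have z1 : f x = 0 := by
          by_contra hne
          have := hR (subset_tsupport f hne)
          rw [mem_closedBall_zero_iff] at this
          linarith
        have z2 : f (x - t k • e) = 0 := by
          by_contra hne
          have := hR (subset_tsupport f hne)
          rw [mem_closedBall_zero_iff] at this
          have h2 : ‖x‖ ≤ ‖x - t k • e‖ + ‖t k • e‖ := by
            simpa using norm_add_le (x - t k • e) (t k • e)
          rw [norm_smul, he, Real.norm_eq_abs, abs_of_pos (ht0 k)] at h2
          linarith [ht1 k]
        simp [z1, z2]
    · refine Tendsto.smul_const ?_ _
      have hda : HasDerivAt (fun s : ℝ => f (x + s • e)) (partialDeriv i f x) 0 := by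
        have h1 : HasDerivAt (fun s : ℝ => x + s • e) e 0 := by
          simpa using ((hasDerivAt_id (0 : ℝ)).smul_const e).const_add x
        have h2 : HasFDerivAt f (fderiv ℝ f x) (x + (0 : ℝ) • e) := by
          simpa using (hf1.differentiable (by norm_num) x).hasFDerivAt
        exact h2.comp_hasDerivAt 0 h1
      have hneg : Tendsto (fun k => -t k) atTop (𝓝[≠] 0) := by
        refine tendsto_nhdsWithin_iff.2 ⟨?_, Eventually.of_forall fun k => ?_⟩
        · simpa [t] using (tendsto_one_div_add_atTop_nhds_zero_nat (𝕜 := ℝ)).neg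
        · simpa using (ht0 k).ne'
      refine ((hda.tendsto_slope_zero.comp hneg).neg).congr fun k => ?_
      simp only [Function.comp_apply, zero_add, zero_smul, add_zero, smul_eq_mul, neg_smul,
        ← sub_eq_add_neg, inv_neg]
      ring
  have hm : MemLp (fun x => (f x : ℂ)) 2 volume :=
    memLp_test (Complex.continuous_ofReal.comp hf.continuous)
      (hc.comp_left (g := fun t : ℝ => (t : ℂ)) rfl)
  have h1 := hGw.tendsto_integral_mul (fun k => hD (s k)) hG hm
  have h2 := tendsto_nhds_unique h1 ((hlim.comp hs.tendsto_atTop).congr fun k => (hmove (s k)).symm)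
  simp only [Complex.real_smul, neg_smul, integral_neg] at h2 ⊢
  rw [h2, neg_neg]

theorem lintegral_translate_single_le {u : Space n → ℂ} (hu : MemH1 u) (i : Fin n) (t : ℝ) :
    ∫⁻ x, ‖u (x + t • EuclideanSpace.single i 1) - u x‖ₑ ^ 2
      ≤ ENNReal.ofReal (t ^ 2 * mass (weakPartial i u)) := by
  refine (lintegral_translate_le hu _).trans_eq ?_
  have h : ∀ x, ∑ j, (((t • EuclideanSpace.single i (1 : ℝ) : Space n) j : ℝ) : ℂ)
      * weakPartial j u x = ((t : ℂ) • weakPartial i u) x := fun x => by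
    rw [Finset.sum_eq_single i]
    · simp
    · intro j _ hj
      simp [hj]
    · simp
  simp only [h]
  rw [lintegral_enorm_sq ((hu.memLp_weakPartial i).const_smul _), mass_smul, Complex.norm_real,
    Real.norm_eq_abs, sq_abs]

/-- Passing to the modulus preserves `H¹`, and no partial derivative grows in `L²`. -/
theorem MemH1.norm {u : Space n → ℂ} (hu : MemH1 u) :
    MemH1 (fun x => (‖u x‖ : ℂ)) ∧ ∀ i,
      mass (weakPartial i fun x => (‖u x‖ : ℂ)) ≤ mass (weakPartial i u) := by
  have hL : MemLp (fun x => (‖u x‖ : ℂ)) 2 volume := hu.1.norm.ofReal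
  have h : ∀ i, ∃ G, HasWeakPartial i (fun x => (‖u x‖ : ℂ)) G ∧ MemLp G 2 volume ∧
      mass G ≤ mass (weakPartial i u) := fun i => by
    refine exists_hasWeakPartial_of_translate (mass_nonneg _) hL fun t => ?_
    refine (lintegral_mono fun x => ?_).trans (lintegral_translate_single_le hu i t)
    gcongr
    -- the modulus is a contraction
    rw [enorm_le_iff_norm_le, ← Complex.ofReal_sub, Complex.norm_real]
    exact abs_norm_sub_norm_le _ _
  refine ⟨⟨hL, fun i => ?_⟩, fun i => ?_⟩
  · obtain ⟨G, h1, h2, -⟩ := h i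
    exact ⟨G, h1, h2⟩
  · obtain ⟨G, h1, -, h3⟩ := h i
    rwa [mass_congr h1.weakPartial_ae]

theorem gradNormSq_norm_le {u : Space n → ℂ} (hu : MemH1 u) :
    gradNormSq (fun x => (‖u x‖ : ℂ)) ≤ gradNormSq u :=
  Finset.sum_le_sum fun i _ => hu.norm.2 i

/-! ### The confining potential and the energy space -/

theorem potential_nonneg (x : Space n) : 0 ≤ potential x :=
  Finset.sum_nonneg fun _ _ => sq_nonneg _

theorem continuous_potential : Continuous (potential : Space n → ℝ) := by
  unfold potential
  fun_prop

/-- One component of the energy space: `u ∈ H¹` with `∫ V |u|² < ∞`. -/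
def MemH (u : Space n → ℂ) : Prop :=
  MemH1 u ∧ Integrable (fun x => potential x * ‖u x‖ ^ 2) volume

/-- Multiplication by `√V`, which turns the potential energy into a squared `L²` norm. -/
def potComp (u : Space n → ℂ) : Space n → ℂ := fun x => (√(potential x) : ℂ) * u x

theorem norm_potComp_sq (u : Space n → ℂ) (x : Space n) :
    ‖potComp u x‖ ^ 2 = potential x * ‖u x‖ ^ 2 := by
  rw [potComp, norm_mul, mul_pow, Complex.norm_real, Real.norm_eq_abs, sq_abs,
    Real.sq_sqrt (potential_nonneg x)]

theorem potentialEnergy_eq (u : Space n → ℂ) : potentialEnergy u = mass (potComp u) := by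
  simp only [mass, norm_potComp_sq, potentialEnergy]

theorem potentialEnergy_nonneg (u : Space n → ℂ) : 0 ≤ potentialEnergy u := by
  rw [potentialEnergy_eq]; exact mass_nonneg _

theorem aestronglyMeasurable_potComp {u : Space n → ℂ} (hu : AEStronglyMeasurable u volume) :
    AEStronglyMeasurable (potComp u) volume :=
  (Complex.continuous_ofReal.comp (continuous_potential.sqrt)).aestronglyMeasurable.mul hu

theorem memH_iff {u : Space n → ℂ} : MemH u ↔ MemH1 u ∧ MemLp (potComp u) 2 volume := by
  refine and_congr_right fun h => ?_
  rw [memLp_two_iff_integrable_sq_norm (aestronglyMeasurable_potComp h.1.1)]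
  simp only [norm_potComp_sq]

theorem MemH.memLp_potComp {u : Space n → ℂ} (hu : MemH u) : MemLp (potComp u) 2 volume :=
  (memH_iff.1 hu).2

theorem potComp_add (u v : Space n → ℂ) : potComp (u + v) = potComp u + potComp v := by
  ext x; simp [potComp, mul_add]

theorem potComp_smul (c : ℂ) (u : Space n → ℂ) : potComp (c • u) = c • potComp u := by
  ext x; simp [potComp]; ring

theorem MemH.add {u v : Space n → ℂ} (hu : MemH u) (hv : MemH v) : MemH (u + v) :=
  memH_iff.2 ⟨hu.1.add hv.1, by rw [potComp_add]; exact hu.memLp_potComp.add hv.memLp_potComp⟩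

theorem MemH.smul {u : Space n → ℂ} (c : ℂ) (hu : MemH u) : MemH (c • u) :=
  memH_iff.2 ⟨hu.1.smul c, by rw [potComp_smul]; exact hu.memLp_potComp.const_smul c⟩

theorem MemH.sub {u v : Space n → ℂ} (hu : MemH u) (hv : MemH v) : MemH (u - v) := by
  rw [sub_eq_add_neg, ← neg_one_smul ℂ v]
  exact hu.add (hv.smul _)

theorem MemH.norm {u : Space n → ℂ} (hu : MemH u) : MemH (fun x => (‖u x‖ : ℂ)) :=
  ⟨hu.1.norm.1, by simpa using hu.2⟩

theorem mass_norm (u : Space n → ℂ) : mass (fun x => (‖u x‖ : ℂ)) = mass u := by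
  simp [mass]

theorem potentialEnergy_norm (u : Space n → ℂ) :
    potentialEnergy (fun x => (‖u x‖ : ℂ)) = potentialEnergy u := by
  simp [potentialEnergy]

theorem potentialEnergy_smul (c : ℂ) (u : Space n → ℂ) :
    potentialEnergy (c • u) = ‖c‖ ^ 2 * potentialEnergy u := by
  rw [potentialEnergy_eq, potentialEnergy_eq, potComp_smul, mass_smul]

/-- The polar form of `potentialEnergy`. -/
def potInner (u v : Space n → ℂ) : ℝ := reInner (potComp u) (potComp v)

theorem potentialEnergy_add {u v : Space n → ℂ} (hu : MemH u) (hv : MemH v) :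
    potentialEnergy (u + v) = potentialEnergy u + 2 * potInner u v + potentialEnergy v := by
  simp only [potentialEnergy_eq, potInner, potComp_add]
  exact mass_add hu.memLp_potComp hv.memLp_potComp

theorem memH_of_test {f : Space n → ℂ} (hf : ContDiff ℝ ∞ f) (hc : HasCompactSupport f) :
    MemH f := by
  have hf1 : ContDiff ℝ 1 f := hf.of_le (by norm_num)
  refine memH_iff.2 ⟨⟨memLp_test hf.continuous hc, fun i => ⟨_, hasWeakPartial_of_contDiff i hf1,
    memLp_test (continuous_partialDeriv i hf1) (hasCompactSupport_partialDeriv i hc)⟩⟩, ?_⟩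
  exact memLp_test ((Complex.continuous_ofReal.comp continuous_potential.sqrt).mul hf.continuous)
    hc.mul_left

theorem potential_add_single {l : Fin n} (hl : l.val + 1 = n) (x : Space n) (t : ℝ) :
    potential (x + t • EuclideanSpace.single l 1) = potential x := by
  refine Finset.sum_congr rfl fun i hi => ?_
  have : i ≠ l := by
    rintro rfl
    simp only [Finset.mem_filter, hl, lt_irrefl, and_false] at hi
  simp [this]

theorem MemH.comp_add {l : Fin n} (hl : l.val + 1 = n) {u : Space n → ℂ} (hu : MemH u) (t : ℝ) :
    MemH (fun x => u (x + t • EuclideanSpace.single l 1)) := by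
  refine ⟨hu.1.comp_add _, ?_⟩
  have := (measurePreserving_add_right volume (t • EuclideanSpace.single l 1 : Space n)).integrable_comp_of_integrable
    hu.2
  simpa only [Function.comp_def, potential_add_single hl] using this

theorem potentialEnergy_comp_add {l : Fin n} (hl : l.val + 1 = n) (u : Space n → ℂ) (t : ℝ) :
    potentialEnergy (fun x => u (x + t • EuclideanSpace.single l 1)) = potentialEnergy u := by
  unfold potentialEnergy
  rw [← integral_add_right_eq_self (fun x => potential x * ‖u x‖ ^ 2)
    (t • EuclideanSpace.single l 1)]
  simp only [potential_add_single hl]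

/-- Weak limits of bounded sequences of the energy space lie in the energy space. -/
theorem MemH.of_weakLim {u : ℕ → Space n → ℂ} {U : Space n → ℂ} {C : ℝ} (hu : ∀ k, MemH (u k))
    (hG : ∀ k, gradNormSq (u k) ≤ C) (hP : ∀ k, potentialEnergy (u k) ≤ C)
    (hU : MemLp U 2 volume) (hw : WeakLim u U) : MemH U := by
  refine memH_iff.2 ⟨⟨hU, fun i => ?_⟩, ?_⟩
  · obtain ⟨G, h1, h2, -⟩ := exists_hasWeakPartial_of_weakLim (fun k => (hu k).1.1)
      (fun k => (hu k).1.memLp_weakPartial i) (fun k => (hu k).1.hasWeakPartial i)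
      (fun k => (mass_weakPartial_le _ i).trans (hG k)) hU hw
    exact ⟨G, h1, h2⟩
  · obtain ⟨G, hG2, s, hs, hGw⟩ := exists_weakLim (fun k => (hu k).memLp_potComp)
      (fun k => (potentialEnergy_eq (u k)).symm.trans_le (hP k))
    refine hG2.ae_eq ?_
    have hUl : LocallyIntegrable (potComp U) volume :=
      ((hU.locallyIntegrable (by norm_num)).continuous_smul
        (Complex.continuous_ofReal.comp continuous_potential.sqrt))
    -- the weak limit `G` of `√V u` is identified with `√V U` by testing
    refine ae_eq_of_integral_contDiff_smul_eq (hG2.locallyIntegrable (by norm_num)) hUl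
      fun f hf hc => ?_
    have m1 : MemLp (fun x => (f x : ℂ)) 2 volume :=
      memLp_test (Complex.continuous_ofReal.comp hf.continuous)
        (hc.comp_left (g := fun t : ℝ => (t : ℂ)) rfl)
    have m2 : MemLp (potComp fun x => (f x : ℂ)) 2 volume :=
      memLp_test ((Complex.continuous_ofReal.comp continuous_potential.sqrt).mul
        (Complex.continuous_ofReal.comp hf.continuous))
        (hc.comp_left (g := fun t : ℝ => (t : ℂ)) rfl).mul_left
    have t1 := hGw.tendsto_integral_mul (fun k => (hu (s k)).memLp_potComp) hG2 m1
    have t2 := (hw.tendsto_integral_mul (fun k => (hu k).1.1) hU m2).comp hs.tendsto_atTop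
    simp only [Complex.real_smul]
    have e : ∀ v : Space n → ℂ, ∫ x, potComp (fun x => (f x : ℂ)) x * v x
        = ∫ x, (f x : ℂ) * potComp v x := fun v => by
      refine integral_congr_ae (ae_of_all _ fun x => ?_)
      simp only [potComp]
      ring
    rw [← e]
    exact tendsto_nhds_unique t1 (t2.congr fun k => e _)

/-! ### The uncertainty principle -/

/-- Heisenberg's inequality in one coordinate. -/
theorem mass_le_uncertainty {u : Space n → ℂ} (hu : MemH1 u) (i : Fin n)
    (hx : MemLp (fun x => (x i : ℂ) * u x) 2 volume) :
    mass u ≤ 2 * (√(mass (weakPartial i u)) * √(mass fun x => (x i : ℂ) * u x)) := by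
  set A := √(mass (weakPartial i u))
  set X := √(mass fun x => (x i : ℂ) * u x)
  have hA : 0 ≤ A := Real.sqrt_nonneg _
  -- comparison of `∫ xᵢ |u|²` before and after a translation by `h`
  have key : ∀ h : ℝ, 0 < h → mass u ≤ A * (2 * X + h * √(mass u)) := by
    intro h hh
    let e : Space n := EuclideanSpace.single i 1
    let τ : Space n → ℂ := fun x => u (x + h • e)
    have hτ : MemLp τ 2 volume := memLp_comp_add hu.1 _
    have hei : ∀ x : Space n, (x + h • e) i = x i + h := fun x => by simp [e]
    have hxh : MemLp (fun x => ((x i - h : ℝ) : ℂ) * u x) 2 volume := by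
      have := hx.sub (hu.1.const_mul (h : ℂ))
      refine this.ae_eq (ae_of_all _ fun x => ?_)
      simp only [Pi.sub_apply]
      push_cast
      ring
    have hxτ : MemLp (fun x => (x i : ℂ) * τ x) 2 volume := by
      have := memLp_comp_add hxh (h • e)
      simpa only [hei, add_sub_cancel_right] using this
    have eτ : mass (fun x => (x i : ℂ) * τ x) = mass (fun x => ((x i - h : ℝ) : ℂ) * u x) := by
      have := mass_comp_add (fun x => ((x i - h : ℝ) : ℂ) * u x) (h • e)
      simpa only [hei, add_sub_cancel_right] using this
    have bτ : √(mass fun x => (x i : ℂ) * τ x) ≤ X + h * √(mass u) := by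
      rw [eτ, ← norm_toLp_eq_sqrt hxh]
      have e1 : hxh.toLp = hx.toLp - ((hu.1.const_smul (h : ℂ))).toLp := by
        rw [← MemLp.toLp_sub]
        refine MemLp.toLp_congr _ _ (ae_of_all _ fun x => ?_)
        simp only [Pi.sub_apply, Pi.smul_apply, smul_eq_mul]
        push_cast
        ring
      rw [e1]
      refine (norm_sub_le _ _).trans ?_
      rw [norm_toLp_eq_sqrt, norm_toLp_eq_sqrt, mass_smul, Complex.norm_real, Real.norm_eq_abs,
        sq_abs, Real.sqrt_mul (sq_nonneg _), Real.sqrt_sq hh.le]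
    have iu : Integrable (fun x => x i * ‖u x‖ ^ 2) := by
      have := integrable_inner hx hu.1
      refine this.congr (ae_of_all _ fun x => ?_)
      simp only [inner_eq_re_mul_conj, mul_assoc, Complex.mul_conj, Complex.re_ofReal_mul,
        Complex.ofReal_re, Complex.normSq_eq_norm_sq]
    have iτ : Integrable (fun x => x i * ‖τ x‖ ^ 2) := by
      have := integrable_inner hxτ hτ
      refine this.congr (ae_of_all _ fun x => ?_)
      simp only [inner_eq_re_mul_conj, mul_assoc, Complex.mul_conj, Complex.re_ofReal_mul,
        Complex.ofReal_re, Complex.normSq_eq_norm_sq]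
    have e2 : ∫ x, x i * ‖τ x‖ ^ 2 = (∫ x, x i * ‖u x‖ ^ 2) - h * mass u := by
      have : ∫ x, (x i - h) * ‖u x‖ ^ 2 = ∫ x, x i * ‖τ x‖ ^ 2 := by
        rw [← integral_add_right_eq_self _ (h • e)]
        simp only [hei, add_sub_cancel_right, τ]
      rw [← this, mass, ← integral_const_mul, ← integral_sub iu ((integrable_normSq hu.1).const_mul _)]
      simp only [sub_mul]
    have hd : MemLp (τ - u) 2 volume := hτ.sub hu.1
    have i1 := (hd.norm.integrable_mul hxτ.norm)
    have i2 := (hd.norm.integrable_mul hx.norm)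
    have e3 : h * mass u ≤ ∫ x, (‖(τ - u) x‖ * ‖(x i : ℂ) * τ x‖
        + ‖(τ - u) x‖ * ‖(x i : ℂ) * u x‖) := by
      have : h * mass u = ∫ x, (x i * ‖u x‖ ^ 2 - x i * ‖τ x‖ ^ 2) := by
        rw [integral_sub iu iτ, e2]; ring
      rw [this]
      refine integral_mono (iu.sub iτ) (i1.add i2) fun x => ?_
      simp only [norm_mul, Complex.norm_real, Real.norm_eq_abs, Pi.sub_apply]
      have h1 : |‖u x‖ - ‖τ x‖| ≤ ‖τ x - u x‖ := by
        rw [norm_sub_rev]; exact abs_norm_sub_norm_le _ _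
      calc x i * ‖u x‖ ^ 2 - x i * ‖τ x‖ ^ 2
          = x i * (‖u x‖ - ‖τ x‖) * (‖u x‖ + ‖τ x‖) := by ring
        _ ≤ |x i| * |‖u x‖ - ‖τ x‖| * (‖u x‖ + ‖τ x‖) := by
            rw [← abs_mul]
            gcongr
            exact le_abs_self _
        _ ≤ |x i| * ‖τ x - u x‖ * (‖u x‖ + ‖τ x‖) := by gcongr
        _ = _ := by ring
    have e4 : √(mass (τ - u)) ≤ h * A := by
      have h1 := mass_le_of_lintegral (by have := mass_nonneg (weakPartial i u); positivity) hd.1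
        (lintegral_translate_single_le hu i h)
      calc √(mass (τ - u)) ≤ √(h ^ 2 * mass (weakPartial i u)) := Real.sqrt_le_sqrt h1
        _ = h * A := by rw [Real.sqrt_mul (sq_nonneg _), Real.sqrt_sq hh.le]
    have hX : 0 ≤ X := Real.sqrt_nonneg _
    have hsu := Real.sqrt_nonneg (mass u)
    have e5 := integral_norm_mul_norm_le hd hxτ
    have e6 := integral_norm_mul_norm_le hd hx
    have e7 : h * mass u ≤ h * (A * (2 * X + h * √(mass u))) := by
      calc h * mass u ≤ _ := e3
        _ = _ := integral_add i1 i2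
        _ ≤ (h * A) * (X + h * √(mass u)) + (h * A) * X :=
            add_le_add (e5.trans (by gcongr)) (e6.trans (by gcongr))
        _ = _ := by ring
    exact le_of_mul_le_mul_left e7 hh
  have hlim : Tendsto (fun h : ℝ => A * (2 * X + h * √(mass u))) (𝓝[>] 0) (𝓝 (A * (2 * X))) := by
    have : Continuous fun h : ℝ => A * (2 * X + h * √(mass u)) := by fun_prop
    have h1 := this.tendsto 0
    simp only [zero_mul, add_zero] at h1
    exact h1.mono_left nhdsWithin_le_nhds
  have := ge_of_tendsto hlim (eventually_mem_nhdsWithin.mono fun h hh => key h hh)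
  linarith

theorem card_transversal (hn : 1 ≤ n) :
    ((Finset.univ.filter (fun i : Fin n => i.val + 1 < n)).card : ℝ) = n - 1 := by
  have h : (Finset.univ.filter (fun i : Fin n => i.val + 1 < n))
      = Finset.univ.erase (⟨n - 1, by omega⟩ : Fin n) := by
    ext i
    simp only [Finset.mem_filter, Finset.mem_univ, true_and, Finset.mem_erase, ne_eq, Fin.ext_iff,
      and_true]
    have := i.2
    omega
  rw [h, Finset.card_erase_of_mem (Finset.mem_univ _)]
  simp [Nat.cast_sub hn]

/-- The bottom of the transversal oscillator: `κ ‖∇u‖² + ∫ V |u|² ≥ √κ (n - 1) ‖u‖²`. -/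
theorem oscillator_le {κ : ℝ} (hκ : 0 < κ) (hn : 1 ≤ n) {u : Space n → ℂ} (hu : MemH u) :
    √κ * (n - 1) * mass u ≤ κ * gradNormSq u + potentialEnergy u := by
  let s := Finset.univ.filter (fun i : Fin n => i.val + 1 < n)
  have hxi : ∀ i ∈ s, MemLp (fun x => (x i : ℂ) * u x) 2 volume := by
    intro i hi
    refine hu.memLp_potComp.mono ?_ (ae_of_all _ fun x => ?_)
    · refine AEStronglyMeasurable.mul ?_ hu.1.1.1
      have : Continuous fun x : Space n => (x i : ℂ) := by fun_prop
      exact this.aestronglyMeasurable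
    · rw [potComp, norm_mul, norm_mul, Complex.norm_real, Complex.norm_real, Real.norm_eq_abs,
        Real.norm_eq_abs, abs_of_nonneg (Real.sqrt_nonneg _)]
      gcongr
      refine Real.abs_le_sqrt ?_
      exact Finset.single_le_sum (f := fun i => x i ^ 2) (fun _ _ => sq_nonneg _) hi
  have hpot : potentialEnergy u = ∑ i ∈ s, mass (fun x => (x i : ℂ) * u x) := by
    unfold mass potentialEnergy
    rw [← integral_finsetSum _ fun i hi => integrable_normSq (hxi i hi)]
    refine integral_congr_ae (ae_of_all _ fun x => ?_)
    simp only [potential, Finset.sum_mul, norm_mul, mul_pow, Complex.norm_real, Real.norm_eq_abs,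
      sq_abs]
    rfl
  -- the derivative in the free variable is dropped
  have hgrad : ∑ i ∈ s, mass (weakPartial i u) ≤ gradNormSq u :=
    Finset.sum_le_sum_of_subset_of_nonneg (Finset.filter_subset _ _) fun _ _ _ => mass_nonneg _
  -- one harmonic oscillator for each transversal coordinate
  have hterm : ∀ i ∈ s, √κ * mass u ≤ κ * mass (weakPartial i u)
      + mass (fun x => (x i : ℂ) * u x) := by
    intro i hi
    have h1 := mass_le_uncertainty hu.1 i (hxi i hi)
    have h2 := Real.sq_sqrt (mass_nonneg (weakPartial i u))
    have h3 := Real.sq_sqrt (mass_nonneg (fun x => (x i : ℂ) * u x))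
    have h4 := Real.sq_sqrt hκ.le
    have h5 := mul_le_mul_of_nonneg_left h1 (Real.sqrt_nonneg κ)
    have h6 : κ * mass (weakPartial i u) = (√κ * √(mass (weakPartial i u))) ^ 2 := by
      rw [mul_pow, h2, h4]
    nlinarith [sq_nonneg (√κ * √(mass (weakPartial i u)) - √(mass fun x => (x i : ℂ) * u x))]
  have hsum := Finset.sum_le_sum hterm
  rw [Finset.sum_const, nsmul_eq_mul, card_transversal hn, Finset.sum_add_distrib,
    ← Finset.mul_sum, ← hpot] at hsum
  have := mul_le_mul_of_nonneg_left hgrad hκ.le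
  linarith

/-! ### Trilinear integrals -/

theorem MemH1.memLp_three (hn3 : 3 ≤ n) (hn5 : n ≤ 5) {u : Space n → ℂ} (hu : MemH1 u) :
    MemLp u 3 volume := by
  obtain ⟨C, -, hC⟩ := exists_cube_le hn3 hn5
  exact (hC u hu).1

theorem integrable_cube {μ : Measure (Space n)} {f : Space n → ℂ} (hf : MemLp f 3 μ) :
    Integrable (fun x => ‖f x‖ ^ 3) μ := hf.integrable_norm_pow (p := 3) (by norm_num)

theorem integrable_triple {μ : Measure (Space n)} {f g h : Space n → ℂ} (hf : MemLp f 3 μ)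
    (hg : MemLp g 3 μ) (hh : MemLp h 3 μ) :
    Integrable (fun x => ‖f x‖ * ‖g x‖ * ‖h x‖) μ := by
  refine (((integrable_cube hf).add (integrable_cube hg)).add (integrable_cube hh)).mono'
    ((hf.1.norm.mul hg.1.norm).mul hh.1.norm) (ae_of_all _ fun x => ?_)
  rw [Real.norm_eq_abs, abs_of_nonneg (by positivity)]
  simp only [Pi.add_apply]
  have ha := norm_nonneg (f x)
  have hb := norm_nonneg (g x)
  have hc := norm_nonneg (h x)
  nlinarith [mul_nonneg ha (sq_nonneg (‖g x‖ - ‖h x‖)), mul_nonneg hb (sq_nonneg (‖f x‖ - ‖h x‖)),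
    mul_nonneg hc (sq_nonneg (‖f x‖ - ‖g x‖)), mul_nonneg (add_nonneg ha hb) (sq_nonneg (‖f x‖ - ‖g x‖)),
    mul_nonneg (add_nonneg ha hc) (sq_nonneg (‖f x‖ - ‖h x‖)),
    mul_nonneg (add_nonneg hb hc) (sq_nonneg (‖g x‖ - ‖h x‖)), pow_nonneg ha 3, pow_nonneg hb 3,
    pow_nonneg hc 3]

theorem lintegral_cube {μ : Measure (Space n)} {f : Space n → ℂ} (hf : MemLp f 3 μ) :
    ∫⁻ x, ‖f x‖ₑ ^ 3 ∂μ = ENNReal.ofReal (∫ x, ‖f x‖ ^ 3 ∂μ) := by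
  rw [ofReal_integral_eq_lintegral_ofReal (integrable_cube hf) (ae_of_all _ fun _ => by positivity)]
  congr 1 with x
  rw [← ofReal_norm, ENNReal.ofReal_pow (norm_nonneg _)]

/-- Hölder's inequality for a product of three functions. -/
theorem integral_triple_le {μ : Measure (Space n)} {f g h : Space n → ℂ} (hf : MemLp f 3 μ)
    (hg : MemLp g 3 μ) (hh : MemLp h 3 μ) :
    ∫ x, ‖f x‖ * ‖g x‖ * ‖h x‖ ∂μ ≤ (∫ x, ‖f x‖ ^ 3 ∂μ) ^ (1 / 3 : ℝ)
      * (∫ x, ‖g x‖ ^ 3 ∂μ) ^ (1 / 3 : ℝ) * (∫ x, ‖h x‖ ^ 3 ∂μ) ^ (1 / 3 : ℝ) := by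
  have n1 : 0 ≤ ∫ x, ‖f x‖ ^ 3 ∂μ := integral_nonneg fun _ => by positivity
  have n2 : 0 ≤ ∫ x, ‖g x‖ ^ 3 ∂μ := integral_nonneg fun _ => by positivity
  have n3 : 0 ≤ ∫ x, ‖h x‖ ^ 3 ∂μ := integral_nonneg fun _ => by positivity
  have key := ENNReal.lintegral_prod_norm_pow_le (μ := μ) (Finset.univ : Finset (Fin 3))
    (f := ![fun x => ‖f x‖ₑ ^ 3, fun x => ‖g x‖ₑ ^ 3, fun x => ‖h x‖ₑ ^ 3])
    (by
      intro i _
      fin_cases i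
      · exact hf.1.enorm.pow_const 3
      · exact hg.1.enorm.pow_const 3
      · exact hh.1.enorm.pow_const 3)
    (p := fun _ => 1 / 3) (by simp) (by intro i _; norm_num)
  have hroot : ∀ a : ℝ≥0∞, (a ^ 3) ^ (1 / 3 : ℝ) = a := fun a => by
    rw [← ENNReal.rpow_natCast, ← ENNReal.rpow_mul]; norm_num
  simp only [Fin.prod_univ_three, Matrix.cons_val_zero, Matrix.cons_val_one, Matrix.cons_val,
    hroot] at key
  rw [lintegral_cube hf, lintegral_cube hg, lintegral_cube hh,
    ENNReal.ofReal_rpow_of_nonneg n1 (by norm_num), ENNReal.ofReal_rpow_of_nonneg n2 (by norm_num),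
    ENNReal.ofReal_rpow_of_nonneg n3 (by norm_num), ← ENNReal.ofReal_mul (by positivity),
    ← ENNReal.ofReal_mul (by positivity)] at key
  rw [← ENNReal.ofReal_le_ofReal_iff (by positivity)]
  refine le_trans (le_of_eq ?_) key
  rw [ofReal_integral_eq_lintegral_ofReal (integrable_triple hf hg hh)
    (ae_of_all _ fun _ => by positivity)]
  congr 1 with x
  rw [ENNReal.ofReal_mul (by positivity), ENNReal.ofReal_mul (by positivity), ofReal_norm,
    ofReal_norm, ofReal_norm]

theorem rpow_third_le {a C : ℝ} (ha : 0 ≤ a) (h : a ≤ C) : a ^ (1 / 3 : ℝ) ≤ C ^ (1 / 3 : ℝ) := by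
  gcongr

/-- Trilinear integrals of a fixed function, a bounded sequence and a locally vanishing bounded
sequence of `L³` tend to zero. -/
theorem tendsto_triple {f : Space n → ℂ} {g h : ℕ → Space n → ℂ} {C : ℝ} (hf : MemLp f 3 volume)
    (hg : ∀ k, MemLp (g k) 3 volume) (hh : ∀ k, MemLp (h k) 3 volume)
    (hgC : ∀ k, ∫ x, ‖g k x‖ ^ 3 ≤ C) (hhC : ∀ k, ∫ x, ‖h k x‖ ^ 3 ≤ C)
    (hloc : ∀ R : ℝ, Tendsto (fun k => ∫ x in Metric.ball 0 R, ‖h k x‖ ^ 3) atTop (𝓝 0)) :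
    Tendsto (fun k => ∫ x, ‖f x‖ * ‖g k x‖ * ‖h k x‖) atTop (𝓝 0) := by
  have hp : ∀ (T : Set (Space n)) (v : Space n → ℂ), 0 ≤ ∫ x in T, ‖v x‖ ^ 3 :=
    fun T v => integral_nonneg fun _ => by positivity
  have hp' : ∀ v : Space n → ℂ, 0 ≤ ∫ x, ‖v x‖ ^ 3 :=
    fun v => integral_nonneg fun _ => by positivity
  have hC0 : 0 ≤ C := (hp' _).trans (hgC 0)
  have htail : Tendsto (fun R : ℕ => ∫ x in (Metric.ball (0 : Space n) R)ᶜ, ‖f x‖ ^ 3) atTop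
      (𝓝 0) := by
    have := tendsto_setIntegral_of_antitone (μ := volume) (f := fun x => ‖f x‖ ^ 3)
      (s := fun R : ℕ => (Metric.ball (0 : Space n) R)ᶜ)
      (fun R => Metric.isOpen_ball.measurableSet.compl)
      (fun a b hab => Set.compl_subset_compl.2 (Metric.ball_subset_ball (by exact_mod_cast hab)))
      ⟨0, (integrable_cube hf).integrableOn⟩
    have he : (⋂ R : ℕ, (Metric.ball (0 : Space n) R)ᶜ) = ∅ := by
      ext x
      simp only [Set.mem_iInter, Set.mem_compl_iff, Metric.mem_ball, dist_zero_right,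
        Set.mem_empty_iff_false, iff_false, not_forall, not_not]
      exact exists_nat_gt _
    simpa [he] using this
  have hroot : ∀ {a : ℕ → ℝ}, Tendsto a atTop (𝓝 0) →
      Tendsto (fun k => a k ^ (1 / 3 : ℝ)) atTop (𝓝 0) := fun ha => by
    have := ((Real.continuous_rpow_const (q := (1 / 3 : ℝ)) (by norm_num)).tendsto 0).comp ha
    rwa [Real.zero_rpow (by norm_num)] at this
  have hbd : ∀ (k R : ℕ), ∫ x, ‖f x‖ * ‖g k x‖ * ‖h k x‖ ≤
      (∫ x, ‖f x‖ ^ 3) ^ (1 / 3 : ℝ) * C ^ (1 / 3 : ℝ)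
        * (∫ x in Metric.ball 0 R, ‖h k x‖ ^ 3) ^ (1 / 3 : ℝ)
      + (∫ x in (Metric.ball 0 R)ᶜ, ‖f x‖ ^ 3) ^ (1 / 3 : ℝ) * C ^ (1 / 3 : ℝ)
        * C ^ (1 / 3 : ℝ) := by
    intro k R
    have hle : ∀ (T : Set (Space n)) {v : Space n → ℂ}, MemLp v 3 volume →
        ∫ x in T, ‖v x‖ ^ 3 ≤ ∫ x, ‖v x‖ ^ 3 := fun T v hv =>
      setIntegral_le_integral (integrable_cube hv) (ae_of_all _ fun _ => by positivity)
    rw [← integral_add_compl (Metric.isOpen_ball (x := (0 : Space n)) (ε := R)).measurableSet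
      (integrable_triple hf (hg k) (hh k))]
    have r0 : ∀ {c : ℝ}, 0 ≤ c → 0 ≤ c ^ (1 / 3 : ℝ) := fun hc => Real.rpow_nonneg hc _
    have g1 : ∀ T : Set (Space n), (∫ x in T, ‖g k x‖ ^ 3) ^ (1 / 3 : ℝ) ≤ C ^ (1 / 3 : ℝ) :=
      fun T => rpow_third_le (hp _ _) ((hle T (hg k)).trans (hgC k))
    have h1 : ∀ T : Set (Space n), (∫ x in T, ‖h k x‖ ^ 3) ^ (1 / 3 : ℝ) ≤ C ^ (1 / 3 : ℝ) :=
      fun T => rpow_third_le (hp _ _) ((hle T (hh k)).trans (hhC k))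
    refine add_le_add ((integral_triple_le (hf.restrict _) ((hg k).restrict _)
      ((hh k).restrict _)).trans ?_) ((integral_triple_le (hf.restrict _) ((hg k).restrict _)
      ((hh k).restrict _)).trans ?_)
    · exact mul_le_mul_of_nonneg_right (mul_le_mul (rpow_third_le (hp _ _) (hle _ hf)) (g1 _)
        (r0 (hp _ _)) (r0 (hp' _))) (r0 (hp _ _))
    · exact mul_le_mul (mul_le_mul_of_nonneg_left (g1 _) (r0 (hp _ _))) (h1 _) (r0 (hp _ _))
        (mul_nonneg (r0 (hp _ _)) (r0 hC0))
  rw [Metric.tendsto_atTop]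
  intro ε hε
  have t1 := ((hroot htail).mul_const (C ^ (1 / 3 : ℝ))).mul_const (C ^ (1 / 3 : ℝ))
  rw [zero_mul, zero_mul] at t1
  obtain ⟨R, hR⟩ := (t1.eventually (gt_mem_nhds (half_pos hε))).exists
  have t2 := (hroot (hloc R)).const_mul ((∫ x, ‖f x‖ ^ 3) ^ (1 / 3 : ℝ) * C ^ (1 / 3 : ℝ))
  rw [mul_zero] at t2
  obtain ⟨N, hN⟩ := eventually_atTop.1 (t2.eventually (gt_mem_nhds (half_pos hε)))
  refine ⟨N, fun k hk => ?_⟩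
  rw [dist_zero_right, Real.norm_eq_abs, abs_of_nonneg (integral_nonneg fun _ => by positivity)]
  have := hbd k R
  have := hN k hk
  linarith

/-! ### The interaction -/

theorem norm_sq_mul_conj (a b : ℂ) : ‖a ^ 2 * conj b‖ = ‖a‖ * ‖a‖ * ‖b‖ := by
  rw [norm_mul, norm_pow, RCLike.norm_conj, sq]

theorem integrable_interaction {f g : Space n → ℂ} (hf : MemLp f 3 volume)
    (hg : MemLp g 3 volume) : Integrable (fun x => f x ^ 2 * conj (g x)) :=
  (integrable_triple hf hf hg).mono' ((hf.1.pow 2).mul hg.1.star)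
    (ae_of_all _ fun _ => (norm_sq_mul_conj _ _).le)

theorem abs_interaction_le (f g : Space n → ℂ) :
    |interaction (f, g)| ≤ ∫ x, ‖f x‖ * ‖f x‖ * ‖g x‖ := by
  refine (Complex.abs_re_le_norm _).trans ((norm_integral_le_integral_norm _).trans (le_of_eq ?_))
  simp only [norm_sq_mul_conj]

theorem interaction_norm (f g : Space n → ℂ) :
    interaction ((fun x => (‖f x‖ : ℂ)), fun x => (‖g x‖ : ℂ)) = ∫ x, ‖f x‖ * ‖f x‖ * ‖g x‖ := by
  unfold interaction
  have : ∀ x, ((‖f x‖ : ℂ)) ^ 2 * conj (‖g x‖ : ℂ) = ((‖f x‖ * ‖f x‖ * ‖g x‖ : ℝ) : ℂ) := fun x => by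
    rw [Complex.conj_ofReal]; push_cast; ring
  simp only [this]
  rw [integral_complex_ofReal, Complex.ofReal_re]

theorem interaction_le_norm (f g : Space n → ℂ) :
    interaction (f, g) ≤ interaction ((fun x => (‖f x‖ : ℂ)), fun x => (‖g x‖ : ℂ)) := by
  rw [interaction_norm]
  exact (le_abs_self _).trans (abs_interaction_le f g)

theorem interaction_smul (a b : ℝ) (f g : Space n → ℂ) :
    interaction ((a : ℂ) • f, (b : ℂ) • g) = a ^ 2 * b * interaction (f, g) := by
  unfold interaction
  have : ∀ x, ((a : ℂ) • f) x ^ 2 * conj (((b : ℂ) • g) x)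
      = ((a ^ 2 * b : ℝ) : ℂ) * (f x ^ 2 * conj (g x)) := fun x => by
    simp only [Pi.smul_apply, smul_eq_mul, map_mul, Complex.conj_ofReal]
    push_cast
    ring
  simp only [this]
  rw [integral_const_mul, Complex.re_ofReal_mul]

theorem interaction_comp_add (f g : Space n → ℂ) (y : Space n) :
    interaction ((fun x => f (x + y)), fun x => g (x + y)) = interaction (f, g) := by
  unfold interaction
  simp only
  rw [integral_add_right_eq_self (fun x => f x ^ 2 * conj (g x)) y]

theorem abs_interaction_add_sub_le {a b x y : Space n → ℂ} (ha : MemLp a 3 volume)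
    (hb : MemLp b 3 volume) (hx : MemLp x 3 volume) (hy : MemLp y 3 volume) :
    |interaction (a + x, b + y) - interaction (x, y) - interaction (a, b)|
      ≤ 2 * (∫ t, ‖b t‖ * ‖a t‖ * ‖x t‖) + (∫ t, ‖b t‖ * ‖x t‖ * ‖x t‖)
        + (∫ t, ‖a t‖ * ‖a t‖ * ‖y t‖) + 2 * ∫ t, ‖a t‖ * ‖x t‖ * ‖y t‖ := by
  have i1 := integrable_interaction (ha.add hx) (hb.add hy)
  have i2 := integrable_interaction hx hy
  have i3 := integrable_interaction ha hb
  have j1 := integrable_triple hb ha hx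
  have j2 := integrable_triple hb hx hx
  have j3 := integrable_triple ha ha hy
  have j4 := integrable_triple ha hx hy
  unfold interaction
  simp only
  have i12 : Integrable (fun t => (a + x) t ^ 2 * conj ((b + y) t) - x t ^ 2 * conj (y t)) :=
    i1.sub i2
  have j12 : Integrable (fun t => 2 * (‖b t‖ * ‖a t‖ * ‖x t‖) + ‖b t‖ * ‖x t‖ * ‖x t‖) :=
    (j1.const_mul 2).add j2
  have j123 : Integrable (fun t => 2 * (‖b t‖ * ‖a t‖ * ‖x t‖) + ‖b t‖ * ‖x t‖ * ‖x t‖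
      + ‖a t‖ * ‖a t‖ * ‖y t‖) := j12.add j3
  have j1234 : Integrable (fun t => 2 * (‖b t‖ * ‖a t‖ * ‖x t‖) + ‖b t‖ * ‖x t‖ * ‖x t‖
      + ‖a t‖ * ‖a t‖ * ‖y t‖ + 2 * (‖a t‖ * ‖x t‖ * ‖y t‖)) := j123.add (j4.const_mul 2)
  rw [← Complex.sub_re, ← Complex.sub_re, ← integral_sub i1 i2, ← integral_sub i12 i3,
    ← integral_const_mul, ← integral_const_mul, ← integral_add (j1.const_mul 2) j2,
    ← integral_add j12 j3, ← integral_add j123 (j4.const_mul 2)]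
  refine (Complex.abs_re_le_norm _).trans (norm_integral_le_of_norm_le j1234
    (ae_of_all _ fun t => ?_))
  have e : (a + x) t ^ 2 * conj ((b + y) t) - x t ^ 2 * conj (y t) - a t ^ 2 * conj (b t)
      = 2 * (a t * x t * conj (b t)) + x t ^ 2 * conj (b t) + a t ^ 2 * conj (y t)
        + 2 * (a t * x t * conj (y t)) := by
    simp only [Pi.add_apply, map_add]
    ring
  rw [e]
  refine (norm_add_le _ _).trans (add_le_add ((norm_add_le _ _).trans
    (add_le_add ((norm_add_le _ _).trans (add_le_add (le_of_eq ?_) (le_of_eq ?_)))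
      (le_of_eq ?_))) (le_of_eq ?_))
  · simp only [norm_mul, RCLike.norm_conj, Complex.norm_ofNat]; ring
  · simp only [norm_sq_mul_conj]; ring
  · simp only [norm_sq_mul_conj]
  · simp only [norm_mul, RCLike.norm_conj, Complex.norm_ofNat]

/-! ### Weakly null sequences -/

/-- A bounded sequence of the energy space which tends weakly to zero in `L²`. -/
structure WeakNull (r : ℕ → Space n → ℂ) : Prop where
  memH : ∀ k, MemH (r k)
  bdd : ∃ C, ∀ k, mass (r k) ≤ C ∧ gradNormSq (r k) ≤ C ∧ potentialEnergy (r k) ≤ C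
  weak : WeakLim r 0

theorem WeakLim.comp {u : ℕ → Space n → ℂ} {U : Space n → ℂ} (hw : WeakLim u U) {s : ℕ → ℕ}
    (hs : StrictMono s) : WeakLim (fun k => u (s k)) U :=
  fun g hg => (hw g hg).comp hs.tendsto_atTop

theorem WeakNull.comp {r : ℕ → Space n → ℂ} (hr : WeakNull r) {s : ℕ → ℕ} (hs : StrictMono s) :
    WeakNull fun k => r (s k) :=
  ⟨fun _ => hr.memH _, hr.bdd.imp fun _ h _ => h _, hr.weak.comp hs⟩

theorem WeakNull.smul {r : ℕ → Space n → ℂ} (c : ℝ) (hr : WeakNull r) :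
    WeakNull fun k => (c : ℂ) • r k := by
  obtain ⟨C, hC⟩ := hr.bdd
  refine ⟨fun k => (hr.memH k).smul _, ⟨‖(c : ℂ)‖ ^ 2 * C, fun k => ?_⟩, fun g hg => ?_⟩
  · rw [mass_smul, gradNormSq_smul _ (hr.memH k).1, potentialEnergy_smul]
    exact ⟨by gcongr; exact (hC k).1, by gcongr; exact (hC k).2.1, by gcongr; exact (hC k).2.2⟩
  · have h := (hr.weak g hg).const_mul c
    simp only [reInner_smul_left]
    have hz : reInner (0 : Space n → ℂ) g = 0 := by simp [reInner]
    rw [hz, mul_zero] at h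
    rw [hz]
    exact h

theorem WeakNull.tendsto_local {r : ℕ → Space n → ℂ} (hr : WeakNull r) (R : ℝ) :
    Tendsto (fun k => ∫ x in Metric.ball 0 R, ‖r k x‖ ^ 2) atTop (𝓝 0) := by
  obtain ⟨C, hC⟩ := hr.bdd
  exact hr.weak.tendsto_local (fun k => (hr.memH k).1) (fun k => (hC k).1) (fun k => (hC k).2.1) R

theorem WeakNull.exists_cube_bound (hn3 : 3 ≤ n) (hn5 : n ≤ 5) {r : ℕ → Space n → ℂ}
    (hr : WeakNull r) : ∃ C, ∀ k, ∫ x, ‖r k x‖ ^ 3 ≤ C := by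
  obtain ⟨C, hC⟩ := hr.bdd
  obtain ⟨K, hK0, hK⟩ := exists_cube_le hn3 hn5
  have hnR5 : (n : ℝ) ≤ 5 := by exact_mod_cast hn5
  refine ⟨K * C ^ ((6 - n : ℝ) / 4) * C ^ ((n : ℝ) / 4), fun k => ?_⟩
  have h := (hK (r k) (hr.memH k).1).2 Set.univ MeasurableSet.univ
  simp only [Measure.restrict_univ] at h
  refine h.trans ?_
  have h1 : 0 ≤ ∫ x, ‖r k x‖ ^ 2 := mass_nonneg (r k)
  have h2 := gradNormSq_nonneg (r k)
  have h3 := (mass_nonneg (r k)).trans (hC k).1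
  gcongr
  · linarith
  · exact (hC k).1
  · exact (hC k).2.1

theorem WeakNull.tendsto_cube_local (hn3 : 3 ≤ n) (hn5 : n ≤ 5) {r : ℕ → Space n → ℂ}
    (hr : WeakNull r) (R : ℝ) :
    Tendsto (fun k => ∫ x in Metric.ball 0 R, ‖r k x‖ ^ 3) atTop (𝓝 0) := by
  obtain ⟨C, hC⟩ := hr.bdd
  obtain ⟨K, hK0, hK⟩ := exists_cube_le hn3 hn5
  have hnR5 : (n : ℝ) ≤ 5 := by exact_mod_cast hn5
  have hθ : (0 : ℝ) < (6 - n : ℝ) / 4 := by linarith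
  have h1 := ((Real.continuous_rpow_const (q := ((6 - n : ℝ) / 4)) hθ.le).tendsto 0).comp
    (hr.tendsto_local R)
  rw [Real.zero_rpow hθ.ne'] at h1
  have h2 := (h1.const_mul K).mul_const (C ^ ((n : ℝ) / 4))
  rw [mul_zero, zero_mul] at h2
  refine squeeze_zero (fun k => integral_nonneg fun _ => by positivity) (fun k => ?_) h2
  refine ((hK (r k) (hr.memH k).1).2 _ Metric.isOpen_ball.measurableSet).trans ?_
  have h3 := gradNormSq_nonneg (r k)
  have h4 : 0 ≤ ∫ x in Metric.ball 0 R, ‖r k x‖ ^ 2 := integral_nonneg fun _ => by positivity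
  simp only [Function.comp_apply]
  gcongr
  exact (hC k).2.1

theorem WeakNull.weakLim_weakPartial {r : ℕ → Space n → ℂ} (hr : WeakNull r) (i : Fin n) :
    WeakLim (fun k => weakPartial i (r k)) 0 := by
  obtain ⟨C, hC⟩ := hr.bdd
  refine WeakLim.of_test (C := C) (fun k => (hr.memH k).1.memLp_weakPartial i)
    (fun k => (mass_weakPartial_le _ i).trans (hC k).2.1) fun f hf hc => ?_
  have hfc : ContDiff ℝ ∞ (fun x => conj (f x)) :=
    ((Complex.conjCLE : ℂ →L[ℝ] ℂ).contDiff.comp hf :)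
  have hcc : HasCompactSupport (fun x => conj (f x)) := hc.comp_left (g := conj) (by simp)
  have hm : MemLp (fun x => conj (f x)) 2 volume := memLp_test hfc.continuous hcc
  have hf1 : ContDiff ℝ 1 (fun x => conj (f x)) := hfc.of_le (by norm_num)
  have hd : MemLp (partialDeriv i fun x => conj (f x)) 2 volume :=
    memLp_test (continuous_partialDeriv i hf1) (hasCompactSupport_partialDeriv i hcc)
  have h1 := (hr.weak.tendsto_integral_mul (fun k => (hr.memH k).1.1) MemLp.zero hd).neg
  have h2 : ∀ k, reInner (weakPartial i (r k)) f
      = (-∫ x, partialDeriv i (fun x => conj (f x)) x * r k x).re := fun k => by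
    rw [((hr.memH k).1.hasWeakPartial i).test_complex hfc hcc, neg_neg,
      integral_mul_eq ((hr.memH k).1.memLp_weakPartial i) hm]
    simp
  simp only [h2]
  have h3 := (Complex.continuous_re.tendsto _).comp h1
  simpa [Function.comp_def] using h3

theorem potential_le_norm_sq (x : Space n) : potential x ≤ ‖x‖ ^ 2 := by
  rw [EuclideanSpace.norm_sq_eq]
  simp only [Real.norm_eq_abs, sq_abs]
  exact Finset.sum_le_sum_of_subset_of_nonneg (Finset.filter_subset _ _) fun _ _ _ => sq_nonneg _

theorem WeakNull.weakLim_potComp {r : ℕ → Space n → ℂ} (hr : WeakNull r) :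
    WeakLim (fun k => potComp (r k)) 0 := by
  obtain ⟨C, hC⟩ := hr.bdd
  refine WeakLim.of_local (C := C) (fun k => (hr.memH k).memLp_potComp)
    (fun k => (potentialEnergy_eq _).symm.trans_le (hC k).2.2) fun R => ?_
  have h1 := (hr.tendsto_local R).const_mul (R ^ 2)
  rw [mul_zero] at h1
  refine squeeze_zero (fun k => integral_nonneg fun _ => by positivity) (fun k => ?_) h1
  rw [← integral_const_mul]
  refine setIntegral_mono_on (integrable_normSq (hr.memH k).memLp_potComp).integrableOn
    ((integrable_normSq (hr.memH k).1.1).const_mul _).integrableOn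
    Metric.isOpen_ball.measurableSet fun x hx => ?_
  rw [norm_potComp_sq]
  have h2 : ‖x‖ < R := by simpa using hx
  gcongr
  exact (potential_le_norm_sq x).trans (by gcongr)

/-- The quantities entering the variational problem, in the order masses, gradients, potential
energies, interaction. -/
def energyData (p : (Space n → ℂ) × (Space n → ℂ)) : Fin 7 → ℝ :=
  ![mass p.1, mass p.2, gradNormSq p.1, gradNormSq p.2, potentialEnergy p.1, potentialEnergy p.2,
    interaction p]

theorem tendsto_gradNormSq_add_sub {P : Space n → ℂ} {r : ℕ → Space n → ℂ} (hP : MemH P)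
    (hr : WeakNull r) :
    Tendsto (fun k => gradNormSq (P + r k) - gradNormSq (r k)) atTop (𝓝 (gradNormSq P)) := by
  have h := tendsto_finsetSum (Finset.univ : Finset (Fin n)) fun i _ =>
    tendsto_mass_add_sub (hP.1.memLp_weakPartial i) (fun k => (hr.memH k).1.memLp_weakPartial i)
      (hr.weakLim_weakPartial i)
  refine h.congr fun k => ?_
  rw [Finset.sum_sub_distrib, gradNormSq_eq, gradNormSq_eq]
  congr 1
  exact Finset.sum_congr rfl fun i _ => (mass_congr (weakPartial_add hP.1 (hr.memH k).1 i)).symm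

theorem tendsto_potentialEnergy_add_sub {P : Space n → ℂ} {r : ℕ → Space n → ℂ} (hP : MemH P)
    (hr : WeakNull r) :
    Tendsto (fun k => potentialEnergy (P + r k) - potentialEnergy (r k)) atTop
      (𝓝 (potentialEnergy P)) := by
  simp only [potentialEnergy_eq, potComp_add]
  exact tendsto_mass_add_sub hP.memLp_potComp (fun k => (hr.memH k).memLp_potComp)
    hr.weakLim_potComp

theorem tendsto_interaction_add_sub (hn3 : 3 ≤ n) (hn5 : n ≤ 5) {P Q : Space n → ℂ}
    {r s : ℕ → Space n → ℂ} (hP : MemH P) (hQ : MemH Q) (hr : WeakNull r) (hs : WeakNull s) :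
    Tendsto (fun k => interaction (P + r k, Q + s k) - interaction (r k, s k)) atTop
      (𝓝 (interaction (P, Q))) := by
  have mP := hP.1.memLp_three hn3 hn5
  have mQ := hQ.1.memLp_three hn3 hn5
  have mr := fun k => (hr.memH k).1.memLp_three hn3 hn5
  have ms := fun k => (hs.memH k).1.memLp_three hn3 hn5
  obtain ⟨C, hC⟩ := hr.exists_cube_bound hn3 hn5
  obtain ⟨C', hC'⟩ := hs.exists_cube_bound hn3 hn5
  have lr := hr.tendsto_cube_local hn3 hn5
  have ls := hs.tendsto_cube_local hn3 hn5
  let M := max (max C C') (max (∫ x, ‖P x‖ ^ 3) (∫ x, ‖Q x‖ ^ 3))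
  have bC : ∀ k, ∫ x, ‖r k x‖ ^ 3 ≤ M := fun k => (hC k).trans (by simp [M])
  have bC' : ∀ k, ∫ x, ‖s k x‖ ^ 3 ≤ M := fun k => (hC' k).trans (by simp [M])
  have bP : ∫ x, ‖P x‖ ^ 3 ≤ M := by simp [M]
  have t1 := tendsto_triple (C := M) mQ (fun _ => mP) mr (fun _ => bP) bC lr
  have t2 := tendsto_triple (C := M) mQ mr mr bC bC lr
  have t3 := tendsto_triple (C := M) mP (fun _ => mP) ms (fun _ => bP) bC' ls
  have t4 := tendsto_triple (C := M) mP mr ms bC bC' ls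
  have t := (((t1.const_mul 2).add t2).add t3).add (t4.const_mul 2)
  simp only [mul_zero, add_zero] at t
  rw [tendsto_iff_dist_tendsto_zero]
  refine squeeze_zero (fun _ => dist_nonneg) (fun k => ?_) t
  rw [Real.dist_eq]
  exact abs_interaction_add_sub_le mP mQ (mr k) (ms k)

theorem gradNormSq_add_le {u v : Space n → ℂ} (hu : MemH1 u) (hv : MemH1 v) :
    gradNormSq (u + v) ≤ 2 * gradNormSq u + 2 * gradNormSq v := by
  rw [gradNormSq_eq, gradNormSq_eq, gradNormSq_eq, Finset.mul_sum, Finset.mul_sum,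
    ← Finset.sum_add_distrib]
  refine Finset.sum_le_sum fun i _ => ?_
  rw [mass_congr (weakPartial_add hu hv i)]
  exact mass_add_le (hu.memLp_weakPartial i) (hv.memLp_weakPartial i)

theorem potentialEnergy_add_le {u v : Space n → ℂ} (hu : MemH u) (hv : MemH v) :
    potentialEnergy (u + v) ≤ 2 * potentialEnergy u + 2 * potentialEnergy v := by
  simp only [potentialEnergy_eq, potComp_add]
  exact mass_add_le hu.memLp_potComp hv.memLp_potComp

/-- Weak compactness in the energy space. -/
theorem exists_weakNull_sub {u : ℕ → Space n → ℂ} {C : ℝ} (hu : ∀ k, MemH (u k))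
    (hC : ∀ k, mass (u k) ≤ C ∧ gradNormSq (u k) ≤ C ∧ potentialEnergy (u k) ≤ C) :
    ∃ (U : Space n → ℂ) (s : ℕ → ℕ), MemH U ∧ StrictMono s ∧ WeakLim (fun k => u (s k)) U ∧
      WeakNull fun k => u (s k) - U := by
  obtain ⟨U, hU, s, hs, hw⟩ := exists_weakLim (fun k => (hu k).1.1) (fun k => (hC k).1)
  have hUH : MemH U := MemH.of_weakLim (fun k => hu (s k)) (fun k => (hC (s k)).2.1)
    (fun k => (hC (s k)).2.2) hU hw
  refine ⟨U, s, hUH, hs, hw, fun k => (hu _).sub hUH, ?_, fun g hg => ?_⟩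
  · let B := mass U + gradNormSq U + potentialEnergy U
    refine ⟨2 * C + 2 * B, fun k => ?_⟩
    have h1 := mass_nonneg U
    have h2 := gradNormSq_nonneg U
    have h3 := potentialEnergy_nonneg U
    have e : u (s k) - U = u (s k) + (-1 : ℂ) • U := by rw [neg_one_smul, sub_eq_add_neg]
    have hm : MemH ((-1 : ℂ) • U) := hUH.smul _
    have a1 := mass_add_le (hu (s k)).1.1 hm.1.1
    have a2 := gradNormSq_add_le (hu (s k)).1 hm.1
    have a3 := potentialEnergy_add_le (hu (s k)) hm
    rw [mass_smul] at a1
    rw [gradNormSq_smul _ hUH.1] at a2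
    rw [potentialEnergy_smul] at a3
    simp only [norm_neg, norm_one, one_pow, one_mul] at a1 a2 a3
    rw [e]
    obtain ⟨b1, b2, b3⟩ := hC (s k)
    refine ⟨?_, ?_, ?_⟩ <;> simp only [B] <;> linarith
  · have h1 := (hw g hg).sub_const (reInner U g)
    have hz : reInner (0 : Space n → ℂ) g = 0 := by simp [reInner]
    rw [sub_self] at h1
    rw [hz]
    refine h1.congr fun k => ?_
    have := reInner_add_left ((hu (s k)).1.1.sub hU) hU hg
    rw [sub_add_cancel] at this
    linarith

/-! ### Gaussian profiles -/

/-- The anisotropic Gaussian `exp (- ∑ bᵢ xᵢ²)`. -/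
def gaussExp (b : Fin n → ℝ) (x : Space n) : ℝ := Real.exp (-∑ i, b i * x i ^ 2)

theorem gaussExp_pos (b : Fin n → ℝ) (x : Space n) : 0 < gaussExp b x := Real.exp_pos _

theorem gaussExp_mul (b c : Fin n → ℝ) (x : Space n) :
    gaussExp b x * gaussExp c x = gaussExp (b + c) x := by
  unfold gaussExp
  rw [← Real.exp_add]
  congr 1
  simp only [Pi.add_apply, add_mul, Finset.sum_add_distrib]
  ring

theorem contDiff_gaussExp (b : Fin n → ℝ) : ContDiff ℝ ∞ (gaussExp b) := by
  have h : ∀ i : Fin n, ContDiff ℝ ∞ fun x : Space n => x i := fun i =>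
    (EuclideanSpace.proj i : Space n →L[ℝ] ℝ).contDiff
  unfold gaussExp
  exact Real.contDiff_exp.comp
    (ContDiff.neg (ContDiff.sum fun i _ => contDiff_const.mul ((h i).pow 2)))

theorem gaussExp_ofLp (b : Fin n → ℝ) (x : Fin n → ℝ) :
    gaussExp b (WithLp.toLp 2 x) = ∏ i, Real.exp (-b i * x i ^ 2) := by
  unfold gaussExp
  rw [← Real.exp_sum, ← Finset.sum_neg_distrib]
  simp only [neg_mul]

theorem integrable_gaussExp {b : Fin n → ℝ} (hb : ∀ i, 0 < b i) : Integrable (gaussExp b) := by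
  rw [← (PiLp.volume_preserving_toLp (Fin n)).integrable_comp_emb
    (MeasurableEquiv.toLp 2 _).measurableEmbedding]
  simp only [Function.comp_def, gaussExp_ofLp]
  exact Integrable.fintype_prod (f := fun i (t : ℝ) => Real.exp (-b i * t ^ 2))
    fun i => integrable_exp_neg_mul_sq (hb i)

theorem integral_gaussExp (b : Fin n → ℝ) : ∫ x, gaussExp b x = ∏ i, √(Real.pi / b i) := by
  rw [← (PiLp.volume_preserving_toLp (Fin n)).integral_comp
    (MeasurableEquiv.toLp 2 _).measurableEmbedding]
  simp only [gaussExp_ofLp]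
  rw [integral_fintype_prod_volume_eq_prod (f := fun i (t : ℝ) => Real.exp (-b i * t ^ 2))]
  simp only [integral_gaussian]

theorem sq_mul_gaussExp_le {b : Fin n → ℝ} (hb : ∀ i, 0 < b i) (j : Fin n) (x : Space n) :
    x j ^ 2 * gaussExp b x ≤ 2 / b j * gaussExp (fun i => b i / 2) x := by
  have h1 : gaussExp b x = gaussExp (fun i => b i / 2) x * gaussExp (fun i => b i / 2) x := by
    rw [gaussExp_mul]
    congr 1
    ext i
    simp
  have h2 : gaussExp (fun i => b i / 2) x ≤ Real.exp (-(b j / 2 * x j ^ 2)) := by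
    refine Real.exp_le_exp.2 (neg_le_neg ?_)
    exact Finset.single_le_sum (f := fun i => b i / 2 * x i ^ 2)
      (fun i _ => mul_nonneg (half_pos (hb i)).le (sq_nonneg _)) (Finset.mem_univ j)
  have h3 : x j ^ 2 * Real.exp (-(b j / 2 * x j ^ 2)) ≤ 2 / b j := by
    have h4 := Real.add_one_le_exp (b j / 2 * x j ^ 2)
    have h5 : Real.exp (b j / 2 * x j ^ 2) * Real.exp (-(b j / 2 * x j ^ 2)) = 1 := by
      rw [← Real.exp_add]; simp
    have h6 : b j / 2 * x j ^ 2 * Real.exp (-(b j / 2 * x j ^ 2)) ≤ 1 := by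
      rw [← h5]
      gcongr
      linarith
    rw [le_div_iff₀ (hb j)]
    linarith
  rw [h1]
  calc x j ^ 2 * (gaussExp (fun i => b i / 2) x * gaussExp (fun i => b i / 2) x)
      ≤ x j ^ 2 * (Real.exp (-(b j / 2 * x j ^ 2)) * gaussExp (fun i => b i / 2) x) := by
        have := gaussExp_pos (fun i => b i / 2) x
        gcongr
    _ ≤ _ := by
        rw [← mul_assoc]
        have := gaussExp_pos (fun i => b i / 2) x
        gcongr

theorem integrable_sq_mul_gaussExp {b : Fin n → ℝ} (hb : ∀ i, 0 < b i) (j : Fin n) :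
    Integrable fun x : Space n => x j ^ 2 * gaussExp b x := by
  refine ((integrable_gaussExp fun i => half_pos (hb i)).const_mul (2 / b j)).mono' ?_
    (ae_of_all _ fun x => ?_)
  · have h1 : Continuous fun x : Space n => x j ^ 2 := by fun_prop
    exact (h1.mul (contDiff_gaussExp b).continuous).aestronglyMeasurable
  · rw [Real.norm_eq_abs, abs_of_nonneg (mul_nonneg (sq_nonneg _) (gaussExp_pos _ _).le)]
    exact sq_mul_gaussExp_le hb j x

theorem fderiv_gaussExp (b : Fin n → ℝ) (j : Fin n) (x : Space n) :
    fderiv ℝ (gaussExp b) x (EuclideanSpace.single j 1) = -(2 * b j * x j) * gaussExp b x := by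
  have h : ∀ i : Fin n, HasFDerivAt (fun x : Space n => b i * x i ^ 2)
      (b i • ((2 * x i) • (EuclideanSpace.proj i : Space n →L[ℝ] ℝ))) x := fun i => by
    have := ((EuclideanSpace.proj i : Space n →L[ℝ] ℝ).hasFDerivAt (x := x)).pow 2
    have := this.const_mul (b i)
    simpa using this
  have h2 : HasFDerivAt (gaussExp b) _ x := (HasFDerivAt.fun_sum fun i _ => h i).fun_neg.exp
  rw [h2.fderiv]
  have hp : ∀ i : Fin n, (EuclideanSpace.proj i : Space n →L[ℝ] ℝ) (EuclideanSpace.single j 1)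
      = if i = j then 1 else 0 := fun i => by simp
  simp only [smul_apply, neg_apply, sum_apply, hp,
    smul_eq_mul, mul_ite, mul_one, mul_zero, Finset.sum_ite_eq',
    Finset.mem_univ, if_true, gaussExp]
  ring

theorem integral_sq_mul_gaussExp {b : Fin n → ℝ} (hb : ∀ i, 0 < b i) (j : Fin n) :
    ∫ x : Space n, x j ^ 2 * gaussExp b x = (∫ x, gaussExp b x) / (2 * b j) := by
  have hj : ∀ x : Space n, fderiv ℝ (fun x : Space n => x j) x (EuclideanSpace.single j 1) = 1 :=
    fun x => by
      have := ((EuclideanSpace.proj j : Space n →L[ℝ] ℝ).hasFDerivAt (x := x)).fderiv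
      change fderiv ℝ (fun x : Space n => x j) x = _ at this
      rw [this]
      simp
  have i1 : Integrable fun x : Space n => x j * gaussExp b x := by
    refine ((integrable_gaussExp hb).add (integrable_sq_mul_gaussExp hb j)).mono' ?_
      (ae_of_all _ fun x => ?_)
    · have h1 : Continuous fun x : Space n => x j := by fun_prop
      exact (h1.mul (contDiff_gaussExp b).continuous).aestronglyMeasurable
    · have h0 := gaussExp_pos b x
      rw [norm_mul, Real.norm_eq_abs, Real.norm_eq_abs, abs_of_pos h0, Pi.add_apply]
      have : |x j| ≤ 1 + x j ^ 2 := by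
        rw [← sq_abs (x j)]
        nlinarith [sq_nonneg (|x j| - 1)]
      nlinarith
  have key := integral_mul_fderiv_eq_neg_fderiv_mul_of_integrable (μ := volume)
    (f := fun x : Space n => x j) (g := gaussExp b) (v := EuclideanSpace.single j 1)
    (by simpa only [hj, one_mul] using integrable_gaussExp hb)
    (by
      simp only [fderiv_gaussExp]
      refine ((integrable_sq_mul_gaussExp hb j).const_mul (-(2 * b j))).congr
        (ae_of_all _ fun x => ?_)
      simp only
      ring)
    i1 (fun x _ => ((EuclideanSpace.proj j : Space n →L[ℝ] ℝ).differentiableAt :))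
    (fun x _ => (contDiff_gaussExp b).differentiable (by norm_num) x)
  simp only [hj, one_mul, fderiv_gaussExp] at key
  have e : ∀ x : Space n, x j * (-(2 * b j * x j) * gaussExp b x)
      = -(2 * b j) * (x j ^ 2 * gaussExp b x) := fun x => by ring
  simp only [e] at key
  rw [integral_const_mul] at key
  have := hb j
  rw [eq_div_iff (by positivity)]
  linarith

/-- The Gaussian as a complex-valued function. -/
def gaussian (b : Fin n → ℝ) (x : Space n) : ℂ := (gaussExp b x : ℂ)

theorem contDiff_gaussian (b : Fin n → ℝ) : ContDiff ℝ ∞ (gaussian b) :=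
  Complex.ofRealCLM.contDiff.comp (contDiff_gaussExp b)

theorem norm_gaussian (b : Fin n → ℝ) (x : Space n) : ‖gaussian b x‖ = gaussExp b x := by
  rw [gaussian, Complex.norm_real, Real.norm_eq_abs, abs_of_pos (gaussExp_pos _ _)]

theorem norm_gaussian_sq (b : Fin n → ℝ) (x : Space n) :
    ‖gaussian b x‖ ^ 2 = gaussExp (b + b) x := by
  rw [norm_gaussian, sq, gaussExp_mul]

theorem partialDeriv_gaussian (b : Fin n → ℝ) (j : Fin n) (x : Space n) :
    partialDeriv j (gaussian b) x = -(2 * b j : ℝ) * (x j : ℂ) * gaussian b x := by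
  have h := ((contDiff_gaussExp b).differentiable (by norm_num) x).hasFDerivAt
  have h2 : HasFDerivAt (gaussian b) _ x := (Complex.ofRealCLM.hasFDerivAt).comp x h
  rw [partialDeriv, h2.fderiv]
  simp only [ContinuousLinearMap.comp_apply, fderiv_gaussExp, Complex.ofRealCLM_apply, gaussian]
  push_cast
  ring

theorem mass_gaussian (b : Fin n → ℝ) :
    mass (gaussian b) = ∏ i, √(Real.pi / (2 * b i)) := by
  unfold mass
  simp only [norm_gaussian_sq]
  rw [integral_gaussExp]
  simp only [Pi.add_apply, two_mul]

theorem mass_coord_mul_gaussian {b : Fin n → ℝ} (hb : ∀ i, 0 < b i) (j : Fin n) :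
    Integrable (fun x : Space n => x j ^ 2 * ‖gaussian b x‖ ^ 2) ∧
      ∫ x : Space n, x j ^ 2 * ‖gaussian b x‖ ^ 2 = mass (gaussian b) / (4 * b j) := by
  have hb' : ∀ i, 0 < (b + b) i := fun i => add_pos (hb i) (hb i)
  unfold mass
  simp only [norm_gaussian_sq]
  refine ⟨integrable_sq_mul_gaussExp hb' j, ?_⟩
  rw [integral_sq_mul_gaussExp hb' j, Pi.add_apply]
  congr 1
  ring

theorem memLp_gaussian {b : Fin n → ℝ} (hb : ∀ i, 0 < b i) : MemLp (gaussian b) 2 volume := by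
  rw [memLp_two_iff_integrable_sq_norm (contDiff_gaussian b).continuous.aestronglyMeasurable]
  simp only [norm_gaussian_sq]
  exact integrable_gaussExp fun i => add_pos (hb i) (hb i)

theorem norm_partialDeriv_gaussian_sq (b : Fin n → ℝ) (j : Fin n) (x : Space n) :
    ‖partialDeriv j (gaussian b) x‖ ^ 2 = (2 * b j) ^ 2 * (x j ^ 2 * ‖gaussian b x‖ ^ 2) := by
  rw [partialDeriv_gaussian, norm_mul, norm_mul, norm_neg, Complex.norm_real, Complex.norm_real,
    mul_pow, mul_pow, Real.norm_eq_abs, Real.norm_eq_abs, sq_abs, sq_abs]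
  ring

theorem memH_gaussian {b : Fin n → ℝ} (hb : ∀ i, 0 < b i) : MemH (gaussian b) := by
  refine ⟨⟨memLp_gaussian hb, fun j => ⟨_, hasWeakPartial_of_contDiff j
    ((contDiff_gaussian b).of_le (by norm_num)), ?_⟩⟩, ?_⟩
  · rw [memLp_two_iff_integrable_sq_norm (contDiff_partialDeriv j
      (contDiff_gaussian b)).continuous.aestronglyMeasurable]
    simp only [norm_partialDeriv_gaussian_sq]
    exact (mass_coord_mul_gaussian hb j).1.const_mul _
  · simp only [potential, Finset.sum_mul]
    exact integrable_finsetSum _ fun i _ => (mass_coord_mul_gaussian hb i).1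

theorem gradNormSq_gaussian {b : Fin n → ℝ} (hb : ∀ i, 0 < b i) :
    gradNormSq (gaussian b) = (∑ i, b i) * mass (gaussian b) := by
  rw [gradNormSq_eq, Finset.sum_mul]
  refine Finset.sum_congr rfl fun j _ => ?_
  rw [mass_congr (hasWeakPartial_of_contDiff j
    ((contDiff_gaussian b).of_le (by norm_num))).weakPartial_ae]
  conv_lhs => unfold mass
  simp only [norm_partialDeriv_gaussian_sq]
  rw [integral_const_mul, (mass_coord_mul_gaussian hb j).2]
  have := hb j
  field_simp
  ring

theorem potentialEnergy_gaussian {b : Fin n → ℝ} (hb : ∀ i, 0 < b i) :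
    potentialEnergy (gaussian b) = (∑ i ∈ Finset.univ.filter (fun i : Fin n => i.val + 1 < n),
      1 / (4 * b i)) * mass (gaussian b) := by
  unfold potentialEnergy
  simp only [potential, Finset.sum_mul]
  rw [integral_finsetSum _ fun i _ => (mass_coord_mul_gaussian hb i).1]
  refine Finset.sum_congr rfl fun j _ => ?_
  rw [(mass_coord_mul_gaussian hb j).2]
  ring

theorem interaction_gaussian (b c : Fin n → ℝ) :
    interaction (gaussian b, gaussian c) = ∏ i, √(Real.pi / (2 * b i + c i)) := by
  unfold interaction
  have : ∀ x, gaussian b x ^ 2 * conj (gaussian c x) = (gaussExp (b + b + c) x : ℂ) := fun x => by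
    rw [gaussian, gaussian, Complex.conj_ofReal, ← gaussExp_mul, ← gaussExp_mul]
    push_cast
    ring
  simp only [this]
  rw [integral_complex_ofReal, Complex.ofReal_re, integral_gaussExp]
  simp only [Pi.add_apply, two_mul]

/-! ### Spread-out ground states of the transversal oscillator -/

/-- The exponents of `groundState`. -/
def groundWeight (κ a : ℝ) (i : Fin n) : ℝ := if i.val + 1 < n then 1 / (2 * √κ) else a / 2

/-- The ground state of `-κ Δ' + |x'|²` in the transversal variables times a Gaussian of width
`a^{-1/2}` in the free variable. -/
def groundState (κ a : ℝ) : Space n → ℂ := gaussian (groundWeight κ a)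

theorem groundWeight_pos {κ a : ℝ} (hκ : 0 < κ) (ha : 0 < a) (i : Fin n) :
    0 < groundWeight κ a i := by
  unfold groundWeight
  have := Real.sqrt_pos.2 hκ
  split_ifs <;> positivity

theorem filter_not_transversal {l : Fin n} (hl : l.val + 1 = n) :
    Finset.univ.filter (fun i : Fin n => ¬ i.val + 1 < n) = {l} := by
  ext i
  simp only [Finset.mem_filter, Finset.mem_univ, true_and, Finset.mem_singleton, Fin.ext_iff]
  have := i.2
  omega

theorem prod_split (hn : 1 ≤ n) (f : Fin n → ℝ) {c d : ℝ}
    (hc : ∀ i : Fin n, i.val + 1 < n → f i = c) (hd : ∀ i : Fin n, ¬ i.val + 1 < n → f i = d) :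
    ∏ i, f i = c ^ (Finset.univ.filter (fun i : Fin n => i.val + 1 < n)).card * d := by
  rw [← Finset.prod_filter_mul_prod_filter_not _ (fun i : Fin n => i.val + 1 < n)]
  have hl : (⟨n - 1, by omega⟩ : Fin n).val + 1 = n := by simp; omega
  rw [filter_not_transversal hl, Finset.prod_singleton, hd _ (by omega),
    Finset.prod_congr rfl fun i hi => hc i (Finset.mem_filter.1 hi).2, Finset.prod_const]

theorem exists_mass_groundState (hn : 1 ≤ n) {κ : ℝ} (hκ : 0 < κ) :
    ∃ M : ℝ, 0 < M ∧ ∀ a, 0 < a → mass (groundState (n := n) κ a) = M / √a := by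
  refine ⟨√(Real.pi * √κ) ^ (Finset.univ.filter (fun i : Fin n => i.val + 1 < n)).card
    * √Real.pi, ?_, fun a ha => ?_⟩
  · have := Real.sqrt_pos.2 hκ
    have := Real.pi_pos
    positivity
  · rw [groundState, mass_gaussian, prod_split hn _ (c := √(Real.pi * √κ)) (d := √(Real.pi / a)),
      Real.sqrt_div Real.pi_pos.le, mul_div_assoc]
    · intro i hi
      have := Real.sqrt_pos.2 hκ
      simp only [groundWeight, hi, if_true]
      congr 1
      field_simp
    · intro i hi
      simp only [groundWeight, hi, if_false]
      congr 1
      field_simp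

theorem exists_interaction_groundState (hn : 1 ≤ n) {κ : ℝ} (hκ : 0 < κ) :
    ∃ J : ℝ, 0 < J ∧ ∀ a, 0 < a →
      interaction (groundState (n := n) 1 a, groundState (n := n) κ a) = J / √a := by
  refine ⟨√(Real.pi / (1 + 1 / (2 * √κ)))
    ^ (Finset.univ.filter (fun i : Fin n => i.val + 1 < n)).card * √(Real.pi * (2 / 3)), ?_,
    fun a ha => ?_⟩
  · have := Real.sqrt_pos.2 hκ
    have := Real.pi_pos
    positivity
  · rw [groundState, groundState, interaction_gaussian,
      prod_split hn _ (c := √(Real.pi / (1 + 1 / (2 * √κ)))) (d := √(Real.pi * (2 / 3) / a)),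
      Real.sqrt_div (x := Real.pi * (2 / 3)) (by positivity), mul_div_assoc]
    · intro i hi
      have h := Real.sqrt_pos.2 hκ
      simp only [groundWeight, if_pos hi, Real.sqrt_one]
      norm_num
    · intro i hi
      simp only [groundWeight, if_neg hi]
      congr 1
      field_simp
      ring

theorem gradNormSq_groundState (hn : 1 ≤ n) {κ a : ℝ} (hκ : 0 < κ) (ha : 0 < a) :
    gradNormSq (groundState (n := n) κ a)
      = ((n - 1) / (2 * √κ) + a / 2) * mass (groundState (n := n) κ a) := by
  rw [groundState, gradNormSq_gaussian (groundWeight_pos hκ ha)]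
  congr 1
  rw [← Finset.sum_filter_add_sum_filter_not _ (fun i : Fin n => i.val + 1 < n)]
  have hl : (⟨n - 1, by omega⟩ : Fin n).val + 1 = n := by simp; omega
  rw [filter_not_transversal hl, Finset.sum_singleton, Finset.sum_congr rfl
    (g := fun _ => 1 / (2 * √κ)) fun i hi => by
      simp [groundWeight, (Finset.mem_filter.1 hi).2],
    Finset.sum_const, nsmul_eq_mul, card_transversal hn]
  rw [groundWeight, if_neg (by omega)]
  ring

theorem potentialEnergy_groundState (hn : 1 ≤ n) {κ a : ℝ} (hκ : 0 < κ) (ha : 0 < a) :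
    potentialEnergy (groundState (n := n) κ a)
      = (n - 1) * √κ / 2 * mass (groundState (n := n) κ a) := by
  rw [groundState, potentialEnergy_gaussian (groundWeight_pos hκ ha)]
  congr 1
  rw [Finset.sum_congr rfl (g := fun _ => √κ / 2) fun i hi => by
      have := Real.sqrt_pos.2 hκ
      rw [groundWeight, if_pos (Finset.mem_filter.1 hi).2]
      field_simp
      norm_num,
    Finset.sum_const, nsmul_eq_mul, card_transversal hn]
  ring

theorem memH_groundState {κ a : ℝ} (hκ : 0 < κ) (ha : 0 < a) :
    MemH (groundState (n := n) κ a) := memH_gaussian (groundWeight_pos hκ ha)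

theorem groundState_mono (κ : ℝ) {a a' : ℝ} (h : a ≤ a') (x : Space n) :
    ‖groundState κ a' x‖ ≤ ‖groundState κ a x‖ := by
  rw [groundState, groundState, norm_gaussian, norm_gaussian]
  refine Real.exp_le_exp.2 (neg_le_neg (Finset.sum_le_sum fun i _ => ?_))
  unfold groundWeight
  split_ifs
  · exact le_rfl
  · gcongr

theorem smul_groundState_data (hn : 1 ≤ n) {κ a c μ : ℝ} (hκ : 0 < κ) (ha : 0 < a)
    (hc : c ^ 2 * mass (groundState (n := n) κ a) = μ) :
    MemH ((c : ℂ) • groundState (n := n) κ a) ∧ mass ((c : ℂ) • groundState (n := n) κ a) = μ ∧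
      gradNormSq ((c : ℂ) • groundState (n := n) κ a) = ((n - 1) / (2 * √κ) + a / 2) * μ ∧
      potentialEnergy ((c : ℂ) • groundState (n := n) κ a) = (n - 1) * √κ / 2 * μ := by
  have hnc : ‖(c : ℂ)‖ ^ 2 = c ^ 2 := by rw [Complex.norm_real, Real.norm_eq_abs, sq_abs]
  refine ⟨(memH_groundState hκ ha).smul _, by rw [mass_smul, hnc, hc], ?_, ?_⟩
  · rw [gradNormSq_smul _ (memH_groundState hκ ha).1, hnc, gradNormSq_groundState hn hκ ha, ← hc]
    ring
  · rw [potentialEnergy_smul, hnc, potentialEnergy_groundState hn hκ ha, ← hc]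
    ring

theorem exists_trial_data (hn : 1 ≤ n) {κ μ₁ μ₂ : ℝ} (hκ : 0 < κ) (hμ₁ : 0 < μ₁) (hμ₂ : 0 < μ₂) :
    ∃ J : ℝ, 0 < J ∧ ∀ t : ℝ, 0 < t → ∃ φ ψ : Space n → ℂ,
      (MemH φ ∧ mass φ = μ₁ ∧ gradNormSq φ = ((n - 1) / 2 + t ^ 4 / 2) * μ₁ ∧
        potentialEnergy φ = (n - 1) / 2 * μ₁) ∧
      (MemH ψ ∧ mass ψ = μ₂ ∧ gradNormSq ψ = ((n - 1) / (2 * √κ) + t ^ 4 / 2) * μ₂ ∧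
        potentialEnergy ψ = (n - 1) * √κ / 2 * μ₂) ∧ interaction (φ, ψ) = J * t := by
  obtain ⟨M₁, hM₁, h1⟩ := exists_mass_groundState (n := n) hn one_pos
  obtain ⟨M₂, hM₂, h2⟩ := exists_mass_groundState (n := n) hn hκ
  obtain ⟨J, hJ, hJa⟩ := exists_interaction_groundState (n := n) hn hκ
  refine ⟨μ₁ / M₁ * √(μ₂ / M₂) * J, by positivity, fun t ht => ?_⟩
  have ha : 0 < t ^ 4 := by positivity
  have hsa : √(t ^ 4) = t ^ 2 := by
    rw [show t ^ 4 = (t ^ 2) ^ 2 by ring, Real.sqrt_sq (by positivity)]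
  have e1 : (√(μ₁ / M₁) * t) ^ 2 * mass (groundState (n := n) 1 (t ^ 4)) = μ₁ := by
    rw [h1 _ ha, hsa, mul_pow, Real.sq_sqrt (div_pos hμ₁ hM₁).le]
    field_simp
  have e2 : (√(μ₂ / M₂) * t) ^ 2 * mass (groundState (n := n) κ (t ^ 4)) = μ₂ := by
    rw [h2 _ ha, hsa, mul_pow, Real.sq_sqrt (div_pos hμ₂ hM₂).le]
    field_simp
  have d1 := smul_groundState_data hn one_pos ha e1
  simp only [Real.sqrt_one, mul_one] at d1
  refine ⟨_, _, d1, smul_groundState_data hn hκ ha e2, ?_⟩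
  rw [interaction_smul, hJa _ ha, hsa, mul_pow, Real.sq_sqrt (div_pos hμ₁ hM₁).le]
  field_simp

/-- Wide Gaussian profiles show that the infimum lies strictly below the bottom of the spectrum
of the linear problem: the overhead is of order `a`, the interaction of order `a^{1/4}`. -/
theorem exists_trial (hn : 1 ≤ n) {κ : ℝ} (hκ : 0 < κ) : ∃ C : ℝ, 0 < C ∧ ∀ μ₁ μ₂ : ℝ,
    0 < μ₁ → 0 < μ₂ → ∃ p ∈ massConstraint n μ₁ μ₂, homNormSq p ≤ C * (μ₁ + μ₂) ∧
      energy κ p < 1 / 2 * (n - 1) * (μ₁ + √κ * μ₂) := by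
  have hsκ := Real.sqrt_pos.2 hκ
  have hn' : (1 : ℝ) ≤ n := by exact_mod_cast hn
  refine ⟨n * (1 + 1 / √κ + √κ), by positivity, fun μ₁ μ₂ hμ₁ hμ₂ => ?_⟩
  obtain ⟨J, hJ, hJt⟩ := exists_trial_data hn hκ hμ₁ hμ₂
  -- the width parameter is `a = t⁴`
  obtain ⟨t, ht0, ht1, htc⟩ : ∃ t : ℝ, 0 < t ∧ t ≤ 1 ∧ (μ₁ + κ * μ₂) * t < 2 * J :=
    ⟨min 1 (J / (μ₁ + κ * μ₂)), by positivity, min_le_left _ _, by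
      calc (μ₁ + κ * μ₂) * min 1 (J / (μ₁ + κ * μ₂))
          ≤ (μ₁ + κ * μ₂) * (J / (μ₁ + κ * μ₂)) := by gcongr; exact min_le_right _ _
        _ = J := by field_simp
        _ < 2 * J := by linarith⟩
  obtain ⟨φ, ψ, ⟨hφ, m1, G1, P1⟩, ⟨hψ, m2, G2, P2⟩, K⟩ := hJt t ht0
  have ht4 : t ^ 4 ≤ 1 := pow_le_one₀ ht0.le ht1
  refine ⟨(φ, ψ), ⟨⟨hφ, hψ⟩, m1, m2⟩, ?_, ?_⟩
  · have hr : 0 < 1 / √κ := by positivity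
    have hd : ((n : ℝ) - 1) / (2 * √κ) = (n - 1) / 2 * (1 / √κ) := by field_simp
    have h1 : 0 < n * (1 / √κ) := by positivity
    have h2 : 0 < n * √κ := by positivity
    simp only [homNormSq, G1, G2, P1, P2, hd]
    have hb1 : ((n : ℝ) - 1) / 2 + t ^ 4 / 2 + (n - 1) / 2 ≤ n * (1 + 1 / √κ + √κ) := by
      linarith
    have hb2 : ((n : ℝ) - 1) / 2 * (1 / √κ) + t ^ 4 / 2 + (n - 1) * √κ / 2
        ≤ n * (1 + 1 / √κ + √κ) := by
      linarith
    have := mul_le_mul_of_nonneg_right hb1 hμ₁.le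
    have := mul_le_mul_of_nonneg_right hb2 hμ₂.le
    linarith
  · have h3 : κ * (((n - 1) / (2 * √κ) + t ^ 4 / 2) * μ₂)
        = ((n - 1) / 2 * √κ + κ * t ^ 4 / 2) * μ₂ := by
      have h : ∀ s : ℝ, 0 < s → s * s * (((n - 1) / (2 * s) + t ^ 4 / 2) * μ₂)
          = ((n - 1) / 2 * s + s * s * t ^ 4 / 2) * μ₂ := fun s hs => by field_simp
      simpa only [Real.mul_self_sqrt hκ.le] using h _ hsκ
    have h4 : (μ₁ + κ * μ₂) * t ^ 4 < 2 * J * t := by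
      have h5 : t ^ 4 ≤ t ^ 2 := pow_le_pow_of_le_one ht0.le ht1 (by norm_num)
      calc (μ₁ + κ * μ₂) * t ^ 4 ≤ (μ₁ + κ * μ₂) * t ^ 2 := by gcongr
        _ = (μ₁ + κ * μ₂) * t * t := by ring
        _ < 2 * J * t := by gcongr
    simp only [energy, G1, G2, P1, P2, K, mul_add, h3]
    linarith

/-! ### Localization to slabs -/

/-- A smooth function of one variable, equal to `1` on `[0, 1]` and vanishing off `(-1, 2)`. -/
def slabBump (s : ℝ) : ℝ := Real.smoothTransition (s + 1) * Real.smoothTransition (2 - s)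

theorem contDiff_slabBump : ContDiff ℝ ∞ slabBump :=
  (Real.smoothTransition.contDiff.comp (contDiff_id.add contDiff_const)).mul
    (Real.smoothTransition.contDiff.comp (contDiff_const.sub contDiff_id))

theorem slabBump_nonneg (s : ℝ) : 0 ≤ slabBump s :=
  mul_nonneg (Real.smoothTransition.nonneg _) (Real.smoothTransition.nonneg _)

theorem slabBump_le_one (s : ℝ) : slabBump s ≤ 1 :=
  mul_le_one₀ (Real.smoothTransition.le_one _) (Real.smoothTransition.nonneg _)
    (Real.smoothTransition.le_one _)

theorem slabBump_eq_one {s : ℝ} (h0 : 0 ≤ s) (h1 : s ≤ 1) : slabBump s = 1 := by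
  rw [slabBump, Real.smoothTransition.one_of_one_le (by linarith),
    Real.smoothTransition.one_of_one_le (by linarith), one_mul]

theorem slabBump_eq_zero {s : ℝ} (h : s ≤ -1 ∨ 2 ≤ s) : slabBump s = 0 := by
  rcases h with h | h
  · rw [slabBump, Real.smoothTransition.zero_of_nonpos (by linarith), zero_mul]
  · rw [slabBump, Real.smoothTransition.zero_of_nonpos (x := 2 - s) (by linarith), mul_zero]

/-- A zero of the nonnegative function `slabBump` is a minimum. -/
theorem deriv_slabBump_eq_zero {s : ℝ} (h : slabBump s = 0) : deriv slabBump s = 0 :=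
  IsLocalMin.deriv_eq_zero (Eventually.of_forall fun t => by
    rw [h]; exact slabBump_nonneg t)

theorem exists_deriv_slabBump_le : ∃ D : ℝ, ∀ s, |deriv slabBump s| ≤ D := by
  have hc : HasCompactSupport slabBump := HasCompactSupport.intro (K := Set.Icc (-1) 2)
    isCompact_Icc fun s hs => slabBump_eq_zero (by
      by_contra h
      push Not at h
      exact hs ⟨h.1.le, h.2.le⟩)
  have hd : Continuous (deriv slabBump) := contDiff_slabBump.continuous_deriv (by norm_num)
  obtain ⟨D, hD⟩ := hd.bounded_above_of_compact_support hc.deriv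
  exact ⟨D, hD⟩

/-- The slab `{⌊xₗ⌋ = z}`. -/
def slab (l : Fin n) (z : ℤ) : Set (Space n) := {x | ⌊x l⌋ = z}

theorem measurableSet_slab (l : Fin n) (z : ℤ) : MeasurableSet (slab l z) := by
  have h : Measurable fun x : Space n => ⌊x l⌋ := by
    have : Continuous fun x : Space n => x l := by fun_prop
    exact Int.measurable_floor.comp this.measurable
  exact h (measurableSet_singleton z)

theorem pairwise_disjoint_slab (l : Fin n) : Pairwise (Function.onFun Disjoint (slab l)) := by
  intro a b hab
  rw [Function.onFun, Set.disjoint_left]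
  intro x hx hx'
  exact hab (hx.symm.trans hx')

theorem iUnion_slab (l : Fin n) : ⋃ z, slab l z = Set.univ :=
  Set.eq_univ_of_forall fun x => Set.mem_iUnion.2 ⟨⌊x l⌋, rfl⟩

theorem hasSum_integral_slab (l : Fin n) {f : Space n → ℝ} (hf : Integrable f) :
    HasSum (fun z => ∫ x in slab l z, f x) (∫ x, f x) := by
  have := hasSum_integral_iUnion (measurableSet_slab l) (pairwise_disjoint_slab l)
    hf.integrableOn (μ := volume) (f := f)
  rwa [iUnion_slab, Measure.restrict_univ] at this

/-- The density of the squared `H¹` norm. -/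
def sobolevDensity (u : Space n → ℂ) (x : Space n) : ℝ :=
  ∑ i, ‖weakPartial i u x‖ ^ 2 + ‖u x‖ ^ 2

theorem sobolevDensity_nonneg (u : Space n → ℂ) (x : Space n) : 0 ≤ sobolevDensity u x :=
  add_nonneg (Finset.sum_nonneg fun _ _ => by positivity) (by positivity)

theorem integrable_sobolevDensity {u : Space n → ℂ} (hu : MemH1 u) :
    Integrable (sobolevDensity u) :=
  (integrable_finsetSum _ fun i _ => integrable_normSq (hu.memLp_weakPartial i)).add
    (integrable_normSq hu.1)

theorem integral_sobolevDensity {u : Space n → ℂ} (hu : MemH1 u) :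
    ∫ x, sobolevDensity u x = gradNormSq u + mass u := by
  unfold sobolevDensity
  rw [integral_add (integrable_finsetSum _ fun i _ => integrable_normSq (hu.memLp_weakPartial i))
    (integrable_normSq hu.1), integral_finsetSum _ fun i _ =>
    integrable_normSq (hu.memLp_weakPartial i)]
  rfl

/-- The union of a slab and its two neighbours. -/
def wideSlab (l : Fin n) (z : ℤ) : Set (Space n) := slab l (z - 1) ∪ slab l z ∪ slab l (z + 1)

theorem measurableSet_wideSlab (l : Fin n) (z : ℤ) : MeasurableSet (wideSlab l z) :=
  ((measurableSet_slab l _).union (measurableSet_slab l _)).union (measurableSet_slab l _)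

theorem slabBump_eq_zero_of_notMem {l : Fin n} {z : ℤ} {x : Space n} (hx : x ∉ wideSlab l z) :
    slabBump (x l - z) = 0 := by
  refine slabBump_eq_zero ?_
  simp only [wideSlab, slab, Set.mem_union, Set.mem_ofPred_eq, not_or] at hx
  have h : ⌊x l⌋ < z - 1 ∨ z + 2 ≤ ⌊x l⌋ := by omega
  rcases h with h | h
  · left
    have := Int.lt_floor_add_one (x l)
    have h' : ((⌊x l⌋ + 1 : ℤ) : ℝ) ≤ ((z - 1 : ℤ) : ℝ) := by exact_mod_cast h
    push_cast at h'
    linarith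
  · right
    have := Int.floor_le (x l)
    have h' : ((z + 2 : ℤ) : ℝ) ≤ ⌊x l⌋ := by exact_mod_cast h
    push_cast at h'
    linarith

theorem hasSum_integral_wideSlab (l : Fin n) {f : Space n → ℝ} (hf : Integrable f) :
    HasSum (fun z => ∫ x in wideSlab l z, f x) (3 * ∫ x, f x) := by
  have h := hasSum_integral_slab l hf
  have h1 := (Equiv.hasSum_iff (Equiv.subRight (1 : ℤ))).2 h
  have h2 := (Equiv.hasSum_iff (Equiv.addRight (1 : ℤ))).2 h
  have h3 := (h1.add h).add h2
  have e : (∫ x, f x) + (∫ x, f x) + ∫ x, f x = 3 * ∫ x, f x := by ring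
  rw [e] at h3
  convert! h3 using 2 with z
  have d : ∀ {a b : ℤ}, a ≠ b → Disjoint (slab l a) (slab l b) := fun h =>
    pairwise_disjoint_slab l h
  rw [wideSlab, setIntegral_union (Set.disjoint_union_left.2 ⟨d (by omega), d (by omega)⟩)
    (measurableSet_slab l _) hf.integrableOn hf.integrableOn,
    setIntegral_union (d (by omega)) (measurableSet_slab l _) hf.integrableOn hf.integrableOn]
  rfl

theorem exists_weakPartial_slabBump_le : ∃ D : ℝ, 0 ≤ D ∧ ∀ (l : Fin n) (z : ℤ)
    (u : Space n → ℂ), MemH1 u → MemH1 (fun x => slabBump (x l - z) • u x) ∧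
      mass (fun x => slabBump (x l - z) • u x) ≤ ∫ x in wideSlab l z, sobolevDensity u x ∧
      gradNormSq (fun x => slabBump (x l - z) • u x)
        ≤ D * ∫ x in wideSlab l z, sobolevDensity u x := by
  obtain ⟨D, hD⟩ := exists_deriv_slabBump_le
  have hD0 : 0 ≤ D := (abs_nonneg _).trans (hD 0)
  refine ⟨n * (2 + 2 * D ^ 2), by positivity, fun l z u hu => ?_⟩
  let η : Space n → ℝ := fun x => slabBump (x l - z)
  have hp : ContDiff ℝ ∞ fun x : Space n => x l :=
    (EuclideanSpace.proj l : Space n →L[ℝ] ℝ).contDiff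
  have hη : ContDiff ℝ ∞ η := contDiff_slabBump.comp (hp.sub contDiff_const)
  have hpd : ∀ i x, partialDeriv i η x = deriv slabBump (x l - z) * if l = i then 1 else 0 := by
    intro i x
    have h1 : HasFDerivAt (fun x : Space n => x l - (z : ℝ))
        (EuclideanSpace.proj l : Space n →L[ℝ] ℝ) x :=
      ((EuclideanSpace.proj l : Space n →L[ℝ] ℝ).hasFDerivAt (x := x)).sub_const _
    have h2 := ((contDiff_slabBump.differentiable (by norm_num) (x l - z)).hasDerivAt
      ).comp_hasFDerivAt x h1
    have h3 : HasFDerivAt η _ x := h2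
    rw [partialDeriv, h3.fderiv]
    simp
  have hle : ∀ i x, |partialDeriv i η x| ≤ D := fun i x => by
    rw [hpd, abs_mul]
    have := hD (x l - z)
    split_ifs
    · simpa using this
    · simpa using hD0
  have hind : ∀ {f : Space n → ℂ} {c : ℝ}, MemLp f 2 volume →
      (∀ x, x ∉ wideSlab l z → f x = 0) → (∀ x, ‖f x‖ ^ 2 ≤ c * sobolevDensity u x) →
      mass f ≤ c * ∫ x in wideSlab l z, sobolevDensity u x := by
    intro f c hf h0 hc
    have e : mass f = ∫ x in wideSlab l z, ‖f x‖ ^ 2 := by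
      refine (setIntegral_eq_integral_of_forall_compl_eq_zero fun x hx => ?_).symm
      change ‖f x‖ ^ 2 = 0
      rw [h0 x hx]
      simp
    rw [e, ← integral_const_mul]
    exact integral_mono (integrable_normSq hf).integrableOn
      ((integrable_sobolevDensity hu).const_mul c).integrableOn hc
  have hnη : ∀ x, ‖η x‖ ≤ 1 := fun x => by
    rw [Real.norm_eq_abs, abs_of_nonneg (slabBump_nonneg _)]; exact slabBump_le_one _
  have hηsm : ∀ x, x ∉ wideSlab l z → η x = 0 := fun x hx => slabBump_eq_zero_of_notMem hx
  have hmul : ∀ {ζ : Space n → ℝ} {c : ℝ} {v : Space n → ℂ}, Continuous ζ → (∀ x, |ζ x| ≤ c) →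
      MemLp v 2 volume → MemLp (fun x => ζ x • v x) 2 volume := by
    intro ζ c v hζ hb hv
    refine MemLp.of_le_mul (c := c) hv (hζ.aestronglyMeasurable.smul hv.1)
      (ae_of_all _ fun x => ?_)
    rw [norm_smul, Real.norm_eq_abs]
    gcongr
    exact hb x
  have hL : ∀ i, MemLp (fun x => η x • weakPartial i u x + partialDeriv i η x • u x) 2 volume :=
    fun i => (hmul hη.continuous hnη (hu.memLp_weakPartial i)).add
      (hmul (contDiff_partialDeriv i hη).continuous (hle i) hu.1)
  have hM : MemLp (fun x => η x • u x) 2 volume := hmul hη.continuous hnη hu.1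
  have hw := fun i => (hu.hasWeakPartial i).smooth_smul hη
  have hsd : ∀ x i, ‖weakPartial i u x‖ ^ 2 ≤ sobolevDensity u x := fun x i => by
    have := Finset.single_le_sum (f := fun i => ‖weakPartial i u x‖ ^ 2)
      (fun _ _ => by positivity) (Finset.mem_univ i)
    unfold sobolevDensity
    have h2 : 0 ≤ ‖u x‖ ^ 2 := by positivity
    linarith
  have hsu : ∀ x, ‖u x‖ ^ 2 ≤ sobolevDensity u x := fun x =>
    le_add_of_nonneg_left (Finset.sum_nonneg fun _ _ => by positivity)
  refine ⟨⟨hM, fun i => ⟨_, hw i, hL i⟩⟩, ?_, ?_⟩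
  · rw [← one_mul (∫ x in wideSlab l z, sobolevDensity u x)]
    refine hind hM (fun x hx => by
      change η x • u x = 0
      rw [hηsm x hx, zero_smul]) fun x => ?_
    change ‖η x • u x‖ ^ 2 ≤ _
    rw [norm_smul, mul_pow, one_mul]
    have h1 : ‖η x‖ ^ 2 ≤ 1 := pow_le_one₀ (norm_nonneg _) (hnη x)
    nlinarith [hsu x, sq_nonneg ‖u x‖]
  · rw [gradNormSq_eq, mul_assoc]
    refine (Finset.sum_le_card_nsmul _ _ ((2 + 2 * D ^ 2)
      * ∫ x in wideSlab l z, sobolevDensity u x) fun i _ => ?_).trans (le_of_eq (by simp))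
    rw [mass_congr (hw i).weakPartial_ae]
    refine hind (hL i) (fun x hx => ?_) fun x => ?_
    · have h0 := hηsm x hx
      rw [hpd, h0, deriv_slabBump_eq_zero h0]
      simp
    · have h1 : ‖η x • weakPartial i u x‖ ≤ ‖weakPartial i u x‖ := by
        rw [norm_smul]
        exact mul_le_of_le_one_left (norm_nonneg _) (hnη x)
      have h2 : ‖partialDeriv i η x • u x‖ ≤ D * ‖u x‖ := by
        rw [norm_smul]
        gcongr
        exact hle i x
      have h3 : ‖η x • weakPartial i u x + partialDeriv i η x • u x‖
          ≤ ‖weakPartial i u x‖ + D * ‖u x‖ := (norm_add_le _ _).trans (add_le_add h1 h2)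
      calc _ ≤ (‖weakPartial i u x‖ + D * ‖u x‖) ^ 2 := by gcongr
        _ ≤ 2 * ‖weakPartial i u x‖ ^ 2 + 2 * D ^ 2 * ‖u x‖ ^ 2 := by
          nlinarith [sq_nonneg (‖weakPartial i u x‖ - D * ‖u x‖)]
        _ ≤ 2 * sobolevDensity u x + 2 * D ^ 2 * sobolevDensity u x := by
          gcongr
          · exact hsd x i
          · exact hsu x
        _ = _ := by ring

theorem setIntegral_cube_le_integral {u : Space n → ℂ} (hu : MemLp u 3 volume)
    (T : Set (Space n)) : ∫ x in T, ‖u x‖ ^ 3 ≤ ∫ x, ‖u x‖ ^ 3 :=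
  setIntegral_le_integral (integrable_cube hu) (ae_of_all _ fun _ => by positivity)

/-- The cubic Gagliardo--Nirenberg inequality on slabs, with a constant independent of the slab. -/
theorem exists_slab_cube_le (hn3 : 3 ≤ n) (hn5 : n ≤ 5) : ∃ C : ℝ, 0 < C ∧
    ∀ (l : Fin n) (z : ℤ) (u : Space n → ℂ), MemH1 u → ∫ x in slab l z, ‖u x‖ ^ 3 ≤
      C * ((∫ x in wideSlab l z, sobolevDensity u x)
        * √(∫ x in wideSlab l z, sobolevDensity u x)) := by
  obtain ⟨C, hC0, hC⟩ := exists_cube_le hn3 hn5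
  obtain ⟨D, hD0, hD⟩ := exists_weakPartial_slabBump_le (n := n)
  have hnR5 : (n : ℝ) ≤ 5 := by exact_mod_cast hn5
  refine ⟨C * (D + 1) ^ ((n : ℝ) / 4), by positivity, fun l z u hu => ?_⟩
  obtain ⟨h1, h2, h3⟩ := hD l z u hu
  set h := ∫ x in wideSlab l z, sobolevDensity u x
  have hh : 0 ≤ h := setIntegral_nonneg (measurableSet_wideSlab l z)
    fun x _ => sobolevDensity_nonneg u x
  obtain ⟨h4, h5⟩ := hC _ h1
  have h6 := h5 Set.univ MeasurableSet.univ
  simp only [Measure.restrict_univ] at h6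
  have h7 : ∫ x in slab l z, ‖u x‖ ^ 3 = ∫ x in slab l z, ‖slabBump (x l - z) • u x‖ ^ 3 := by
    refine setIntegral_congr_fun (measurableSet_slab l z) fun x hx => ?_
    have e : ⌊x l⌋ = z := hx
    have f1 := Int.floor_le (x l)
    have f2 := Int.lt_floor_add_one (x l)
    rw [e] at f1 f2
    simp only [slabBump_eq_one (sub_nonneg.2 f1) (by linarith : x l - z ≤ 1), one_smul]
  have hg := gradNormSq_nonneg fun x => slabBump (x l - z) • u x
  have hm := mass_nonneg fun x => slabBump (x l - z) • u x
  rw [h7]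
  refine (setIntegral_cube_le_integral h4 _).trans (h6.trans ?_)
  have e1 : h * √h = h ^ ((6 - n : ℝ) / 4) * h ^ ((n : ℝ) / 4) := by
    rw [← Real.rpow_add_of_nonneg hh (by linarith) (by positivity), Real.sqrt_eq_rpow,
      ← Real.rpow_one_add' hh (by norm_num)]
    congr 1
    ring
  calc _ ≤ C * h ^ ((6 - n : ℝ) / 4) * ((D + 1) * h) ^ ((n : ℝ) / 4) := by
        have h8 : gradNormSq (fun x => slabBump (x l - z) • u x) ≤ (D + 1) * h := by linarith
        have h9 : (∫ x, ‖slabBump (x l - z) • u x‖ ^ 2) ^ ((6 - n : ℝ) / 4)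
            ≤ h ^ ((6 - n : ℝ) / 4) := Real.rpow_le_rpow hm h2 (by linarith)
        gcongr
    _ = _ := by
        rw [Real.mul_rpow (by positivity) hh, e1]
        ring

/-- If `∫ |φ|² |ψ|` is bounded below and the `H¹` norms are bounded, some slab carries a fixed
amount of this integral. -/
theorem exists_slab_ge (hn3 : 3 ≤ n) (hn5 : n ≤ 5) (l : Fin n) {N δ : ℝ} (hδ : 0 < δ) :
    ∃ δ' : ℝ, 0 < δ' ∧ ∀ φ ψ : Space n → ℂ, MemH1 φ → MemH1 ψ → mass φ ≤ N → mass ψ ≤ N →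
      gradNormSq φ ≤ N → gradNormSq ψ ≤ N → δ ≤ ∫ x, ‖φ x‖ * ‖φ x‖ * ‖ψ x‖ →
      ∃ z : ℤ, δ' ≤ ∫ x in slab l z, ‖φ x‖ * ‖φ x‖ * ‖ψ x‖ := by
  obtain ⟨C, hC0, hC⟩ := exists_slab_cube_le hn3 hn5
  by_cases hN : 0 < N
  swap
  · refine ⟨1, one_pos, fun φ ψ hφ hψ m1 _ g1 _ hint => ?_⟩
    -- the hypotheses force `φ = 0`
    exfalso
    have m0 : mass φ = 0 := le_antisymm (m1.trans (not_lt.1 hN)) (mass_nonneg _)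
    have hz : φ =ᵐ[volume] 0 := by
      have := (integral_eq_zero_iff_of_nonneg (fun x => by positivity)
        (integrable_normSq hφ.1)).1 m0
      filter_upwards [this] with x hx
      simpa using hx
    have : ∫ x, ‖φ x‖ * ‖φ x‖ * ‖ψ x‖ = 0 := by
      rw [integral_congr_ae (g := fun _ => (0 : ℝ)) (hz.mono fun x hx => by simp [hx])]
      simp
    linarith
  let c := δ / (24 * N)
  have hc : 0 < c := by positivity
  refine ⟨c * (c / (2 * C)) ^ 2, by positivity, fun φ ψ hφ hψ m1 m2 g1 g2 hint => ?_⟩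
  have i1 := hφ.memLp_three hn3 hn5
  have i2 := hψ.memLp_three hn3 hn5
  let h : ℤ → ℝ := fun z => (∫ x in wideSlab l z, sobolevDensity φ x)
    + ∫ x in wideSlab l z, sobolevDensity ψ x
  have hs1 : HasSum h (3 * (gradNormSq φ + mass φ) + 3 * (gradNormSq ψ + mass ψ)) := by
    rw [← integral_sobolevDensity hφ, ← integral_sobolevDensity hψ]
    exact (hasSum_integral_wideSlab l (integrable_sobolevDensity hφ)).add
      (hasSum_integral_wideSlab l (integrable_sobolevDensity hψ))
  have hs2 := hasSum_integral_slab l (integrable_triple i1 i1 i2)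
  have hp1 : ∀ z, 0 ≤ ∫ x in wideSlab l z, sobolevDensity φ x := fun z =>
    setIntegral_nonneg (measurableSet_wideSlab l z) fun x _ => sobolevDensity_nonneg φ x
  have hp2 : ∀ z, 0 ≤ ∫ x in wideSlab l z, sobolevDensity ψ x := fun z =>
    setIntegral_nonneg (measurableSet_wideSlab l z) fun x _ => sobolevDensity_nonneg ψ x
  -- pigeonhole: the slabs share `δ`, while the densities `h z` sum to at most `12 N`, each point
  -- lying in three wide slabs; the constant `24 N` of `c` leaves a factor of two
  obtain ⟨z, hz0, hz⟩ : ∃ z, 0 < ∫ x in slab l z, ‖φ x‖ * ‖φ x‖ * ‖ψ x‖ ∧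
      c * h z ≤ ∫ x in slab l z, ‖φ x‖ * ‖φ x‖ * ‖ψ x‖ := by
    by_contra! hcon
    have hle : ∀ z, ∫ x in slab l z, ‖φ x‖ * ‖φ x‖ * ‖ψ x‖ ≤ c * h z := fun z => by
      by_cases h0 : 0 < ∫ x in slab l z, ‖φ x‖ * ‖φ x‖ * ‖ψ x‖
      · exact (hcon z h0).le
      · exact (not_lt.1 h0).trans (mul_nonneg hc.le (add_nonneg (hp1 z) (hp2 z)))
    have h3 := hasSum_le hle hs2 (hs1.mul_left c)
    have h4 : c * (3 * (gradNormSq φ + mass φ) + 3 * (gradNormSq ψ + mass ψ)) ≤ c * (12 * N) := by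
      gcongr
      linarith
    have h5 : c * (12 * N) = δ / 2 := by simp only [c]; field_simp; norm_num
    linarith
  refine ⟨z, le_trans ?_ hz⟩
  -- the interaction is superlinear in `h z`, so the linear lower bound keeps `h z` away from zero
  have hup : ∫ x in slab l z, ‖φ x‖ * ‖φ x‖ * ‖ψ x‖ ≤ 2 * C * (h z * √(h z)) := by
    have j1 := integrable_cube i1
    have j2 := integrable_cube i2
    have k1 := hC l z φ hφ
    have k2 := hC l z ψ hψ
    have hq : ∀ {a : ℝ}, 0 ≤ a → a ≤ h z → a * √a ≤ h z * √(h z) := fun ha hah =>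
      mul_le_mul hah (Real.sqrt_le_sqrt hah) (Real.sqrt_nonneg _) (ha.trans hah)
    have q1 := hq (hp1 z) (le_add_of_nonneg_right (hp2 z))
    have q2 := hq (hp2 z) (le_add_of_nonneg_left (hp1 z))
    calc _ ≤ ∫ x in slab l z, (‖φ x‖ ^ 3 + ‖ψ x‖ ^ 3) := by
          refine integral_mono (integrable_triple i1 i1 i2).integrableOn
            (j1.add j2).integrableOn fun x => ?_
          have ha := norm_nonneg (φ x)
          have hb := norm_nonneg (ψ x)
          simp only
          nlinarith [mul_nonneg (add_nonneg ha hb) (sq_nonneg (‖φ x‖ - ‖ψ x‖)), pow_nonneg ha 3,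
            pow_nonneg hb 3]
      _ = (∫ x in slab l z, ‖φ x‖ ^ 3) + ∫ x in slab l z, ‖ψ x‖ ^ 3 :=
          integral_add j1.integrableOn j2.integrableOn
      _ ≤ C * (h z * √(h z)) + C * (h z * √(h z)) :=
          add_le_add (k1.trans (by gcongr)) (k2.trans (by gcongr))
      _ = _ := by ring
  have hh0 : 0 ≤ h z := add_nonneg (hp1 z) (hp2 z)
  have hhp : 0 < h z := by
    rcases hh0.lt_or_eq with h | h
    · exact h
    · rw [← h] at hup
      simp at hup
      linarith
  have hsq : c ≤ 2 * C * √(h z) := by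
    have h6 : c * h z ≤ 2 * C * √(h z) * h z := by linarith
    exact le_of_mul_le_mul_right h6 hhp
  gcongr
  have h7 : c / (2 * C) ≤ √(h z) := by
    rw [div_le_iff₀ (by positivity)]
    linarith
  calc (c / (2 * C)) ^ 2 ≤ √(h z) ^ 2 := by gcongr
    _ = h z := Real.sq_sqrt hh0

/-- Up to a translation in the free variable, a fixed amount of `∫ |φ|² |ψ|` sits in a fixed ball:
transversally the potential prevents any loss of mass. -/
theorem exists_translate_ge (hn3 : 3 ≤ n) (hn5 : n ≤ 5) {l : Fin n} (hl : l.val + 1 = n)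
    {N δ : ℝ} (hδ : 0 < δ) :
    ∃ δ' R : ℝ, 0 < δ' ∧ ∀ φ ψ : Space n → ℂ, MemH φ → MemH ψ →
      (mass φ ≤ N ∧ gradNormSq φ ≤ N ∧ potentialEnergy φ ≤ N) →
      (mass ψ ≤ N ∧ gradNormSq ψ ≤ N ∧ potentialEnergy ψ ≤ N) →
      δ ≤ ∫ x, ‖φ x‖ * ‖φ x‖ * ‖ψ x‖ → ∃ t : ℝ, δ' ≤ ∫ x in Metric.ball (0 : Space n) R,
        ‖φ (x + t • EuclideanSpace.single l 1)‖ * ‖φ (x + t • EuclideanSpace.single l 1)‖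
          * ‖ψ (x + t • EuclideanSpace.single l 1)‖ := by
  obtain ⟨δ₁, hδ₁, hslab⟩ := exists_slab_ge hn3 hn5 l (N := N) hδ
  obtain ⟨C, hC0, hC⟩ := exists_cube_le hn3 hn5
  have hnR5 : (n : ℝ) ≤ 5 := by exact_mod_cast hn5
  have hθ : (0 : ℝ) < (6 - n : ℝ) / 4 := by linarith
  -- the tail estimate and the choice of the radius
  have hlim : Tendsto (fun R : ℝ => 2 * (C * (N * R⁻¹) ^ ((6 - n : ℝ) / 4) * N ^ ((n : ℝ) / 4)))
      atTop (𝓝 0) := by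
    have h1 := (tendsto_inv_atTop_zero (𝕜 := ℝ)).const_mul N
    rw [mul_zero] at h1
    have h2 := ((Real.continuous_rpow_const (q := ((6 - n : ℝ) / 4)) hθ.le).tendsto 0).comp h1
    rw [Real.zero_rpow hθ.ne'] at h2
    simpa [Function.comp_def] using ((h2.const_mul C).mul_const (N ^ ((n : ℝ) / 4))).const_mul 2
  obtain ⟨L, hL, hL0⟩ := ((hlim.eventually (gt_mem_nhds (half_pos hδ₁))).and
    (eventually_gt_atTop 0)).exists
  refine ⟨δ₁ / 2, √(L + 1), half_pos hδ₁, fun φ ψ hφ hψ bφ bψ hint => ?_⟩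
  obtain ⟨z, hz⟩ := hslab φ ψ hφ.1 hψ.1 bφ.1 bψ.1 bφ.2.1 bψ.2.1 hint
  let e : Space n := (z : ℝ) • EuclideanSpace.single l 1
  refine ⟨z, ?_⟩
  let φ' : Space n → ℂ := fun x => φ (x + e)
  let ψ' : Space n → ℂ := fun x => ψ (x + e)
  change δ₁ / 2 ≤ ∫ x in Metric.ball (0 : Space n) √(L + 1), ‖φ' x‖ * ‖φ' x‖ * ‖ψ' x‖
  have hφ' : MemH φ' := hφ.comp_add hl _
  have hψ' : MemH ψ' := hψ.comp_add hl _
  have i1 := hφ'.1.memLp_three hn3 hn5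
  have i2 := hψ'.1.memLp_three hn3 hn5
  have itr := integrable_triple i1 i1 i2
  have hz' : δ₁ ≤ ∫ x in slab l 0, ‖φ' x‖ * ‖φ' x‖ * ‖ψ' x‖ := by
    refine hz.trans (le_of_eq ?_)
    rw [← integral_indicator (measurableSet_slab l z), ← integral_indicator (measurableSet_slab l 0),
      ← integral_add_right_eq_self _ e]
    refine integral_congr_ae (ae_of_all _ fun x => ?_)
    have hiff : x + e ∈ slab l z ↔ x ∈ slab l 0 := by
      simp [slab, e]
    beta_reduce
    by_cases hx : x ∈ slab l 0
    · rw [Set.indicator_of_mem hx, Set.indicator_of_mem (hiff.2 hx)]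
    · rw [Set.indicator_of_notMem hx, Set.indicator_of_notMem (fun h => hx (hiff.1 h))]
  -- in the slab `0 ≤ xₗ < 1`, points outside the ball have potential at least `L`
  let T := slab l 0 \ Metric.ball (0 : Space n) √(L + 1)
  have hTm : MeasurableSet T := (measurableSet_slab l 0).diff Metric.isOpen_ball.measurableSet
  have hTV : ∀ x ∈ T, L ≤ potential x := by
    rintro x ⟨hx, hxR⟩
    have hx2 : L + 1 ≤ ‖x‖ ^ 2 := by
      have : √(L + 1) ≤ ‖x‖ := by simpa using hxR
      calc L + 1 = √(L + 1) ^ 2 := (Real.sq_sqrt (by linarith)).symm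
        _ ≤ ‖x‖ ^ 2 := by gcongr
    have hfl : ⌊x l⌋ = 0 := hx
    have f1 := Int.floor_le (x l)
    have f2 := Int.lt_floor_add_one (x l)
    rw [hfl] at f1 f2
    norm_num at f1 f2
    have hsum : ‖x‖ ^ 2 = potential x + x l ^ 2 := by
      rw [EuclideanSpace.norm_sq_eq, ← Finset.sum_filter_add_sum_filter_not _
        (fun i : Fin n => i.val + 1 < n), filter_not_transversal hl, Finset.sum_singleton]
      simp only [Real.norm_eq_abs, sq_abs]
      rfl
    nlinarith
  have tail : ∀ u : Space n → ℂ, MemH u → gradNormSq u ≤ N → potentialEnergy u ≤ N →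
      ∫ x in T, ‖u x‖ ^ 3 ≤ C * (N * L⁻¹) ^ ((6 - n : ℝ) / 4) * N ^ ((n : ℝ) / 4) := by
    intro u hu hg hp
    have h1 : ∫ x in T, ‖u x‖ ^ 2 ≤ N * L⁻¹ := by
      rw [← div_eq_mul_inv, le_div_iff₀ hL0]
      calc (∫ x in T, ‖u x‖ ^ 2) * L = ∫ x in T, L * ‖u x‖ ^ 2 := by
            rw [integral_const_mul, mul_comm]
        _ ≤ ∫ x in T, potential x * ‖u x‖ ^ 2 :=
            setIntegral_mono_on ((integrable_normSq hu.1.1).const_mul _).integrableOn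
              hu.2.integrableOn hTm fun x hx =>
                mul_le_mul_of_nonneg_right (hTV x hx) (by positivity)
        _ ≤ potentialEnergy u := setIntegral_le_integral hu.2
            (ae_of_all _ fun x => mul_nonneg (potential_nonneg x) (by positivity))
        _ ≤ N := hp
    refine ((hC u hu.1).2 T hTm).trans ?_
    have h2 : 0 ≤ ∫ x in T, ‖u x‖ ^ 2 := integral_nonneg fun _ => by positivity
    have h3 := gradNormSq_nonneg u
    have h4 : 0 ≤ N * L⁻¹ := h2.trans h1
    gcongr
  have hT : ∫ x in T, ‖φ' x‖ * ‖φ' x‖ * ‖ψ' x‖ ≤ δ₁ / 2 := by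
    have j1 := integrable_cube i1
    have j2 := integrable_cube i2
    have t1 := tail φ' hφ' ((gradNormSq_comp_add hφ.1 e).trans_le bφ.2.1)
      ((potentialEnergy_comp_add hl φ z).trans_le bφ.2.2)
    have t2 := tail ψ' hψ' ((gradNormSq_comp_add hψ.1 e).trans_le bψ.2.1)
      ((potentialEnergy_comp_add hl ψ z).trans_le bψ.2.2)
    calc _ ≤ ∫ x in T, (‖φ' x‖ ^ 3 + ‖ψ' x‖ ^ 3) := by
          refine integral_mono itr.integrableOn (j1.add j2).integrableOn fun x => ?_
          have ha := norm_nonneg (φ' x)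
          have hb := norm_nonneg (ψ' x)
          simp only
          nlinarith [mul_nonneg (add_nonneg ha hb) (sq_nonneg (‖φ' x‖ - ‖ψ' x‖)), pow_nonneg ha 3,
            pow_nonneg hb 3]
      _ = (∫ x in T, ‖φ' x‖ ^ 3) + ∫ x in T, ‖ψ' x‖ ^ 3 :=
          integral_add j1.integrableOn j2.integrableOn
      _ ≤ δ₁ / 2 := by linarith
  have hsplit := integral_inter_add_sdiff (s := slab l 0)
    (Metric.isOpen_ball (x := (0 : Space n)) (ε := √(L + 1))).measurableSet itr.integrableOn
  have hmono : ∫ x in slab l 0 ∩ Metric.ball (0 : Space n) √(L + 1), ‖φ' x‖ * ‖φ' x‖ * ‖ψ' x‖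
      ≤ ∫ x in Metric.ball (0 : Space n) √(L + 1), ‖φ' x‖ * ‖φ' x‖ * ‖ψ' x‖ :=
    setIntegral_mono_set itr.integrableOn (ae_of_all _ fun _ => by positivity)
      Set.inter_subset_right.eventuallyLE
  linarith

/-! ### Quadratic forms along lines -/

/-- The energy `κ ‖∇u‖² + ∫ V |u|²` of the partially confined oscillator. -/
def oscEnergy (κ : ℝ) (u : Space n → ℂ) : ℝ := κ * gradNormSq u + potentialEnergy u

/-- The bilinear form of `oscEnergy`. -/
def oscInner (κ : ℝ) (u v : Space n → ℂ) : ℝ := κ * gradInner u v + potInner u v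

theorem energy_eq_oscEnergy (κ : ℝ) (p : (Space n → ℂ) × (Space n → ℂ)) :
    energy κ p = 1 / 2 * (oscEnergy 1 p.1 + oscEnergy κ p.2) - 1 / 2 * interaction p := by
  unfold energy oscEnergy
  ring

theorem homNormSq_eq_oscEnergy (p : (Space n → ℂ) × (Space n → ℂ)) :
    homNormSq p = oscEnergy 1 p.1 + oscEnergy 1 p.2 := by
  unfold homNormSq oscEnergy
  ring

theorem oscEnergy_nonneg {κ : ℝ} (hκ : 0 ≤ κ) (u : Space n → ℂ) : 0 ≤ oscEnergy κ u :=
  add_nonneg (mul_nonneg hκ (gradNormSq_nonneg u)) (potentialEnergy_nonneg u)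

theorem norm_ofReal_sq (c : ℝ) : ‖(c : ℂ)‖ ^ 2 = c ^ 2 := by
  rw [Complex.norm_real, Real.norm_eq_abs, sq_abs]

theorem oscEnergy_smul (κ c : ℝ) {u : Space n → ℂ} (hu : MemH u) :
    oscEnergy κ ((c : ℂ) • u) = c ^ 2 * oscEnergy κ u := by
  unfold oscEnergy
  rw [gradNormSq_smul _ hu.1, potentialEnergy_smul, norm_ofReal_sq]
  ring

theorem mass_add_smul {u v : Space n → ℂ} (hu : MemH u) (hv : MemH v) (t : ℝ) :
    mass (u + (t : ℂ) • v) = mass u + 2 * t * reInner u v + t ^ 2 * mass v := by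
  rw [mass_add hu.1.1 (hv.smul _).1.1, mass_smul, norm_ofReal_sq, reInner_comm,
    reInner_smul_left, reInner_comm]
  ring

theorem gradNormSq_add_smul {u v : Space n → ℂ} (hu : MemH u) (hv : MemH v) (t : ℝ) :
    gradNormSq (u + (t : ℂ) • v) = gradNormSq u + 2 * t * gradInner u v + t ^ 2 * gradNormSq v := by
  have h : gradInner u ((t : ℂ) • v) = t * gradInner u v := by
    unfold gradInner
    rw [Finset.mul_sum]
    refine Finset.sum_congr rfl fun i _ => ?_
    rw [reInner_congr Filter.EventuallyEq.rfl (weakPartial_smul _ hv.1 i), reInner_comm,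
      reInner_smul_left, reInner_comm]
  rw [gradNormSq_add hu.1 (hv.smul _).1, gradNormSq_smul _ hv.1, norm_ofReal_sq, h]
  ring

theorem potentialEnergy_add_smul {u v : Space n → ℂ} (hu : MemH u) (hv : MemH v) (t : ℝ) :
    potentialEnergy (u + (t : ℂ) • v)
      = potentialEnergy u + 2 * t * potInner u v + t ^ 2 * potentialEnergy v := by
  have h : potInner u ((t : ℂ) • v) = t * potInner u v := by
    unfold potInner
    rw [potComp_smul, reInner_comm, reInner_smul_left, reInner_comm]
  rw [potentialEnergy_add hu (hv.smul _), potentialEnergy_smul, norm_ofReal_sq, h]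
  ring

theorem oscEnergy_add_smul (κ : ℝ) {u v : Space n → ℂ} (hu : MemH u) (hv : MemH v) (t : ℝ) :
    oscEnergy κ (u + (t : ℂ) • v)
      = oscEnergy κ u + 2 * t * oscInner κ u v + t ^ 2 * oscEnergy κ v := by
  unfold oscEnergy oscInner
  rw [gradNormSq_add_smul hu hv, potentialEnergy_add_smul hu hv]
  ring

theorem oscEnergy_norm_le {κ : ℝ} (hκ : 0 ≤ κ) {u : Space n → ℂ} (hu : MemH u) :
    oscEnergy κ (fun x => (‖u x‖ : ℂ)) ≤ oscEnergy κ u := by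
  unfold oscEnergy
  rw [potentialEnergy_norm]
  have := gradNormSq_norm_le hu.1
  gcongr

theorem interaction_add_smul_right {φ ψ χ : Space n → ℂ} (hφ : MemLp φ 3 volume)
    (hψ : MemLp ψ 3 volume) (hχ : MemLp χ 3 volume) (t : ℝ) :
    interaction (φ, ψ + (t : ℂ) • χ) = interaction (φ, ψ) + t * interaction (φ, χ) := by
  unfold interaction
  have : ∀ x, φ x ^ 2 * conj ((ψ + (t : ℂ) • χ) x)
      = φ x ^ 2 * conj (ψ x) + (t : ℂ) * (φ x ^ 2 * conj (χ x)) := fun x => by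
    simp only [Pi.add_apply, Pi.smul_apply, smul_eq_mul, map_add, map_mul, Complex.conj_ofReal]
    ring
  simp only [this]
  rw [integral_add (integrable_interaction hφ hψ) ((integrable_interaction hφ hχ).const_mul _),
    integral_const_mul, Complex.add_re, Complex.re_ofReal_mul]

/-! ### Smallness of the interaction -/

theorem cube_sum_ge {a b : ℝ} (ha : 0 ≤ a) (hb : 0 ≤ b) : a * a * b ≤ a ^ 3 + b ^ 3 := by
  nlinarith [mul_nonneg (add_nonneg ha hb) (sq_nonneg (a - b)), pow_nonneg ha 3, pow_nonneg hb 3]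

theorem setIntegral_triple_le {f g : Space n → ℂ} (hf : MemLp f 3 volume) (hg : MemLp g 3 volume)
    (T : Set (Space n)) : ∫ x in T, ‖f x‖ * ‖f x‖ * ‖g x‖
      ≤ (∫ x in T, ‖f x‖ ^ 3) + ∫ x in T, ‖g x‖ ^ 3 := by
  rw [← integral_add (integrable_cube hf).integrableOn (integrable_cube hg).integrableOn]
  exact integral_mono (integrable_triple hf hf hg).integrableOn
    ((integrable_cube hf).add (integrable_cube hg)).integrableOn
    fun x => cube_sum_ge (norm_nonneg _) (norm_nonneg _)

theorem WeakNull.tendsto_cube (hn3 : 3 ≤ n) (hn5 : n ≤ 5) {r : ℕ → Space n → ℂ}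
    (hr : WeakNull r) (hm : Tendsto (fun k => mass (r k)) atTop (𝓝 0)) :
    Tendsto (fun k => ∫ x, ‖r k x‖ ^ 3) atTop (𝓝 0) := by
  obtain ⟨C, hC⟩ := hr.bdd
  obtain ⟨K, hK0, hK⟩ := exists_cube_le hn3 hn5
  have hnR5 : (n : ℝ) ≤ 5 := by exact_mod_cast hn5
  have hθ : (0 : ℝ) < (6 - n : ℝ) / 4 := by linarith
  have h1 := ((Real.continuous_rpow_const (q := ((6 - n : ℝ) / 4)) hθ.le).tendsto 0).comp hm
  rw [Real.zero_rpow hθ.ne'] at h1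
  have h2 := (h1.const_mul K).mul_const (C ^ ((n : ℝ) / 4))
  rw [mul_zero, zero_mul] at h2
  refine squeeze_zero (fun k => integral_nonneg fun _ => by positivity) (fun k => ?_) h2
  have h0 := (hK (r k) (hr.memH k).1).2 Set.univ MeasurableSet.univ
  simp only [Measure.restrict_univ] at h0
  refine h0.trans ?_
  have h3 := gradNormSq_nonneg (r k)
  have h4 : 0 ≤ ∫ x, ‖r k x‖ ^ 2 := mass_nonneg _
  simp only [Function.comp_apply]
  exact mul_le_mul_of_nonneg_left (Real.rpow_le_rpow h3 (hC k).2.1 (by positivity))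
    (mul_nonneg hK0.le (Real.rpow_nonneg h4 _))

theorem tendsto_interaction_zero (hn3 : 3 ≤ n) (hn5 : n ≤ 5) {r s : ℕ → Space n → ℂ}
    (hr : WeakNull r) (hs : WeakNull s)
    (h : Tendsto (fun k => mass (r k)) atTop (𝓝 0) ∨ Tendsto (fun k => mass (s k)) atTop (𝓝 0)) :
    Tendsto (fun k => interaction (r k, s k)) atTop (𝓝 0) := by
  have mr := fun k => (hr.memH k).1.memLp_three hn3 hn5
  have ms := fun k => (hs.memH k).1.memLp_three hn3 hn5
  obtain ⟨C, hC⟩ := hr.exists_cube_bound hn3 hn5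
  obtain ⟨C', hC'⟩ := hs.exists_cube_bound hn3 hn5
  have hp : ∀ v : Space n → ℂ, 0 ≤ ∫ x, ‖v x‖ ^ 3 :=
    fun v => integral_nonneg fun _ => by positivity
  have hroot : ∀ {a : ℕ → ℝ}, Tendsto a atTop (𝓝 0) →
      Tendsto (fun k => a k ^ (1 / 3 : ℝ)) atTop (𝓝 0) := fun ha => by
    have := ((Real.continuous_rpow_const (q := (1 / 3 : ℝ)) (by norm_num)).tendsto 0).comp ha
    rwa [Real.zero_rpow (by norm_num)] at this
  have r0 : ∀ {c : ℝ}, 0 ≤ c → 0 ≤ c ^ (1 / 3 : ℝ) := fun hc => Real.rpow_nonneg hc _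
  have hb : ∀ k, ‖interaction (r k, s k)‖ ≤ (∫ x, ‖r k x‖ ^ 3) ^ (1 / 3 : ℝ)
      * (∫ x, ‖r k x‖ ^ 3) ^ (1 / 3 : ℝ) * (∫ x, ‖s k x‖ ^ 3) ^ (1 / 3 : ℝ) := fun k =>
    (abs_interaction_le _ _).trans (integral_triple_le (mr k) (mr k) (ms k))
  rcases h with h | h
  · have t := (((hroot (hr.tendsto_cube hn3 hn5 h)).mul
      (hroot (hr.tendsto_cube hn3 hn5 h))).mul_const (C' ^ (1 / 3 : ℝ)))
    simp only [mul_zero, zero_mul] at t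
    refine squeeze_zero_norm (fun k => (hb k).trans ?_) t
    exact mul_le_mul_of_nonneg_left (rpow_third_le (hp _) (hC' k))
      (mul_nonneg (r0 (hp _)) (r0 (hp _)))
  · have t := (hroot (hs.tendsto_cube hn3 hn5 h)).const_mul (C ^ (1 / 3 : ℝ) * C ^ (1 / 3 : ℝ))
    simp only [mul_zero] at t
    refine squeeze_zero_norm (fun k => (hb k).trans ?_) t
    have hC0 : 0 ≤ C := (hp _).trans (hC k)
    exact mul_le_mul_of_nonneg_right (mul_le_mul (rpow_third_le (hp _) (hC k))
      (rpow_third_le (hp _) (hC k)) (r0 (hp _)) (r0 hC0)) (r0 (hp _))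

/-- A lower bound for the interaction in a fixed ball passes to the weak limit. -/
theorem le_integral_triple_of_local (hn3 : 3 ≤ n) (hn5 : n ≤ 5) {φ ψ : Space n → ℂ}
    {r s : ℕ → Space n → ℂ} (hφ : MemH φ) (hψ : MemH ψ) (hr : WeakNull r) (hs : WeakNull s)
    {δ R : ℝ} (h : ∀ k, δ ≤ ∫ x in Metric.ball (0 : Space n) R,
      ‖(φ + r k) x‖ * ‖(φ + r k) x‖ * ‖(ψ + s k) x‖) :
    δ ≤ ∫ x, ‖φ x‖ * ‖φ x‖ * ‖ψ x‖ := by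
  have mφ := hφ.1.memLp_three hn3 hn5
  have mψ := hψ.1.memLp_three hn3 hn5
  have mr := fun k => (hr.memH k).1.memLp_three hn3 hn5
  have ms := fun k => (hs.memH k).1.memLp_three hn3 hn5
  obtain ⟨C, hC⟩ := hr.exists_cube_bound hn3 hn5
  obtain ⟨C', hC'⟩ := hs.exists_cube_bound hn3 hn5
  have lr := hr.tendsto_cube_local hn3 hn5
  have ls := hs.tendsto_cube_local hn3 hn5
  let M := max (max C C') (∫ x, ‖φ x‖ ^ 3)
  have bC : ∀ k, ∫ x, ‖r k x‖ ^ 3 ≤ M := fun k => (hC k).trans (by simp [M])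
  have bC' : ∀ k, ∫ x, ‖s k x‖ ^ 3 ≤ M := fun k => (hC' k).trans (by simp [M])
  have bP : ∫ x, ‖φ x‖ ^ 3 ≤ M := by simp [M]
  have t1 := tendsto_triple (C := M) mψ (fun _ => mφ) mr (fun _ => bP) bC lr
  have t2 := tendsto_triple (C := M) mψ mr mr bC bC lr
  have t3 := tendsto_triple (C := M) mφ (fun _ => mφ) ms (fun _ => bP) bC' ls
  have t4 := tendsto_triple (C := M) mφ mr ms bC bC' ls
  have t := ((((t1.const_mul 2).add t2).add t3).add (t4.const_mul 2)).add ((lr R).add (ls R))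
  have t' := t.const_add (∫ x, ‖φ x‖ * ‖φ x‖ * ‖ψ x‖)
  simp only [mul_zero, add_zero] at t'
  refine ge_of_tendsto' t' fun k => (h k).trans ?_
  let B := Metric.ball (0 : Space n) R
  have j0 := integrable_triple mφ mφ mψ
  have j1 := (integrable_triple mψ mφ (mr k)).const_mul 2
  have j2 := integrable_triple mψ (mr k) (mr k)
  have j3 := integrable_triple mφ mφ (ms k)
  have j4 := (integrable_triple mφ (mr k) (ms k)).const_mul 2
  have j5 := integrable_triple (mr k) (mr k) (ms k)
  let F : Space n → ℝ := fun x => ‖φ x‖ * ‖φ x‖ * ‖ψ x‖ + (2 * (‖ψ x‖ * ‖φ x‖ * ‖r k x‖)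
    + ‖ψ x‖ * ‖r k x‖ * ‖r k x‖ + ‖φ x‖ * ‖φ x‖ * ‖s k x‖ + 2 * (‖φ x‖ * ‖r k x‖ * ‖s k x‖))
  have j12 : Integrable fun x => 2 * (‖ψ x‖ * ‖φ x‖ * ‖r k x‖) + ‖ψ x‖ * ‖r k x‖ * ‖r k x‖ :=
    j1.add j2
  have j123 : Integrable fun x => 2 * (‖ψ x‖ * ‖φ x‖ * ‖r k x‖) + ‖ψ x‖ * ‖r k x‖ * ‖r k x‖
      + ‖φ x‖ * ‖φ x‖ * ‖s k x‖ := j12.add j3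
  have j1234 : Integrable fun x => 2 * (‖ψ x‖ * ‖φ x‖ * ‖r k x‖) + ‖ψ x‖ * ‖r k x‖ * ‖r k x‖
      + ‖φ x‖ * ‖φ x‖ * ‖s k x‖ + 2 * (‖φ x‖ * ‖r k x‖ * ‖s k x‖) := j123.add j4
  have jF : Integrable F := j0.add j1234
  calc _ ≤ ∫ x in B, (F x + ‖r k x‖ * ‖r k x‖ * ‖s k x‖) := by
        refine integral_mono (integrable_triple (mφ.add (mr k)) (mφ.add (mr k))
          (mψ.add (ms k))).integrableOn (jF.add j5).integrableOn fun x => ?_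
        have h1 := norm_add_le (φ x) (r k x)
        have h2 := norm_add_le (ψ x) (s k x)
        simp only [Pi.add_apply, F]
        calc _ ≤ (‖φ x‖ + ‖r k x‖) * (‖φ x‖ + ‖r k x‖) * (‖ψ x‖ + ‖s k x‖) := by gcongr
          _ = _ := by ring
    _ = (∫ x in B, F x) + ∫ x in B, ‖r k x‖ * ‖r k x‖ * ‖s k x‖ :=
        integral_add jF.integrableOn j5.integrableOn
    _ ≤ (∫ x, F x) + ((∫ x in B, ‖r k x‖ ^ 3) + ∫ x in B, ‖s k x‖ ^ 3) :=
        add_le_add (setIntegral_le_integral jF (ae_of_all _ fun _ => by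
          simp only [F]; positivity)) (setIntegral_triple_le (mr k) (ms k) B)
    _ = _ := by
        simp only [F]
        rw [integral_add j0 j1234, integral_add j123 j4, integral_add j12 j3, integral_add j1 j2,
          integral_const_mul, integral_const_mul]
        ring

theorem mass_pos_of_interaction {φ ψ : Space n → ℂ} (hφ : MemH φ) (hψ : MemH ψ)
    (h : 0 < interaction (φ, ψ)) : 0 < mass φ ∧ 0 < mass ψ := by
  have hz : ∀ {u : Space n → ℂ}, MemH u → ¬ 0 < mass u → u =ᵐ[volume] 0 := fun {u} hu hm => by
    have m0 : mass u = 0 := le_antisymm (not_lt.1 hm) (mass_nonneg _)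
    have := (integral_eq_zero_iff_of_nonneg (fun x => by positivity)
      (integrable_normSq hu.1.1)).1 m0
    filter_upwards [this] with x hx
    simpa using hx
  constructor <;> by_contra hm
  · have : interaction (φ, ψ) = 0 := by
      unfold interaction
      rw [integral_congr_ae (g := fun _ => (0 : ℂ)) ((hz hφ hm).mono fun x hx => by simp [hx])]
      simp
    linarith
  · have : interaction (φ, ψ) = 0 := by
      unfold interaction
      rw [integral_congr_ae (g := fun _ => (0 : ℂ)) ((hz hψ hm).mono fun x hx => by simp [hx])]
      simp
    linarith

/-! ### Trial sequences -/

theorem localInf_le_energy {κ χ μ₁ μ₂ : ℝ}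
    (hbdd : BddBelow (energy κ '' (massConstraint n μ₁ μ₂ ∩ energyBall n κ χ)))
    {p : (Space n → ℂ) × (Space n → ℂ)} (hp : p ∈ massConstraint n μ₁ μ₂ ∩ energyBall n κ χ) :
    localInf n κ χ μ₁ μ₂ ≤ energy κ p := csInf_le hbdd ⟨p, hp, rfl⟩

/-- The infimum is bounded by limits of energies along sequences satisfying the constraints only
asymptotically, provided that the norms stay strictly inside the ball. -/
theorem localInf_le_of_tendsto {κ χ μ₁ μ₂ : ℝ} (hμ₁ : 0 < μ₁) (hμ₂ : 0 < μ₂)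
    (hbdd : BddBelow (energy κ '' (massConstraint n μ₁ μ₂ ∩ energyBall n κ χ)))
    {f g : ℕ → Space n → ℂ} (hf : ∀ k, MemH (f k)) (hg : ∀ k, MemH (g k)) {Z₁ Z₂ W₂ J : ℝ}
    (hmf : Tendsto (fun k => mass (f k)) atTop (𝓝 μ₁))
    (hmg : Tendsto (fun k => mass (g k)) atTop (𝓝 μ₂))
    (hZ₁ : Tendsto (fun k => oscEnergy 1 (f k)) atTop (𝓝 Z₁))
    (hZ₂ : Tendsto (fun k => oscEnergy 1 (g k)) atTop (𝓝 Z₂))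
    (hW₂ : Tendsto (fun k => oscEnergy κ (g k)) atTop (𝓝 W₂))
    (hJ : Tendsto (fun k => interaction (f k, g k)) atTop (𝓝 J)) (hlt : Z₁ + Z₂ < χ / min 1 κ) :
    localInf n κ χ μ₁ μ₂ ≤ 1 / 2 * (Z₁ + W₂) - 1 / 2 * J := by
  -- normalizing factors which restore the constraints; they tend to `1`
  let c : ℕ → ℝ := fun k => √(μ₁ / mass (f k))
  let e : ℕ → ℝ := fun k => √(μ₂ / mass (g k))
  have hc : Tendsto c atTop (𝓝 1) := by
    have := ((tendsto_const_nhds (x := μ₁)).div hmf hμ₁.ne').sqrt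
    rwa [div_self hμ₁.ne', Real.sqrt_one] at this
  have he : Tendsto e atTop (𝓝 1) := by
    have := ((tendsto_const_nhds (x := μ₂)).div hmg hμ₂.ne').sqrt
    rwa [div_self hμ₂.ne', Real.sqrt_one] at this
  have t1 := (hc.pow 2).mul hZ₁
  have t2 := (he.pow 2).mul hZ₂
  have t3 := (he.pow 2).mul hW₂
  have t4 := ((hc.pow 2).mul he).mul hJ
  simp only [one_pow, one_mul] at t1 t2 t3 t4
  have hE := ((t1.add t3).const_mul (1 / 2)).sub (t4.const_mul (1 / 2))
  refine ge_of_tendsto hE ?_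
  filter_upwards [hmf.eventually (lt_mem_nhds hμ₁), hmg.eventually (lt_mem_nhds hμ₂),
    (t1.add t2).eventually (gt_mem_nhds hlt)] with k h1 h2 h3
  have hmem : ((c k : ℂ) • f k, (e k : ℂ) • g k)
      ∈ massConstraint n μ₁ μ₂ ∩ energyBall n κ χ := by
    have hS : ((c k : ℂ) • f k, (e k : ℂ) • g k) ∈ energySpace n :=
      ⟨(hf k).smul _, (hg k).smul _⟩
    refine ⟨⟨hS, ?_, ?_⟩, hS, ?_⟩
    · rw [mass_smul, norm_ofReal_sq, Real.sq_sqrt (by positivity), div_mul_cancel₀ _ h1.ne']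
    · rw [mass_smul, norm_ofReal_sq, Real.sq_sqrt (by positivity), div_mul_cancel₀ _ h2.ne']
    · rw [homNormSq_eq_oscEnergy, oscEnergy_smul _ _ (hf k), oscEnergy_smul _ _ (hg k)]
      exact h3.le
  have h4 := localInf_le_energy hbdd hmem
  rw [energy_eq_oscEnergy, oscEnergy_smul _ _ (hf k), oscEnergy_smul _ _ (hg k),
    interaction_smul] at h4
  exact h4

theorem tendsto_mass_split {P : Space n → ℂ} {r : ℕ → Space n → ℂ} (hP : MemH P)
    (hr : WeakNull r) (β : ℝ) {b : ℝ} (hb : Tendsto (fun k => mass (r k)) atTop (𝓝 b)) :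
    Tendsto (fun k => mass (P + (β : ℂ) • r k)) atTop (𝓝 (mass P + β ^ 2 * b)) := by
  have h := (tendsto_mass_add_sub hP.1.1 (fun k => ((hr.smul β).memH k).1.1)
    (hr.smul β).weak).add (hb.const_mul (β ^ 2))
  refine h.congr fun k => ?_
  rw [mass_smul, norm_ofReal_sq]
  ring

theorem tendsto_oscEnergy_split {κ : ℝ} {P : Space n → ℂ} {r : ℕ → Space n → ℂ} (hP : MemH P)
    (hr : WeakNull r) (β : ℝ) {X : ℝ} (hX : Tendsto (fun k => oscEnergy κ (r k)) atTop (𝓝 X)) :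
    Tendsto (fun k => oscEnergy κ (P + (β : ℂ) • r k)) atTop
      (𝓝 (oscEnergy κ P + β ^ 2 * X)) := by
  have h := (((tendsto_gradNormSq_add_sub hP (hr.smul β)).const_mul κ).add
    (tendsto_potentialEnergy_add_sub hP (hr.smul β))).add (hX.const_mul (β ^ 2))
  refine h.congr fun k => ?_
  rw [← oscEnergy_smul κ β (hr.memH k)]
  unfold oscEnergy
  ring

theorem tendsto_interaction_split (hn3 : 3 ≤ n) (hn5 : n ≤ 5) {P Q : Space n → ℂ}
    {r s : ℕ → Space n → ℂ} (hP : MemH P) (hQ : MemH Q) (hr : WeakNull r) (hs : WeakNull s)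
    (β γ : ℝ) {K : ℝ} (hK : Tendsto (fun k => interaction (r k, s k)) atTop (𝓝 K)) :
    Tendsto (fun k => interaction (P + (β : ℂ) • r k, Q + (γ : ℂ) • s k)) atTop
      (𝓝 (interaction (P, Q) + β ^ 2 * γ * K)) := by
  have h := (tendsto_interaction_add_sub hn3 hn5 hP hQ (hr.smul β) (hs.smul γ)).add
    (hK.const_mul (β ^ 2 * γ))
  refine h.congr fun k => ?_
  rw [interaction_smul]
  ring

/-- A pair of weakly null sequences along which all the relevant quantities converge: `b₁, b₂` are
the limits of the masses, `X₁, X₂` those of the homogeneous norms, `Y₂` and `K` enter the limit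
energy. -/
structure Remainder (κ : ℝ) (r s : ℕ → Space n → ℂ) (b₁ b₂ X₁ X₂ Y₂ K : ℝ) : Prop where
  left : WeakNull r
  right : WeakNull s
  mass_left : Tendsto (fun k => mass (r k)) atTop (𝓝 b₁)
  mass_right : Tendsto (fun k => mass (s k)) atTop (𝓝 b₂)
  osc_left : Tendsto (fun k => oscEnergy 1 (r k)) atTop (𝓝 X₁)
  osc_right : Tendsto (fun k => oscEnergy 1 (s k)) atTop (𝓝 X₂)
  osc_right' : Tendsto (fun k => oscEnergy κ (s k)) atTop (𝓝 Y₂)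
  inter : Tendsto (fun k => interaction (r k, s k)) atTop (𝓝 K)

section Remainder

variable {κ χ μ₁ μ₂ b₁ b₂ X₁ X₂ Y₂ K : ℝ} {r s : ℕ → Space n → ℂ}

/-- Recombining an arbitrary pair with rescaled remainders gives admissible trial sequences. -/
theorem Remainder.localInf_le (hR : Remainder κ r s b₁ b₂ X₁ X₂ Y₂ K) (hn3 : 3 ≤ n) (hn5 : n ≤ 5)
    (hμ₁ : 0 < μ₁) (hμ₂ : 0 < μ₂)
    (hbdd : BddBelow (energy κ '' (massConstraint n μ₁ μ₂ ∩ energyBall n κ χ)))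
    {P Q : Space n → ℂ} (hP : MemH P) (hQ : MemH Q) (β γ : ℝ)
    (h1 : mass P + β ^ 2 * b₁ = μ₁) (h2 : mass Q + γ ^ 2 * b₂ = μ₂)
    (hlt : oscEnergy 1 P + β ^ 2 * X₁ + (oscEnergy 1 Q + γ ^ 2 * X₂) < χ / min 1 κ) :
    localInf n κ χ μ₁ μ₂ ≤ 1 / 2 * (oscEnergy 1 P + β ^ 2 * X₁ + (oscEnergy κ Q + γ ^ 2 * Y₂))
      - 1 / 2 * (interaction (P, Q) + β ^ 2 * γ * K) :=
  localInf_le_of_tendsto hμ₁ hμ₂ hbdd (fun k => hP.add ((hR.left.smul β).memH k))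
    (fun k => hQ.add ((hR.right.smul γ).memH k))
    (h1 ▸ tendsto_mass_split hP hR.left β hR.mass_left)
    (h2 ▸ tendsto_mass_split hQ hR.right γ hR.mass_right)
    (tendsto_oscEnergy_split hP hR.left β hR.osc_left)
    (tendsto_oscEnergy_split hQ hR.right γ hR.osc_right)
    (tendsto_oscEnergy_split hQ hR.right γ hR.osc_right')
    (tendsto_interaction_split hn3 hn5 hP hQ hR.left hR.right β γ hR.inter) hlt

theorem Remainder.nonneg (hR : Remainder κ r s b₁ b₂ X₁ X₂ Y₂ K) (hκ : 0 < κ) :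
    0 ≤ b₁ ∧ 0 ≤ b₂ ∧ 0 ≤ X₁ ∧ 0 ≤ X₂ ∧ 0 ≤ Y₂ :=
  ⟨ge_of_tendsto' hR.mass_left fun _ => mass_nonneg _,
    ge_of_tendsto' hR.mass_right fun _ => mass_nonneg _,
    ge_of_tendsto' hR.osc_left fun _ => oscEnergy_nonneg zero_le_one _,
    ge_of_tendsto' hR.osc_right fun _ => oscEnergy_nonneg zero_le_one _,
    ge_of_tendsto' hR.osc_right' fun _ => oscEnergy_nonneg hκ.le _⟩

theorem Remainder.oscillator_le (hR : Remainder κ r s b₁ b₂ X₁ X₂ Y₂ K) (hn : 1 ≤ n)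
    (hκ : 0 < κ) : (n - 1) * b₁ ≤ X₁ ∧ √κ * (n - 1) * b₂ ≤ Y₂ := by
  constructor
  · refine le_of_tendsto_of_tendsto' (hR.mass_left.const_mul _) hR.osc_left fun k => ?_
    have := PartialConfinement.oscillator_le one_pos hn (hR.left.memH k)
    rwa [Real.sqrt_one, one_mul] at this
  · exact le_of_tendsto_of_tendsto' (hR.mass_right.const_mul _) hR.osc_right' fun k =>
      PartialConfinement.oscillator_le hκ hn (hR.right.memH k)

theorem Remainder.interaction_eq_zero (hR : Remainder κ r s b₁ b₂ X₁ X₂ Y₂ K) (hn3 : 3 ≤ n)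
    (hn5 : n ≤ 5) (hb : b₁ = 0 ∨ b₂ = 0) : K = 0 := by
  refine tendsto_nhds_unique hR.inter (tendsto_interaction_zero hn3 hn5 hR.left hR.right ?_)
  rcases hb with h | h
  · exact Or.inl (h ▸ hR.mass_left)
  · exact Or.inr (h ▸ hR.mass_right)

end Remainder

/-! ### Mass exchange -/

/-- The second-order gain in mass exchange: the interaction of a part whose masses are scaled by
`1 ± x` and `1 ± y` scales by `(1 ± x) √(1 ± y)`. -/
theorem two_lt_sqrt_exchange {x y : ℝ} (hy : 0 < y) (hyx : y ≤ x) (hx : x < 1) :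
    2 < (1 + x) * √(1 + y) + (1 - x) * √(1 - y) := by
  have hA2 : √(1 + y) ^ 2 = 1 + y := Real.sq_sqrt (by linarith)
  have hB2 : √(1 - y) ^ 2 = 1 - y := Real.sq_sqrt (by linarith)
  have hA : 0 < √(1 + y) := Real.sqrt_pos.2 (by linarith)
  have hB : 0 < √(1 - y) := Real.sqrt_pos.2 (by linarith)
  have hAB : √(1 - y) < √(1 + y) := Real.sqrt_lt_sqrt (by linarith) (by linarith)
  generalize √(1 + y) = A at *
  generalize √(1 - y) = B at *
  have h1 : y * (A - B) ≤ x * (A - B) := by nlinarith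
  have h2 : y * (A - B) = (4 - (A + B) ^ 2) * (A + B) / 2 := by
    have hy2 : y = (A ^ 2 - B ^ 2) / 2 := by linarith
    have h4 : (A - B) ^ 2 = 4 - (A + B) ^ 2 := by nlinarith
    rw [← h4, hy2]
    ring
  have h3 : (A + B) ^ 2 < 4 := by nlinarith
  have h5 : A + B < 2 := by nlinarith
  have h6 : 1 < A + B := by nlinarith
  nlinarith [mul_pos (sub_pos.2 h5) (sub_pos.2 h6), mul_pos (mul_pos (sub_pos.2 h5) (sub_pos.2 h6))
    (sub_pos.2 h6), mul_pos (sub_pos.2 h5) (add_pos hA hB)]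

/-- A splitting into two parts of positive masses is never optimal: moving mass between the parts,
in either direction, the quadratic terms change linearly, while the interaction is strictly convex
to second order. -/
theorem exchange_contradiction {a₁ a₂ b₁ b₂ Q₁ Q₂ Y₁ Y₂ K K' d : ℝ} (ha₁ : 0 < a₁) (ha₂ : 0 < a₂)
    (hb₁ : 0 < b₁) (hb₂ : 0 < b₂) (hK : 0 < K) (hK' : 0 ≤ K')
    (hd : d = 1 / 2 * (Q₁ + Y₁ + (Q₂ + Y₂)) - 1 / 2 * (K + K'))
    (hF : ∀ α₁ α₂ β₁ β₂ : ℝ, α₁ ^ 2 ≤ 3 / 2 → α₂ ^ 2 ≤ 3 / 2 → β₁ ^ 2 ≤ 3 / 2 → β₂ ^ 2 ≤ 3 / 2 →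
      α₁ ^ 2 * a₁ + β₁ ^ 2 * b₁ = a₁ + b₁ → α₂ ^ 2 * a₂ + β₂ ^ 2 * b₂ = a₂ + b₂ →
      d ≤ 1 / 2 * (α₁ ^ 2 * Q₁ + β₁ ^ 2 * Y₁ + (α₂ ^ 2 * Q₂ + β₂ ^ 2 * Y₂))
        - 1 / 2 * (α₁ ^ 2 * α₂ * K + β₁ ^ 2 * β₂ * K')) : False := by
  let c₁ := a₁ / b₁
  let c₂ := a₂ / b₂
  have hc₁ : 0 < c₁ := by positivity
  have hc₂ : 0 < c₂ := by positivity
  have e1 : c₁ * b₁ = a₁ := div_mul_cancel₀ _ hb₁.ne'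
  have e2 : c₂ * b₂ = a₂ := div_mul_cancel₀ _ hb₂.ne'
  -- `1 ± x` and `1 ± y` scale the masses of the first part; the second part absorbs the difference.
  -- The choice gives `y ≤ x` and `y c₂ ≤ x c₁`, as `two_lt_sqrt_exchange` requires for both parts.
  let x := 1 / (2 * (1 + c₁))
  have hx : 0 < x := by positivity
  have hx1 : x ≤ 1 / 2 := by
    simp only [x]
    gcongr
    linarith
  have hxc : x * c₁ ≤ 1 / 2 := by
    simp only [x]
    rw [div_mul_eq_mul_div, div_le_iff₀ (by positivity)]
    linarith
  have hxc0 : 0 < x * c₁ := by positivity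
  let y := x * min 1 (c₁ / c₂)
  have hy : 0 < y := by positivity
  have hyx : y ≤ x := mul_le_of_le_one_right hx.le (min_le_left _ _)
  have hyc : y * c₂ ≤ x * c₁ := by
    simp only [y]
    rw [mul_assoc]
    gcongr
    rw [← le_div_iff₀ hc₂]
    exact min_le_right _ _
  have hyc0 : 0 < y * c₂ := by positivity
  -- the energy inequality for the amounts `u` and `v` of mass
  have key : ∀ u v : ℝ, |u| ≤ 1 / 2 → |v| ≤ 1 / 2 → |u * c₁| ≤ 1 / 2 → |v * c₂| ≤ 1 / 2 →
      d ≤ 1 / 2 * ((1 + u) * Q₁ + (1 - u * c₁) * Y₁ + ((1 + v) * Q₂ + (1 - v * c₂) * Y₂))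
        - 1 / 2 * ((1 + u) * √(1 + v) * K + (1 - u * c₁) * √(1 - v * c₂) * K') := by
    intro u v hu hv huc hvc
    obtain ⟨u1, u2⟩ := abs_le.1 hu
    obtain ⟨v1, v2⟩ := abs_le.1 hv
    obtain ⟨u3, u4⟩ := abs_le.1 huc
    obtain ⟨v3, v4⟩ := abs_le.1 hvc
    have s1 : √(1 + u) ^ 2 = 1 + u := Real.sq_sqrt (by linarith)
    have s2 : √(1 + v) ^ 2 = 1 + v := Real.sq_sqrt (by linarith)
    have s3 : √(1 - u * c₁) ^ 2 = 1 - u * c₁ := Real.sq_sqrt (by linarith)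
    have s4 : √(1 - v * c₂) ^ 2 = 1 - v * c₂ := Real.sq_sqrt (by linarith)
    have := hF √(1 + u) √(1 + v) √(1 - u * c₁) √(1 - v * c₂) (by rw [s1]; linarith)
      (by rw [s2]; linarith) (by rw [s3]; linarith) (by rw [s4]; linarith)
      (by rw [s1, s3, ← e1]; ring) (by rw [s2, s4, ← e2]; ring)
    rwa [s1, s2, s3, s4] at this
  have ax : |x| ≤ 1 / 2 := by rwa [abs_of_pos hx]
  have ay : |y| ≤ 1 / 2 := by rw [abs_of_pos hy]; linarith
  have axc : |x * c₁| ≤ 1 / 2 := by rwa [abs_of_pos hxc0]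
  have ayc : |y * c₂| ≤ 1 / 2 := by rw [abs_of_pos hyc0]; linarith
  have k1 := key x y ax ay axc ayc
  have k2 := key (-x) (-y) (by rwa [abs_neg]) (by rwa [abs_neg]) (by rwa [neg_mul, abs_neg])
    (by rwa [neg_mul, abs_neg])
  -- in the sum of both inequalities the quadratic terms cancel
  have g1 := two_lt_sqrt_exchange hy hyx (by linarith)
  have g2 := two_lt_sqrt_exchange hyc0 hyc (by linarith)
  have m1 := mul_lt_mul_of_pos_right g1 hK
  have m2 := mul_le_mul_of_nonneg_right g2.le hK'
  simp only [neg_mul, sub_neg_eq_add, ← sub_eq_add_neg] at k2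
  nlinarith

section NoSplitting

variable {κ χ μ₁ μ₂ b₁ b₂ X₁ X₂ Y₂ K : ℝ} {r s : ℕ → Space n → ℂ}

/-! ### No splitting of a minimizing sequence -/

/-- If no mass escapes from the second component, none can escape from the first one: raising the
mass of the weak limit would lower the energy. -/
theorem Remainder.false_of_right_eq_zero (hR : Remainder κ r s b₁ 0 X₁ X₂ Y₂ K) (hn3 : 3 ≤ n)
    (hn5 : n ≤ 5) (hκ : 0 < κ) (hb₁ : 0 < b₁)
    (hbdd : BddBelow (energy κ '' (massConstraint n μ₁ μ₂ ∩ energyBall n κ χ)))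
    {φ ψ : Space n → ℂ} (hφ : MemH φ) (hψ : MemH ψ) (hmφ : 0 < mass φ) (hmψ : 0 < mass ψ)
    (h1 : mass φ + b₁ = μ₁) (h2 : mass ψ = μ₂)
    (hlt : oscEnergy 1 φ + X₁ + (oscEnergy 1 ψ + X₂) ≤ χ / min 1 κ / 2) (hN : 0 < χ / min 1 κ)
    (hd : localInf n κ χ μ₁ μ₂ = 1 / 2 * (oscEnergy 1 φ + X₁ + (oscEnergy κ ψ + Y₂))
      - 1 / 2 * (interaction (φ, ψ) + K))
    (hdE : localInf n κ χ μ₁ μ₂ < 1 / 2 * (n - 1) * (μ₁ + √κ * μ₂)) : False := by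
  have hn1 : 1 ≤ n := by omega
  obtain rfl : K = 0 := hR.interaction_eq_zero hn3 hn5 (Or.inr rfl)
  obtain ⟨-, -, hX₁, hX₂, hY₂⟩ := hR.nonneg hκ
  have hX₁' := (hR.oscillator_le hn1 hκ).1
  let c := mass φ / b₁
  have hc : 0 < c := by positivity
  have hcb : c * b₁ = mass φ := div_mul_cancel₀ _ hb₁.ne'
  -- the mass of `φ` is raised by the factor `1 + σ`, at the expense of the remainder
  let σ := 1 / (2 * (1 + c))
  have hσ : 0 < σ := by positivity
  have hσ1 : σ ≤ 1 / 2 := by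
    simp only [σ]
    gcongr
    linarith
  have hσc : σ * c ≤ 1 := by
    simp only [σ]
    rw [div_mul_eq_mul_div, div_le_one (by positivity)]
    linarith
  have hσc0 : 0 < σ * c := by positivity
  have s1 : √(1 + σ) ^ 2 = 1 + σ := Real.sq_sqrt (by linarith)
  have s2 : √(1 - σ * c) ^ 2 = 1 - σ * c := Real.sq_sqrt (by linarith)
  have ho1 := oscEnergy_nonneg zero_le_one φ
  have ho2 := oscEnergy_nonneg zero_le_one ψ
  have key := hR.localInf_le (μ₁ := μ₁) (μ₂ := μ₂) hn3 hn5 (by linarith) (by linarith) hbdd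
    (hφ.smul (√(1 + σ) : ℂ)) hψ √(1 - σ * c) 1
    (by rw [mass_smul, norm_ofReal_sq, s1, s2, ← h1, sub_mul, mul_assoc, hcb]; ring)
    (by rw [h2]; ring)
    (by
      rw [oscEnergy_smul _ _ hφ, s1, s2]
      nlinarith)
  have hK : interaction ((√(1 + σ) : ℂ) • φ, ψ) = (1 + σ) * interaction (φ, ψ) := by
    have := interaction_smul √(1 + σ) 1 φ ψ
    rwa [Complex.ofReal_one, one_smul, mul_one, s1] at this
  rw [oscEnergy_smul _ _ hφ, hK, s1, s2, hd] at key
  -- optimality makes the interaction too small for the energy to lie below the spectral bound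
  have h3 : σ * interaction (φ, ψ) ≤ σ * (oscEnergy 1 φ - c * X₁) := by linarith
  have h4 := le_of_mul_le_mul_left h3 hσ
  have h5 : (n - 1) * mass φ ≤ c * X₁ := by
    calc (n - 1) * mass φ = c * ((n - 1) * b₁) := by rw [← hcb]; ring
      _ ≤ c * X₁ := by gcongr
  have h6 : √κ * (n - 1) * mass ψ ≤ oscEnergy κ ψ :=
    PartialConfinement.oscillator_le hκ hn1 hψ
  rw [hd, ← h1, ← h2] at hdE
  linarith

/-- If no mass escapes from the first component, none can escape from the second one: the escaping
mass can be put on a wide Gaussian interacting with the first component. -/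
theorem Remainder.false_of_left_eq_zero (hR : Remainder κ r s 0 b₂ X₁ X₂ Y₂ K) (hn3 : 3 ≤ n)
    (hn5 : n ≤ 5) (hκ : 0 < κ) (hb₂ : 0 < b₂)
    (hbdd : BddBelow (energy κ '' (massConstraint n μ₁ μ₂ ∩ energyBall n κ χ)))
    {φ ψ : Space n → ℂ} (hφ : MemH φ) (hψ : MemH ψ) (hmφ : 0 < mass φ)
    (hφr : φ =ᵐ[volume] fun x => (‖φ x‖ : ℂ)) (hψr : ψ =ᵐ[volume] fun x => (‖ψ x‖ : ℂ))
    (h1 : mass φ = μ₁) (h2 : mass ψ + b₂ = μ₂) (hμ₂ : 0 < μ₂)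
    (hlt : oscEnergy 1 φ + X₁ + (oscEnergy 1 ψ + X₂) < χ / min 1 κ)
    (hd : localInf n κ χ μ₁ μ₂ = 1 / 2 * (oscEnergy 1 φ + X₁ + (oscEnergy κ ψ + Y₂))
      - 1 / 2 * (interaction (φ, ψ) + K)) : False := by
  have hn1 : 1 ≤ n := by omega
  obtain rfl : K = 0 := hR.interaction_eq_zero hn3 hn5 (Or.inl rfl)
  have mφ := hφ.1.memLp_three hn3 hn5
  have mψ := hψ.1.memLp_three hn3 hn5
  obtain ⟨-, -, hX₁, hX₂, hY₂⟩ := hR.nonneg hκ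
  have hY₂' := (hR.oscillator_le hn1 hκ).2
  let ε : ℝ := √κ * (n - 1)
  have hn' : (1 : ℝ) ≤ n := by exact_mod_cast hn1
  have hε : 0 ≤ ε := mul_nonneg (Real.sqrt_nonneg _) (by linarith)
  -- pairing of `φ` with the wide Gaussians
  have hpair : ∀ a, 0 < a → interaction (φ, groundState κ a)
      = ∫ x, ‖φ x‖ * ‖φ x‖ * ‖groundState κ a x‖ := fun a ha => by
    rw [← interaction_norm]
    unfold interaction
    refine congrArg Complex.re (integral_congr_ae ?_)
    filter_upwards [hφr] with x hx
    simp only [groundState, norm_gaussian, ← hx]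
    rw [gaussian]
  have hg3 : ∀ a, 0 < a → MemLp (groundState (n := n) κ a) 3 volume := fun a ha =>
    (memH_groundState hκ ha).1.memLp_three hn3 hn5
  have hk0 : 0 < interaction (φ, groundState κ 1) := by
    rw [hpair 1 one_pos]
    refine (integral_nonneg fun x => by positivity).lt_of_ne fun h0 => ?_
    have hz := (integral_eq_zero_iff_of_nonneg (fun x => by positivity)
      (integrable_triple mφ mφ (hg3 1 one_pos))).1 h0.symm
    have : mass φ = 0 := by
      unfold mass
      rw [integral_congr_ae (g := fun _ => (0 : ℝ))]
      · simp
      · filter_upwards [hz] with x hx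
        have hpos : 0 < ‖groundState (n := n) κ 1 x‖ := by
          rw [groundState, norm_gaussian]; exact gaussExp_pos _ _
        have := (mul_eq_zero.1 hx).resolve_right hpos.ne'
        rw [sq]; exact this
    linarith
  have hkmono : ∀ a, 0 < a → a ≤ 1 →
      interaction (φ, groundState κ 1) ≤ interaction (φ, groundState κ a) := fun a ha ha1 => by
    rw [hpair 1 one_pos, hpair a ha]
    refine integral_mono (integrable_triple mφ mφ (hg3 1 one_pos))
      (integrable_triple mφ mφ (hg3 a ha)) fun x => ?_
    exact mul_le_mul_of_nonneg_left (groundState_mono κ ha1 x) (by positivity)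
  -- first-order optimality for the perturbation `ψ + t g`
  have hopt : ∀ a, 0 < a → interaction (φ, groundState κ a)
      ≤ 2 * (oscInner κ ψ (groundState κ a) - ε * reInner ψ (groundState κ a)) := by
    intro a ha
    let g : Space n → ℂ := groundState κ a
    have hg : MemH g := memH_groundState hκ ha
    change interaction (φ, g) ≤ 2 * (oscInner κ ψ g - ε * reInner ψ g)
    have hψg : 0 ≤ reInner ψ g := by
      refine integral_nonneg_of_ae ?_
      filter_upwards [hψr] with x hx
      rw [hx, inner_eq_re_mul_conj]
      simp only [g, groundState, gaussian, Complex.conj_ofReal, ← Complex.ofReal_mul,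
        Complex.ofReal_re]
      exact mul_nonneg (norm_nonneg _) (gaussExp_pos _ _).le
    have hc1 : Continuous fun t : ℝ => 2 * t * reInner ψ g + t ^ 2 * mass g := by fun_prop
    have hc2 : Continuous fun t : ℝ => oscEnergy 1 φ + X₁
        + (oscEnergy 1 ψ + 2 * t * oscInner 1 ψ g + t ^ 2 * oscEnergy 1 g + X₂) := by fun_prop
    have ht1 := (hc1.tendsto 0).eventually (gt_mem_nhds
      (by simpa using hb₂ : 2 * 0 * reInner ψ g + 0 ^ 2 * mass g < b₂))
    have ht2 := (hc2.tendsto 0).eventually (gt_mem_nhds (by simpa using hlt :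
      oscEnergy 1 φ + X₁ + (oscEnergy 1 ψ + 2 * 0 * oscInner 1 ψ g + 0 ^ 2 * oscEnergy 1 g + X₂)
        < χ / min 1 κ))
    have hlim : Tendsto (fun t : ℝ => 2 * (oscInner κ ψ g - ε * reInner ψ g)
        + t * (oscEnergy κ g - ε * mass g)) (𝓝[>] 0)
        (𝓝 (2 * (oscInner κ ψ g - ε * reInner ψ g))) := by
      have hc : Continuous fun t : ℝ => 2 * (oscInner κ ψ g - ε * reInner ψ g)
        + t * (oscEnergy κ g - ε * mass g) := by fun_prop
      have := hc.tendsto 0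
      simp only [zero_mul, add_zero] at this
      exact this.mono_left nhdsWithin_le_nhds
    refine ge_of_tendsto hlim ?_
    filter_upwards [nhdsWithin_le_nhds ht1, nhdsWithin_le_nhds ht2, self_mem_nhdsWithin]
      with t h3 h4 ht
    have ht0 : 0 < t := ht
    have hm := mass_nonneg g
    let M := 2 * t * reInner ψ g + t ^ 2 * mass g
    have hM : 0 ≤ M := by positivity
    have hγ2 : √(1 - M / b₂) ^ 2 = 1 - M / b₂ := Real.sq_sqrt (by
      rw [sub_nonneg, div_le_one hb₂]; exact h3.le)
    have hγ1 : √(1 - M / b₂) ^ 2 ≤ 1 := by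
      rw [hγ2]; have := div_nonneg hM hb₂.le; linarith
    have hγb : √(1 - M / b₂) ^ 2 * b₂ = b₂ - M := by
      rw [hγ2, sub_mul, div_mul_cancel₀ _ hb₂.ne', one_mul]
    have h5 := hR.localInf_le (μ₁ := μ₁) hn3 hn5 (h1 ▸ hmφ) hμ₂ hbdd hφ
      (hψ.add (hg.smul (t : ℂ))) 1 √(1 - M / b₂) (by simp [h1]) (by
        rw [mass_add_smul hψ hg, hγb, ← h2]; simp only [M]; ring) (by
        rw [oscEnergy_add_smul _ hψ hg]
        have := mul_le_of_le_one_left hX₂ hγ1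
        linarith)
    rw [oscEnergy_add_smul _ hψ hg, interaction_add_smul_right mφ mψ (hg3 a ha), hd] at h5
    -- removing the mass `M` from the remainder saves at least the oscillator bound `ε M`
    have h6 : ε * M ≤ (1 - √(1 - M / b₂) ^ 2) * Y₂ := by
      have : M = (1 - √(1 - M / b₂) ^ 2) * b₂ := by rw [sub_mul, hγb]; ring
      calc ε * M = (1 - √(1 - M / b₂) ^ 2) * (ε * b₂) := by
            conv_lhs => rw [this]
            ring
        _ ≤ _ := mul_le_mul_of_nonneg_left hY₂' (by linarith)
    have h7 : t * interaction (φ, g) ≤ t * (2 * (oscInner κ ψ g - ε * reInner ψ g)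
        + t * (oscEnergy κ g - ε * mass g)) := by
      simp only [M] at h6 h5
      change _ ≤ _ - 1 / 2 * (_ + t * interaction (φ, g) + _) at h5
      linarith
    exact le_of_mul_le_mul_left h7 ht0
  -- the form `oscEnergy κ - ε mass` is nonnegative and small on wide Gaussians
  obtain ⟨M, hM, hMa⟩ := exists_mass_groundState (n := n) hn1 hκ
  have hform : ∀ a, 0 < a → oscEnergy κ (groundState (n := n) κ a)
      - ε * mass (groundState (n := n) κ a) = κ * M / 2 * √a := by
    intro a ha
    have hs := Real.sqrt_pos.2 hκ
    have hsa := Real.sqrt_pos.2 ha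
    have e1 : κ = √κ * √κ := (Real.mul_self_sqrt hκ.le).symm
    have e2 : a = √a * √a := (Real.mul_self_sqrt ha.le).symm
    unfold oscEnergy
    rw [gradNormSq_groundState hn1 hκ ha, potentialEnergy_groundState hn1 hκ ha, hMa a ha]
    simp only [ε]
    have h : ∀ k w : ℝ, 0 < k → 0 < w → k * k * (((n - 1) / (2 * k) + w * w / 2) * (M / w))
        + (n - 1) * k / 2 * (M / w) - k * (n - 1) * (M / w) = k * k * M / 2 * w :=
      fun k w hk hw => by field_simp; ring
    have := h √κ √a hs hsa
    rwa [← e1, ← e2] at this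
  let k := interaction (φ, groundState κ 1)
  let q := oscEnergy κ ψ - ε * mass ψ
  let L := (q + 1) / k
  have hq : 0 ≤ q := sub_nonneg.2 (PartialConfinement.oscillator_le hκ hn1 hψ)
  have hL : 0 < L := by positivity
  have hlim : Tendsto (fun a : ℝ => L ^ 2 * (κ * M / 2 * √a)) (𝓝[>] 0) (𝓝 0) := by
    have hc : Continuous fun a : ℝ => L ^ 2 * (κ * M / 2 * √a) := by fun_prop
    have := hc.tendsto 0
    simp only [Real.sqrt_zero, mul_zero] at this
    exact this.mono_left nhdsWithin_le_nhds
  have hlt1 : ∀ᶠ a : ℝ in 𝓝[>] 0, a < 1 := nhdsWithin_le_nhds (gt_mem_nhds one_pos)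
  obtain ⟨a, ⟨h3, h4⟩, ha⟩ := (((hlim.eventually (gt_mem_nhds one_pos)).and hlt1).and
    self_mem_nhdsWithin).exists
  have ha0 : 0 < a := ha
  have hg := memH_groundState (n := n) hκ ha0
  -- nonnegativity of the form at `ψ - L g`, with `L` so large that the cross term, at least
  -- `L k = q + 1`, exceeds the diagonal terms `q` and `L² κ M √a / 2 < 1`
  have h5 := PartialConfinement.oscillator_le hκ hn1 (hψ.add (hg.smul ((-L : ℝ) : ℂ)))
  change ε * _ ≤ oscEnergy κ _ at h5
  rw [oscEnergy_add_smul _ hψ hg, mass_add_smul hψ hg] at h5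
  have h6 := hopt a ha0
  have h7 := hkmono a ha0 h4.le
  have h8 := hform a ha0
  have h9 : L * k = q + 1 := div_mul_cancel₀ _ hk0.ne'
  have h10 : L * k ≤ L * (2 * (oscInner κ ψ (groundState κ a)
      - ε * reInner ψ (groundState κ a))) := mul_le_mul_of_nonneg_left (h7.trans h6) hL.le
  rw [← h8] at h3
  have h11 : q = oscEnergy κ ψ - ε * mass ψ := rfl
  linarith

end NoSplitting

variable {κ χ μ₁ μ₂ : ℝ}

/-! ### Existence of minimizers -/

theorem modulusPair_mem {p : (Space n → ℂ) × (Space n → ℂ)} (hκ : 0 < κ)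
    (hp : p ∈ massConstraint n μ₁ μ₂ ∩ energyBall n κ χ) :
    modulusPair p ∈ massConstraint n μ₁ μ₂ ∩ energyBall n κ χ ∧
      energy κ (modulusPair p) ≤ energy κ p := by
  obtain ⟨⟨hS, h1, h2⟩, -, hB⟩ := hp
  have hS' : modulusPair p ∈ energySpace n := ⟨MemH.norm hS.1, MemH.norm hS.2⟩
  have o1 : ∀ {c : ℝ}, 0 ≤ c → oscEnergy c (modulusPair p).1 ≤ oscEnergy c p.1 :=
    fun hc => oscEnergy_norm_le hc hS.1
  have o2 : ∀ {c : ℝ}, 0 ≤ c → oscEnergy c (modulusPair p).2 ≤ oscEnergy c p.2 :=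
    fun hc => oscEnergy_norm_le hc hS.2
  refine ⟨⟨⟨hS', (mass_norm _).trans h1, (mass_norm _).trans h2⟩, hS', ?_⟩, ?_⟩
  · rw [homNormSq_eq_oscEnergy] at hB ⊢
    have := o1 zero_le_one
    have := o2 zero_le_one
    linarith
  · rw [energy_eq_oscEnergy, energy_eq_oscEnergy]
    have := o1 zero_le_one
    have := o2 hκ.le
    have : interaction p ≤ interaction (modulusPair p) := interaction_le_norm p.1 p.2
    linarith

/-- A minimizing sequence of nonnegative pairs which does not vanish near the origin. -/
theorem exists_minimizing_seq (hn3 : 3 ≤ n) (hn5 : n ≤ 5) (hκ : 0 < κ)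
    (hbdd : BddBelow (energy κ '' (massConstraint n μ₁ μ₂ ∩ energyBall n κ χ)))
    (hne : (massConstraint n μ₁ μ₂ ∩ energyBall n κ χ).Nonempty)
    (hE : localInf n κ χ μ₁ μ₂ < 1 / 2 * (n - 1) * (μ₁ + √κ * μ₂))
    (hap : ∀ q ∈ massConstraint n μ₁ μ₂ ∩ energyBall n κ χ,
      energy κ q ≤ 1 / 2 * (n - 1) * (μ₁ + √κ * μ₂) → homNormSq q ≤ χ / min 1 κ / 2) :
    ∃ (u v : ℕ → Space n → ℂ) (δ R : ℝ), 0 < δ ∧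
      (∀ k, (u k, v k) ∈ massConstraint n μ₁ μ₂ ∩ energyBall n κ χ ∧
        homNormSq (u k, v k) ≤ χ / min 1 κ / 2 ∧ (∀ x, u k x = (‖u k x‖ : ℂ)) ∧
        (∀ x, v k x = (‖v k x‖ : ℂ)) ∧
        δ ≤ ∫ x in Metric.ball (0 : Space n) R, ‖u k x‖ * ‖u k x‖ * ‖v k x‖) ∧
      Tendsto (fun k => energy κ (u k, v k)) atTop (𝓝 (localInf n κ χ μ₁ μ₂)) := by
  have hn1 : 1 ≤ n := by omega
  set d := localInf n κ χ μ₁ μ₂ with hd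
  set E₀ := 1 / 2 * ((n : ℝ) - 1) * (μ₁ + √κ * μ₂) with hE₀
  let l : Fin n := ⟨n - 1, by omega⟩
  have hl : l.val + 1 = n := by simp only [l]; omega
  obtain ⟨w, hanti, hw, hmem⟩ := exists_seq_tendsto_sInf (hne.image (energy κ)) hbdd
  -- energies below the midpoint of `d` and `E₀` keep the interaction at least `E₀ - d`
  obtain ⟨k₀, hk₀⟩ := (hw.eventually (gt_mem_nhds (by
    change d < (E₀ + d) / 2; linarith))).exists
  choose q hq hqw using fun k => hmem (k + k₀)
  have hqd : Tendsto (fun k => energy κ (q k)) atTop (𝓝 d) :=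
    ((tendsto_add_atTop_iff_nat k₀).2 hw).congr fun k => (hqw k).symm
  have hqE : ∀ k, energy κ (q k) ≤ (E₀ + d) / 2 := fun k => by
    rw [hqw k]
    exact (hanti (Nat.le_add_left _ _)).trans hk₀.le
  have hm := fun k => modulusPair_mem hκ (hq k)
  have hmE : ∀ k, energy κ (modulusPair (q k)) ≤ (E₀ + d) / 2 := fun k => (hm k).2.trans (hqE k)
  have hmH : ∀ k, homNormSq (modulusPair (q k)) ≤ χ / min 1 κ / 2 := fun k =>
    hap _ (hm k).1 ((hmE k).trans (by linarith))
  have hmd : Tendsto (fun k => energy κ (modulusPair (q k))) atTop (𝓝 d) :=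
    tendsto_of_tendsto_of_tendsto_of_le_of_le tendsto_const_nhds hqd
      (fun k => localInf_le_energy hbdd (hm k).1) fun k => (hm k).2
  let N := max (max μ₁ μ₂) (χ / min 1 κ / 2)
  obtain ⟨δ, R, hδ, htr⟩ := exists_translate_ge hn3 hn5 hl (N := N) (δ := E₀ - d) (by linarith)
  have hex : ∀ k, ∃ t : ℝ, δ ≤ ∫ x in Metric.ball (0 : Space n) R,
      ‖(modulusPair (q k)).1 (x + t • EuclideanSpace.single l 1)‖
        * ‖(modulusPair (q k)).1 (x + t • EuclideanSpace.single l 1)‖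
        * ‖(modulusPair (q k)).2 (x + t • EuclideanSpace.single l 1)‖ := by
    intro k
    obtain ⟨⟨⟨hS, h1, h2⟩, -⟩, -⟩ := hm k
    have hH := hmH k
    have g1 := gradNormSq_nonneg (modulusPair (q k)).1
    have g2 := gradNormSq_nonneg (modulusPair (q k)).2
    have p1 := potentialEnergy_nonneg (modulusPair (q k)).1
    have p2 := potentialEnergy_nonneg (modulusPair (q k)).2
    have hH' := hH
    unfold homNormSq at hH'
    have hN1 : μ₁ ≤ N := (le_max_left _ _).trans (le_max_left _ _)
    have hN2 : μ₂ ≤ N := (le_max_right _ _).trans (le_max_left _ _)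
    have hN3 : χ / min 1 κ / 2 ≤ N := le_max_right _ _
    refine htr _ _ hS.1 hS.2 ⟨by linarith, by linarith, by linarith⟩
      ⟨by linarith, by linarith, by linarith⟩ ?_
    have o1 := oscillator_le one_pos hn1 (show MemH _ from hS.1)
    have o2 := oscillator_le hκ hn1 (show MemH _ from hS.2)
    rw [Real.sqrt_one] at o1
    have hK : interaction (modulusPair (q k)) = ∫ x, ‖(modulusPair (q k)).1 x‖
        * ‖(modulusPair (q k)).1 x‖ * ‖(modulusPair (q k)).2 x‖ := by
      have := interaction_norm (q k).1 (q k).2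
      simp only [modulusPair, Complex.norm_real, norm_norm]
      exact this
    rw [← hK]
    have hEk := hmE k
    unfold energy at hEk
    rw [h1] at o1
    rw [h2] at o2
    simp only [hE₀] at hEk ⊢
    linarith
  choose t ht using hex
  refine ⟨fun k x => (modulusPair (q k)).1 (x + t k • EuclideanSpace.single l 1),
    fun k x => (modulusPair (q k)).2 (x + t k • EuclideanSpace.single l 1), δ, R, hδ,
    fun k => ?_, ?_⟩
  · obtain ⟨⟨⟨hS, h1, h2⟩, -, hB⟩, -⟩ := hm k
    have hS' : ((fun x => (modulusPair (q k)).1 (x + t k • EuclideanSpace.single l 1)),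
        fun x => (modulusPair (q k)).2 (x + t k • EuclideanSpace.single l 1)) ∈ energySpace n :=
      ⟨MemH.comp_add hl hS.1 _, MemH.comp_add hl hS.2 _⟩
    have hhom : homNormSq ((fun x => (modulusPair (q k)).1 (x + t k • EuclideanSpace.single l 1)),
        fun x => (modulusPair (q k)).2 (x + t k • EuclideanSpace.single l 1))
        = homNormSq (modulusPair (q k)) := by
      simp only [homNormSq]
      rw [gradNormSq_comp_add hS.1.1, gradNormSq_comp_add hS.2.1, potentialEnergy_comp_add hl,
        potentialEnergy_comp_add hl]
    refine ⟨⟨⟨hS', ?_, ?_⟩, hS', ?_⟩, ?_, ?_, ?_, ht k⟩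
    · exact (mass_comp_add _ _).trans h1
    · exact (mass_comp_add _ _).trans h2
    · rw [hhom]; exact hB
    · rw [hhom]; exact hmH k
    · intro x; simp [modulusPair]
    · intro x; simp [modulusPair]
  · refine hmd.congr fun k => ?_
    obtain ⟨⟨⟨hS, -, -⟩, -⟩, -⟩ := hm k
    simp only [energy]
    rw [gradNormSq_comp_add hS.1.1, gradNormSq_comp_add hS.2.1, potentialEnergy_comp_add hl,
      potentialEnergy_comp_add hl, interaction_comp_add]

theorem isBounded_range_energyData (hn3 : 3 ≤ n) (hn5 : n ≤ 5) {r s : ℕ → Space n → ℂ}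
    (hr : WeakNull r) (hs : WeakNull s) :
    Bornology.IsBounded (Set.range fun k => energyData (r k, s k)) := by
  obtain ⟨C, hC⟩ := hr.bdd
  obtain ⟨C', hC'⟩ := hs.bdd
  obtain ⟨D, hD⟩ := hr.exists_cube_bound hn3 hn5
  obtain ⟨D', hD'⟩ := hs.exists_cube_bound hn3 hn5
  refine Bornology.IsBounded.subset (Metric.isBounded_closedBall (x := (0 : Fin 7 → ℝ))
    (r := max (max C C') (D + D'))) ?_
  rintro _ ⟨k, rfl⟩
  have hC1 : C ≤ max (max C C') (D + D') := (le_max_left _ _).trans (le_max_left _ _)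
  have hC2 : C' ≤ max (max C C') (D + D') := (le_max_right _ _).trans (le_max_left _ _)
  have hC3 : D + D' ≤ max (max C C') (D + D') := le_max_right _ _
  have hpos : ∀ {a : ℝ}, 0 ≤ a → a ≤ max (max C C') (D + D') →
      ‖a‖ ≤ max (max C C') (D + D') := fun h0 h => by
    rwa [Real.norm_eq_abs, abs_of_nonneg h0]
  rw [mem_closedBall_zero_iff, pi_norm_le_iff_of_nonneg
    ((mass_nonneg (r k)).trans ((hC k).1.trans hC1))]
  intro i
  fin_cases i
  · exact hpos (mass_nonneg _) ((hC k).1.trans hC1)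
  · exact hpos (mass_nonneg _) ((hC' k).1.trans hC2)
  · exact hpos (gradNormSq_nonneg _) ((hC k).2.1.trans hC1)
  · exact hpos (gradNormSq_nonneg _) ((hC' k).2.1.trans hC2)
  · exact hpos (potentialEnergy_nonneg _) ((hC k).2.2.trans hC1)
  · exact hpos (potentialEnergy_nonneg _) ((hC' k).2.2.trans hC2)
  · have h1 := setIntegral_triple_le ((hr.memH k).1.memLp_three hn3 hn5)
      ((hs.memH k).1.memLp_three hn3 hn5) Set.univ
    simp only [Measure.restrict_univ] at h1
    exact (abs_interaction_le _ _).trans (h1.trans ((add_le_add (hD k) (hD' k)).trans hC3))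

/-- Along a subsequence, all limits of a pair of weakly null sequences exist. -/
theorem exists_remainder (hn3 : 3 ≤ n) (hn5 : n ≤ 5) (κ : ℝ) {r s : ℕ → Space n → ℂ}
    (hr : WeakNull r) (hs : WeakNull s) : ∃ τ : ℕ → ℕ, StrictMono τ ∧ ∃ b₁ b₂ X₁ X₂ Y₂ K : ℝ,
      Remainder κ (fun k => r (τ k)) (fun k => s (τ k)) b₁ b₂ X₁ X₂ Y₂ K := by
  obtain ⟨D, -, τ, hτ, hD⟩ := tendsto_subseq_of_bounded (isBounded_range_energyData hn3 hn5 hr hs)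
    (x := fun k => energyData (r k, s k)) fun k => ⟨k, rfl⟩
  have h := tendsto_pi_nhds.1 hD
  refine ⟨τ, hτ, D 0, D 1, 1 * D 2 + D 4, 1 * D 3 + D 5, κ * D 3 + D 5, D 6, hr.comp hτ,
    hs.comp hτ, h 0, h 1, ?_, ?_, ?_, h 6⟩
  · exact ((h 2).const_mul 1).add (h 4)
  · exact ((h 3).const_mul 1).add (h 5)
  · exact ((h 3).const_mul κ).add (h 5)

/-- **Existence of minimizers.** A minimizing sequence neither vanishes nor splits. -/
theorem localMinimizers_nonempty (hn3 : 3 ≤ n) (hn5 : n ≤ 5) (hκ : 0 < κ) (hχ : 0 < χ)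
    (hμ₁ : 0 < μ₁) (hμ₂ : 0 < μ₂)
    (hbdd : BddBelow (energy κ '' (massConstraint n μ₁ μ₂ ∩ energyBall n κ χ)))
    (hne : (massConstraint n μ₁ μ₂ ∩ energyBall n κ χ).Nonempty)
    (hE : localInf n κ χ μ₁ μ₂ < 1 / 2 * (n - 1) * (μ₁ + √κ * μ₂))
    (hap : ∀ q ∈ massConstraint n μ₁ μ₂ ∩ energyBall n κ χ,
      energy κ q ≤ 1 / 2 * (n - 1) * (μ₁ + √κ * μ₂) → homNormSq q ≤ χ / min 1 κ / 2) :
    (localMinimizers n κ χ μ₁ μ₂).Nonempty := by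
  obtain ⟨u, v, δ, R, hδ, huv, hlim⟩ := exists_minimizing_seq hn3 hn5 hκ hbdd hne hE hap
  have hN : 0 < χ / min 1 κ := by positivity
  -- weak limits
  let C := max (max μ₁ μ₂) (χ / min 1 κ / 2)
  have hC1 : μ₁ ≤ C := (le_max_left _ _).trans (le_max_left _ _)
  have hC2 : μ₂ ≤ C := (le_max_right _ _).trans (le_max_left _ _)
  have hC3 : χ / min 1 κ / 2 ≤ C := le_max_right _ _
  have hb : ∀ k, (mass (u k) ≤ C ∧ gradNormSq (u k) ≤ C ∧ potentialEnergy (u k) ≤ C) ∧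
      (mass (v k) ≤ C ∧ gradNormSq (v k) ≤ C ∧ potentialEnergy (v k) ≤ C) := by
    intro k
    obtain ⟨⟨⟨-, h1, h2⟩, -⟩, hH, -⟩ := huv k
    have g1 := gradNormSq_nonneg (u k)
    have g2 := gradNormSq_nonneg (v k)
    have p1 := potentialEnergy_nonneg (u k)
    have p2 := potentialEnergy_nonneg (v k)
    simp only [homNormSq] at hH
    simp only at h1 h2
    refine ⟨⟨?_, ?_, ?_⟩, ?_, ?_, ?_⟩ <;> linarith
  obtain ⟨φ, s₁, hφ, hs₁, hwφ, hnφ⟩ := exists_weakNull_sub (fun k => (huv k).1.1.1.1)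
    fun k => (hb k).1
  obtain ⟨ψ, s₂, hψ, hs₂, hwψ, hnψ⟩ := exists_weakNull_sub (fun k => (huv (s₁ k)).1.1.1.2)
    fun k => (hb (s₁ k)).2
  obtain ⟨τ, hτ, b₁, b₂, X₁, X₂, Y₂, K, hR⟩ := exists_remainder hn3 hn5 κ (hnφ.comp hs₂) hnψ
  let j : ℕ → ℕ := fun k => s₁ (s₂ (τ k))
  have hj : StrictMono j := hs₁.comp (hs₂.comp hτ)
  let r : ℕ → Space n → ℂ := fun k => u (j k) - φ
  let s : ℕ → Space n → ℂ := fun k => v (j k) - ψ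
  change Remainder κ r s b₁ b₂ X₁ X₂ Y₂ K at hR
  have er : ∀ k, φ + ((1 : ℝ) : ℂ) • r k = u (j k) := fun k => by simp [r]
  have es : ∀ k, ψ + ((1 : ℝ) : ℂ) • s k = v (j k) := fun k => by simp [s]
  have hφr : φ =ᵐ[volume] fun x => (‖φ x‖ : ℂ) :=
    hwφ.eq_norm hφ.1.1 fun k => ae_of_all _ (huv (s₁ k)).2.2.1
  have hψr : ψ =ᵐ[volume] fun x => (‖ψ x‖ : ℂ) :=
    hwψ.eq_norm hψ.1.1 fun k => ae_of_all _ (huv (s₁ (s₂ k))).2.2.2.1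
  have hKφψ : 0 < interaction (φ, ψ) := by
    have h1 := le_integral_triple_of_local hn3 hn5 hφ hψ hR.left hR.right (δ := δ) (R := R)
      fun k => by
        have := (huv (j k)).2.2.2.2
        simpa [r, s] using this
    have h2 : interaction (φ, ψ) = ∫ x, ‖φ x‖ * ‖φ x‖ * ‖ψ x‖ := by
      rw [← interaction_norm]
      refine congrArg Complex.re (integral_congr_ae ?_)
      filter_upwards [hφr, hψr] with x h3 h4
      simp only [← h3, ← h4]
    rw [h2]
    exact hδ.trans_le h1
  obtain ⟨hmφ, hmψ⟩ := mass_pos_of_interaction hφ hψ hKφψ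
  -- the constraints and the energy in the limit
  have m1 : mass φ + b₁ = μ₁ := by
    have h := tendsto_mass_split hφ hR.left 1 hR.mass_left
    simp only [er] at h
    have := tendsto_nhds_unique h (tendsto_const_nhds.congr fun k => (huv (j k)).1.1.2.1.symm)
    linarith
  have m2 : mass ψ + b₂ = μ₂ := by
    have h := tendsto_mass_split hψ hR.right 1 hR.mass_right
    simp only [es] at h
    have := tendsto_nhds_unique h (tendsto_const_nhds.congr fun k => (huv (j k)).1.1.2.2.symm)
    linarith
  have o1 := tendsto_oscEnergy_split hφ hR.left 1 hR.osc_left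
  have o2 := tendsto_oscEnergy_split hψ hR.right 1 hR.osc_right
  have o3 := tendsto_oscEnergy_split hψ hR.right 1 hR.osc_right'
  have i1 := tendsto_interaction_split hn3 hn5 hφ hψ hR.left hR.right 1 1 hR.inter
  simp only [er, es, one_pow, one_mul] at o1 o2 o3 i1
  have hhom : oscEnergy 1 φ + X₁ + (oscEnergy 1 ψ + X₂) ≤ χ / min 1 κ / 2 := by
    refine le_of_tendsto' (o1.add o2) fun k => ?_
    have := (huv (j k)).2.1
    rwa [homNormSq_eq_oscEnergy] at this
  have hd : localInf n κ χ μ₁ μ₂ = 1 / 2 * (oscEnergy 1 φ + X₁ + (oscEnergy κ ψ + Y₂))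
      - 1 / 2 * (interaction (φ, ψ) + K) := by
    refine tendsto_nhds_unique (hlim.comp hj.tendsto_atTop) ?_
    refine (((o1.add o3).const_mul (1 / 2)).sub (i1.const_mul (1 / 2))).congr fun k => ?_
    simp only [Function.comp_apply, energy_eq_oscEnergy]
  obtain ⟨hb₁, hb₂, hX₁, hX₂, hY₂⟩ := hR.nonneg hκ
  -- reversing the sign of the second remainder
  have hK0 : 0 ≤ K := by
    have h := hR.localInf_le hn3 hn5 hμ₁ hμ₂ hbdd hφ hψ 1 (-1) (by linarith) (by linarith)
      (by linarith)
    rw [hd] at h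
    linarith
  rcases hb₁.lt_or_eq with hb₁ | rfl
  · rcases hb₂.lt_or_eq with hb₂ | rfl
    · refine (exchange_contradiction hmφ hmψ hb₁ hb₂ hKφψ hK0 hd ?_).elim
      intro α₁ α₂ β₁ β₂ ha₁ ha₂ hβ₁ hβ₂ e1 e2
      have q1 := oscEnergy_nonneg zero_le_one φ
      have q2 := oscEnergy_nonneg zero_le_one ψ
      have h := hR.localInf_le hn3 hn5 hμ₁ hμ₂ hbdd (hφ.smul (α₁ : ℂ)) (hψ.smul (α₂ : ℂ)) β₁ β₂
        (by rw [mass_smul, norm_ofReal_sq, e1, m1]) (by rw [mass_smul, norm_ofReal_sq, e2, m2])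
        (by
          rw [oscEnergy_smul _ _ hφ, oscEnergy_smul _ _ hψ]
          have t1 := mul_le_mul_of_nonneg_right ha₁ q1
          have t2 := mul_le_mul_of_nonneg_right ha₂ q2
          have t3 := mul_le_mul_of_nonneg_right hβ₁ hX₁
          have t4 := mul_le_mul_of_nonneg_right hβ₂ hX₂
          linarith)
      rw [oscEnergy_smul _ _ hφ, oscEnergy_smul _ _ hψ, interaction_smul] at h
      exact h
    · exact (hR.false_of_right_eq_zero hn3 hn5 hκ hb₁ hbdd hφ hψ hmφ hmψ m1 (by linarith) hhom hN
        hd hE).elim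
  · rcases hb₂.lt_or_eq with hb₂ | rfl
    · exact (hR.false_of_left_eq_zero hn3 hn5 hκ hb₂ hbdd hφ hψ hmφ hφr hψr (by linarith) m2 hμ₂
        (by linarith) hd).elim
    · have hK := hR.interaction_eq_zero hn3 hn5 (Or.inl rfl)
      have hS : (φ, ψ) ∈ energySpace n := ⟨hφ, hψ⟩
      have hmem : (φ, ψ) ∈ massConstraint n μ₁ μ₂ ∩ energyBall n κ χ := by
        refine ⟨⟨hS, ?_, ?_⟩, hS, ?_⟩
        · simpa using m1
        · simpa using m2
        · rw [homNormSq_eq_oscEnergy]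
          simp only
          linarith
      refine ⟨(φ, ψ), hmem, le_antisymm ?_ (localInf_le_energy hbdd hmem)⟩
      rw [energy_eq_oscEnergy, hd]
      simp only
      linarith

/-! ### A priori bounds for small masses -/

theorem min_mul_oscEnergy_le (u : Space n → ℂ) :
    min 1 κ * oscEnergy 1 u ≤ oscEnergy κ u ∧ min 1 κ * oscEnergy 1 u ≤ oscEnergy 1 u := by
  have h1 := min_le_left 1 κ
  have h2 := min_le_right 1 κ
  have g := gradNormSq_nonneg u
  have p := potentialEnergy_nonneg u
  have a1 := mul_le_mul_of_nonneg_right h2 g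
  have a2 := mul_le_mul_of_nonneg_right h1 p
  refine ⟨?_, mul_le_of_le_one_left (oscEnergy_nonneg zero_le_one u) h1⟩
  unfold oscEnergy
  linarith

/-- The choice of the mass threshold: below it the problem is bounded below and feasible, the
infimum lies below the spectral bound, and competitors with energy below that bound stay in the
ball of half the radius. -/
theorem exists_small_mass (hn3 : 3 ≤ n) (hn5 : n ≤ 5) (hκ : 0 < κ) (hχ : 0 < χ) :
    ∃ μstar : ℝ, 0 < μstar ∧ ∀ μ₁ μ₂ : ℝ, 0 < μ₁ → 0 < μ₂ → μ₁ + μ₂ < μstar →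
      BddBelow (energy κ '' (massConstraint n μ₁ μ₂ ∩ energyBall n κ χ)) ∧
      (massConstraint n μ₁ μ₂ ∩ energyBall n κ χ).Nonempty ∧
      localInf n κ χ μ₁ μ₂ < 1 / 2 * (n - 1) * (μ₁ + √κ * μ₂) ∧
      ∀ q ∈ massConstraint n μ₁ μ₂ ∩ energyBall n κ χ,
        energy κ q ≤ 1 / 2 * (n - 1) * (μ₁ + √κ * μ₂) → homNormSq q ≤ χ / min 1 κ / 2 := by
  have hn1 : 1 ≤ n := by omega
  have hn' : (1 : ℝ) ≤ n := by exact_mod_cast hn1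
  have hnR5 : (n : ℝ) ≤ 5 := by exact_mod_cast hn5
  have hθ : (0 : ℝ) < (6 - n : ℝ) / 4 := by linarith
  have hmin : 0 < min 1 κ := lt_min one_pos hκ
  have hN : 0 < χ / min 1 κ := by positivity
  obtain ⟨C, hC0, hC⟩ := exists_cube_le hn3 hn5
  obtain ⟨D, hD0, hD⟩ := exists_trial (n := n) hn1 hκ
  let A := 2 * (C * (χ / min 1 κ) ^ ((n : ℝ) / 4))
  have hA : 0 < A := by positivity
  -- the interaction is of higher order than the masses
  have hK : ∀ {μ₁ μ₂ : ℝ}, 0 < μ₁ → 0 < μ₂ →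
      ∀ q ∈ massConstraint n μ₁ μ₂ ∩ energyBall n κ χ,
        interaction q ≤ A * (μ₁ + μ₂) ^ ((6 - n : ℝ) / 4) := by
    rintro μ₁ μ₂ hμ₁ hμ₂ q ⟨⟨hS, h1, h2⟩, -, hB⟩
    have g1 := gradNormSq_nonneg q.1
    have g2 := gradNormSq_nonneg q.2
    have p1 := potentialEnergy_nonneg q.1
    have p2 := potentialEnergy_nonneg q.2
    unfold homNormSq at hB
    have hc : ∀ u : Space n → ℂ, MemH1 u → mass u ≤ μ₁ + μ₂ → gradNormSq u ≤ χ / min 1 κ →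
        ∫ x, ‖u x‖ ^ 3 ≤ C * (χ / min 1 κ) ^ ((n : ℝ) / 4) * (μ₁ + μ₂) ^ ((6 - n : ℝ) / 4) := by
      intro u hu hm hg
      have h := (hC u hu).2 Set.univ MeasurableSet.univ
      simp only [Measure.restrict_univ] at h
      refine h.trans ?_
      have e1 : (∫ x, ‖u x‖ ^ 2) ^ ((6 - n : ℝ) / 4) ≤ (μ₁ + μ₂) ^ ((6 - n : ℝ) / 4) :=
        Real.rpow_le_rpow (mass_nonneg u) hm hθ.le
      have e2 : gradNormSq u ^ ((n : ℝ) / 4) ≤ (χ / min 1 κ) ^ ((n : ℝ) / 4) :=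
        Real.rpow_le_rpow (gradNormSq_nonneg u) hg (by positivity)
      have e3 : 0 ≤ gradNormSq u ^ ((n : ℝ) / 4) := Real.rpow_nonneg (gradNormSq_nonneg u) _
      calc _ ≤ C * (μ₁ + μ₂) ^ ((6 - n : ℝ) / 4) * (χ / min 1 κ) ^ ((n : ℝ) / 4) := by gcongr
        _ = _ := by ring
    have c1 := hc q.1 hS.1.1 (by linarith) (by linarith)
    have c2 := hc q.2 hS.2.1 (by linarith) (by linarith)
    have h3 := setIntegral_triple_le (hS.1.1.memLp_three hn3 hn5) (hS.2.1.memLp_three hn3 hn5)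
      Set.univ
    simp only [Measure.restrict_univ] at h3
    have h4 : interaction q ≤ ∫ x, ‖q.1 x‖ * ‖q.1 x‖ * ‖q.2 x‖ :=
      (le_abs_self _).trans (abs_interaction_le q.1 q.2)
    simp only [A]
    linarith
  -- the choice of the threshold
  have hlim : Tendsto (fun μ : ℝ => (n - 1) * (1 + √κ) * μ + A * μ ^ ((6 - n : ℝ) / 4)) (𝓝[>] 0)
      (𝓝 0) := by
    have hc : Continuous fun μ : ℝ => (n - 1) * (1 + √κ) * μ + A * μ ^ ((6 - n : ℝ) / 4) :=
      (continuous_const.mul continuous_id).add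
        (continuous_const.mul (Real.continuous_rpow_const hθ.le))
    have := hc.tendsto 0
    simp only [Real.zero_rpow hθ.ne', mul_zero, add_zero] at this
    exact this.mono_left nhdsWithin_le_nhds
  obtain ⟨m, hm, hm0⟩ := ((hlim.eventually (gt_mem_nhds (half_pos hχ))).and
    self_mem_nhdsWithin).exists
  have hm0' : 0 < m := hm0
  refine ⟨min m (χ / min 1 κ / D), by positivity, fun μ₁ μ₂ hμ₁ hμ₂ hlt => ?_⟩
  have hμ : 0 < μ₁ + μ₂ := by positivity
  have hlt1 : μ₁ + μ₂ < m := hlt.trans_le (min_le_left _ _)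
  have hlt2 : μ₁ + μ₂ < χ / min 1 κ / D := hlt.trans_le (min_le_right _ _)
  have hsmall : (n - 1) * (1 + √κ) * (μ₁ + μ₂) + A * (μ₁ + μ₂) ^ ((6 - n : ℝ) / 4) ≤ χ / 2 := by
    refine le_trans ?_ hm.le
    have h1 : (0 : ℝ) ≤ (n - 1) * (1 + √κ) := mul_nonneg (by linarith) (by positivity)
    gcongr
  have hbdd : BddBelow (energy κ '' (massConstraint n μ₁ μ₂ ∩ energyBall n κ χ)) := by
    refine ⟨-(1 / 2 * (A * (μ₁ + μ₂) ^ ((6 - n : ℝ) / 4))), ?_⟩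
    rintro _ ⟨q, hq, rfl⟩
    have h1 := hK hμ₁ hμ₂ q hq
    have h2 := oscEnergy_nonneg zero_le_one q.1
    have h3 := oscEnergy_nonneg hκ.le q.2
    rw [energy_eq_oscEnergy]
    linarith
  obtain ⟨p, hpS, hpB, hpE⟩ := hD μ₁ μ₂ hμ₁ hμ₂
  have hp : p ∈ massConstraint n μ₁ μ₂ ∩ energyBall n κ χ := by
    refine ⟨hpS, hpS.1, hpB.trans ?_⟩
    rw [lt_div_iff₀ hD0] at hlt2
    linarith
  refine ⟨hbdd, ⟨p, hp⟩, (localInf_le_energy hbdd hp).trans_lt hpE, fun q hq hqE => ?_⟩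
  have h1 := hK hμ₁ hμ₂ q hq
  have h2 := (min_mul_oscEnergy_le (κ := κ) q.1).2
  have h3 := (min_mul_oscEnergy_le (κ := κ) q.2).1
  rw [energy_eq_oscEnergy] at hqE
  rw [homNormSq_eq_oscEnergy, div_div, mul_comm, ← div_div, le_div_iff₀ hmin]
  have h4 : (n - 1) * (μ₁ + √κ * μ₂) ≤ (n - 1) * (1 + √κ) * (μ₁ + μ₂) := by
    rw [mul_assoc]
    have h5 : (0 : ℝ) ≤ n - 1 := by linarith
    have h6 : 0 ≤ √κ * μ₁ := by positivity
    gcongr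
    linarith
  linarith

/-! ### The Euler--Lagrange equations -/

theorem re_integral_mul {f g : Space n → ℂ} (hf : MemLp f 2 volume) (hg : MemLp g 2 volume) :
    (∫ x, f x * g x).re = reInner f (fun x => conj (g x)) := by
  have h : ∫ x, f x * g x = ∫ x, g x * f x := by simp only [mul_comm]
  rw [h, integral_mul_eq hf hg]
  simp

theorem partialDeriv_const_mul {f : Space n → ℂ} (hf : Differentiable ℝ f) (c : ℂ) (i : Fin n)
    (x : Space n) : partialDeriv i (fun x => c * f x) x = c * partialDeriv i f x := by
  unfold partialDeriv
  rw [fderiv_const_mul (hf x)]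
  rfl

/-- The weak equation follows from the vanishing of the real part of the first variation in all
complex directions. -/
theorem weakEq_of_re {a lam : ℝ} {u F : Space n → ℂ} (hu : MemH u)
    (h : ∀ f : Space n → ℂ, ContDiff ℝ ∞ f → HasCompactSupport f →
      a * gradInner u f + potInner u f + lam * reInner u f = (∫ x, F x * conj (f x)).re) :
    WeakEq a lam u F := by
  refine ⟨hu.1, fun f hf hc => ?_⟩
  let G : (Space n → ℂ) → Space n → ℂ := fun f x =>
    (a : ℂ) * ∑ i, weakPartial i u x * partialDeriv i f x
      + (lam : ℂ) * u x * f x + (potential x : ℂ) * u x * f x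
  -- the real part of the equation
  have hre : ∀ f : Space n → ℂ, ContDiff ℝ ∞ f → HasCompactSupport f →
      (∫ x, G f x).re = (∫ x, F x * f x).re := by
    intro f hf hc
    have hfc : ContDiff ℝ ∞ (fun x => conj (f x)) :=
      ((Complex.conjCLE : ℂ →L[ℝ] ℂ).contDiff.comp hf :)
    have hcc : HasCompactSupport (fun x => conj (f x)) := hc.comp_left (g := conj) (by simp)
    have hfH := memH_of_test hf hc
    have hd : ∀ i, MemLp (partialDeriv i f) 2 volume := fun i =>
      memLp_test (contDiff_partialDeriv i hf).continuous (hasCompactSupport_partialDeriv i hc)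
    have i1 : ∀ i, Integrable fun x => weakPartial i u x * partialDeriv i f x := fun i =>
      integrable_mul (hu.1.memLp_weakPartial i) (hd i)
    have i2 : Integrable fun x => u x * f x := integrable_mul hu.1.1 hfH.1.1
    have i3 : Integrable fun x => potComp u x * potComp f x :=
      integrable_mul hu.memLp_potComp hfH.memLp_potComp
    have hV : ∀ x, potComp u x * potComp f x = (potential x : ℂ) * u x * f x := fun x => by
      have : (potential x : ℂ) = (√(potential x) : ℂ) * (√(potential x) : ℂ) := by
        rw [← Complex.ofReal_mul, Real.mul_self_sqrt (potential_nonneg x)]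
      rw [this]
      simp only [potComp]
      ring
    have e : ∫ x, G f x = (a : ℂ) * (∑ i, ∫ x, weakPartial i u x * partialDeriv i f x)
        + (lam : ℂ) * (∫ x, u x * f x) + ∫ x, potComp u x * potComp f x := by
      have j1 : Integrable fun x => (a : ℂ) * ∑ i, weakPartial i u x * partialDeriv i f x :=
        (integrable_finsetSum _ fun i _ => i1 i).const_mul _
      have j2 : Integrable fun x => (a : ℂ) * ∑ i, weakPartial i u x * partialDeriv i f x
          + (lam : ℂ) * (u x * f x) := j1.add (i2.const_mul _)
      rw [← integral_finsetSum _ fun i _ => i1 i, ← integral_const_mul, ← integral_const_mul,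
        ← integral_add j1 (i2.const_mul _), ← integral_add j2 i3]
      refine integral_congr_ae (ae_of_all _ fun x => ?_)
      simp only [G, hV]
      ring
    have h1 := h _ hfc hcc
    simp only [Complex.conj_conj] at h1
    rw [← h1, e]
    have e2 : gradInner u (fun x => conj (f x))
        = ∑ i, (∫ x, weakPartial i u x * partialDeriv i f x).re := by
      refine Finset.sum_congr rfl fun i _ => ?_
      rw [re_integral_mul (hu.1.memLp_weakPartial i) (hd i)]
      refine reInner_congr Filter.EventuallyEq.rfl ?_
      refine (hasWeakPartial_of_contDiff i (hfc.of_le (by norm_num))).weakPartial_ae.trans ?_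
      exact ae_of_all _ fun x => partialDeriv_conj (hf.differentiable (by norm_num)) i x
    have e3 : potInner u (fun x => conj (f x)) = (∫ x, potComp u x * potComp f x).re := by
      rw [re_integral_mul hu.memLp_potComp hfH.memLp_potComp]
      unfold potInner
      congr 1
      ext x
      simp only [potComp, map_mul, Complex.conj_ofReal]
    rw [e2, e3, ← re_integral_mul hu.1.1 hfH.1.1, Complex.add_re, Complex.add_re,
      Complex.re_ofReal_mul, Complex.re_ofReal_mul, Complex.re_sum]
    ring
  have h1 := hre f hf hc
  -- the imaginary part is the real part in the direction `i f`
  have h2 := hre (fun x => Complex.I * f x) (contDiff_const.mul hf) hc.mul_left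
  have e1 : ∫ x, G (fun x => Complex.I * f x) x = Complex.I * ∫ x, G f x := by
    rw [← integral_const_mul]
    refine integral_congr_ae (ae_of_all _ fun x => ?_)
    simp only [G, partialDeriv_const_mul (hf.differentiable (by norm_num))]
    have : ∀ i, weakPartial i u x * (Complex.I * partialDeriv i f x)
        = Complex.I * (weakPartial i u x * partialDeriv i f x) := fun i => by ring
    simp only [this, ← Finset.mul_sum]
    ring
  have e2 : ∫ x, F x * (Complex.I * f x) = Complex.I * ∫ x, F x * f x := by
    rw [← integral_const_mul]
    refine integral_congr_ae (ae_of_all _ fun x => ?_)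
    simp only
    ring
  rw [e1, e2, Complex.I_mul_re, Complex.I_mul_re, neg_inj] at h2
  exact Complex.ext h1 h2

theorem interaction_add_smul_left {φ ψ f : Space n → ℂ} (hφ : MemLp φ 3 volume)
    (hψ : MemLp ψ 3 volume) (hf : MemLp f 3 volume) (t : ℝ) :
    interaction (φ + (t : ℂ) • f, ψ) = interaction (φ, ψ)
      + 2 * t * (∫ x, φ x * f x * conj (ψ x)).re + t ^ 2 * interaction (f, ψ) := by
  have i2 : Integrable fun x => φ x * f x * conj (ψ x) :=
    (integrable_triple hφ hf hψ).mono' ((hφ.1.mul hf.1).mul hψ.1.star) (ae_of_all _ fun x => by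
      rw [norm_mul, norm_mul, RCLike.norm_conj])
  have i1 := integrable_interaction hφ hψ
  have i3 := integrable_interaction hf hψ
  have i12 : Integrable fun x => φ x ^ 2 * conj (ψ x)
      + ((2 * t : ℝ) : ℂ) * (φ x * f x * conj (ψ x)) := i1.add (i2.const_mul _)
  unfold interaction
  have : ∀ x, (φ + (t : ℂ) • f) x ^ 2 * conj (ψ x) = φ x ^ 2 * conj (ψ x)
      + ((2 * t : ℝ) : ℂ) * (φ x * f x * conj (ψ x))
      + ((t ^ 2 : ℝ) : ℂ) * (f x ^ 2 * conj (ψ x)) := fun x => by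
    simp only [Pi.add_apply, Pi.smul_apply, smul_eq_mul]
    push_cast
    ring
  simp only [this]
  rw [integral_add i12 (i3.const_mul _), integral_add i1 (i2.const_mul _), integral_const_mul,
    integral_const_mul, Complex.add_re, Complex.add_re, Complex.re_ofReal_mul,
    Complex.re_ofReal_mul]

theorem hasDerivAt_quadratic (a b c : ℝ) : HasDerivAt (fun t : ℝ => a + 2 * t * b + t ^ 2 * c)
    (2 * b) 0 := by
  have h1 : HasDerivAt (fun t : ℝ => a + 2 * t * b + t ^ 2 * c)
      (0 + 2 * 1 * b + (2 : ℕ) * (0 : ℝ) ^ (2 - 1) * 1 * c) 0 :=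
    ((hasDerivAt_const _ _).add (((hasDerivAt_id _).const_mul 2).mul_const b)).add
      (((hasDerivAt_id _).pow 2).mul_const c)
  simpa using h1

/-- The first-order condition for the first component. -/
theorem first_variation_left {m m₁ m₂ q q₁ q₂ k k₁ k₂ c : ℝ} (hm : 0 < m)
    (h : ∀ᶠ t : ℝ in 𝓝 0, 1 / 2 * (q + c) - 1 / 2 * k
      ≤ 1 / 2 * (m / (m + 2 * t * m₁ + t ^ 2 * m₂) * (q + 2 * t * q₁ + t ^ 2 * q₂) + c)
        - 1 / 2 * (m / (m + 2 * t * m₁ + t ^ 2 * m₂) * (k + 2 * t * k₁ + t ^ 2 * k₂))) :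
    q₁ + -(q - k) / m * m₁ = k₁ := by
  have d1 := hasDerivAt_quadratic m m₁ m₂
  have d2 := (((hasDerivAt_const (0 : ℝ) m).div d1 (by simpa using hm.ne')).mul
    (hasDerivAt_quadratic q q₁ q₂)).add_const c
  have d3 := ((hasDerivAt_const (0 : ℝ) m).div d1 (by simpa using hm.ne')).mul
    (hasDerivAt_quadratic k k₁ k₂)
  have d4 := (d2.const_mul (1 / 2)).sub (d3.const_mul (1 / 2))
  have hmin : IsLocalMin _ (0 : ℝ) := h.mono fun t ht => by
    refine le_trans (le_of_eq ?_) ht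
    simp [hm.ne']
  have := hmin.hasDerivAt_eq_zero d4
  simp only [Pi.div_apply, mul_zero, zero_mul, add_zero, ne_eq, OfNat.ofNat_ne_zero,
    not_false_eq_true, zero_pow, zero_sub] at this
  field_simp at this ⊢
  linarith

/-- The first-order condition for the second component. -/
theorem first_variation_right {m m₁ m₂ q q₁ q₂ k k₁ c : ℝ} (hm : 0 < m)
    (h : ∀ᶠ t : ℝ in 𝓝 0, 1 / 2 * (c + q) - 1 / 2 * k
      ≤ 1 / 2 * (c + m / (m + 2 * t * m₁ + t ^ 2 * m₂) * (q + 2 * t * q₁ + t ^ 2 * q₂))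
        - 1 / 2 * (√(m / (m + 2 * t * m₁ + t ^ 2 * m₂)) * (k + t * k₁))) :
    q₁ + -(2 * q - k) / (2 * m) * m₁ = 1 / 2 * k₁ := by
  have d1 := hasDerivAt_quadratic m m₁ m₂
  have d0 := (hasDerivAt_const (0 : ℝ) m).div d1 (by simpa using hm.ne')
  have d2 := (d0.mul (hasDerivAt_quadratic q q₁ q₂)).const_add c
  have d3 := (d0.sqrt (by simp [hm.ne'])).mul
    (((hasDerivAt_id (0 : ℝ)).mul_const k₁).const_add k)
  have d4 := (d2.const_mul (1 / 2)).sub (d3.const_mul (1 / 2))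
  have hmin : IsLocalMin _ (0 : ℝ) := h.mono fun t ht => by
    refine le_trans (le_of_eq ?_) ht
    simp [hm.ne']
  have := hmin.hasDerivAt_eq_zero d4
  simp only [Pi.div_apply, mul_zero, zero_mul, add_zero, ne_eq, OfNat.ofNat_ne_zero,
    not_false_eq_true, zero_pow, zero_sub, div_self hm.ne', Real.sqrt_one, id] at this
  field_simp at this ⊢
  linarith

/-- Minimizers in the interior of the ball solve the elliptic system. The Lagrange multipliers are
determined by testing the equations with the solution itself. -/
theorem isComplexWeakSolution_of_minimizer (hn3 : 3 ≤ n) (hn5 : n ≤ 5) (hμ₁ : 0 < μ₁)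
    (hμ₂ : 0 < μ₂) (hbdd : BddBelow (energy κ '' (massConstraint n μ₁ μ₂ ∩ energyBall n κ χ)))
    {p : (Space n → ℂ) × (Space n → ℂ)} (hp : p ∈ localMinimizers n κ χ μ₁ μ₂)
    (hlt : homNormSq p < χ / min 1 κ) :
    IsComplexWeakSolution κ (-(oscEnergy 1 p.1 - interaction p) / μ₁)
      (-(2 * oscEnergy κ p.2 - interaction p) / (2 * μ₂)) p := by
  obtain ⟨u, v⟩ := p
  obtain ⟨⟨⟨⟨hu, hv⟩, h1, h2⟩, -⟩, hE⟩ := hp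
  change MemH u at hu
  change MemH v at hv
  simp only at h1 h2
  rw [energy_eq_oscEnergy] at hE
  rw [homNormSq_eq_oscEnergy] at hlt
  simp only at hE hlt
  have mu := hu.1.memLp_three hn3 hn5
  have mv := hv.1.memLp_three hn3 hn5
  have hq : ∀ m a b : ℝ, 0 < m → ContinuousAt (fun t : ℝ => m / (m + 2 * t * a + t ^ 2 * b)) 0 :=
    fun m a b hm => by
      refine ContinuousAt.div (by fun_prop) (by fun_prop) ?_
      simpa using hm.ne'
  have hpos : ∀ m a b : ℝ, 0 < m → ∀ᶠ t : ℝ in 𝓝 0, 0 < m + 2 * t * a + t ^ 2 * b :=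
    fun m a b hm => by
      have hc : Continuous fun t : ℝ => m + 2 * t * a + t ^ 2 * b := by fun_prop
      exact (hc.tendsto 0).eventually (lt_mem_nhds (by simpa using hm))
  have hqc : ∀ a b c : ℝ, ContinuousAt (fun t : ℝ => a + 2 * t * b + t ^ 2 * c) 0 :=
    fun a b c => by fun_prop
  constructor
  · refine weakEq_of_re hu fun f hf hc => ?_
    have hfH := memH_of_test hf hc
    have mf := hfH.1.memLp_three hn3 hn5
    have hvar := first_variation_left (m₁ := reInner u f) (m₂ := mass f) (q := oscEnergy 1 u)
      (q₁ := oscInner 1 u f) (q₂ := oscEnergy 1 f) (k := interaction (u, v))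
      (k₁ := (∫ x, u x * f x * conj (v x)).re) (k₂ := interaction (f, v)) (c := oscEnergy κ v)
      hμ₁ (by
        have hcont := ((hq μ₁ (reInner u f) (mass f) hμ₁).mul
          (hqc (oscEnergy 1 u) (oscInner 1 u f) (oscEnergy 1 f))).add_const (oscEnergy 1 v)
        have hev := hcont.tendsto.eventually (gt_mem_nhds (by simpa [hμ₁.ne'] using hlt))
        filter_upwards [hpos μ₁ (reInner u f) (mass f) hμ₁, hev] with t ht0 ht
        -- `c (u + t f)` has the prescribed mass and stays in the ball for small `t`
        let c := √(μ₁ / (μ₁ + 2 * t * reInner u f + t ^ 2 * mass f))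
        have hc2 : c ^ 2 = μ₁ / (μ₁ + 2 * t * reInner u f + t ^ 2 * mass f) :=
          Real.sq_sqrt (by positivity)
        have hw : MemH (u + (t : ℂ) • f) := hu.add (hfH.smul _)
        have hS : ((c : ℂ) • (u + (t : ℂ) • f), v) ∈ energySpace n := ⟨hw.smul _, hv⟩
        have hmem : ((c : ℂ) • (u + (t : ℂ) • f), v)
            ∈ massConstraint n μ₁ μ₂ ∩ energyBall n κ χ := by
          refine ⟨⟨hS, ?_, h2⟩, hS, ?_⟩
          · rw [mass_smul, norm_ofReal_sq, hc2, mass_add_smul hu hfH, h1,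
              div_mul_cancel₀ _ ht0.ne']
          · rw [homNormSq_eq_oscEnergy, oscEnergy_smul _ _ hw, hc2, oscEnergy_add_smul _ hu hfH]
            exact ht.le
        have hle := localInf_le_energy hbdd hmem
        have hK : interaction ((c : ℂ) • (u + (t : ℂ) • f), v)
            = c ^ 2 * interaction (u + (t : ℂ) • f, v) := by
          have := interaction_smul c 1 (u + (t : ℂ) • f) v
          rwa [Complex.ofReal_one, one_smul, mul_one] at this
        rw [← hE, energy_eq_oscEnergy, hK, oscEnergy_smul _ _ hw, hc2,
          oscEnergy_add_smul _ hu hfH, interaction_add_smul_left mu mv mf] at hle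
        exact hle)
    have hF : (∫ x, conj (u x) * v x * conj (f x)).re = (∫ x, u x * f x * conj (v x)).re := by
      have : ∀ x, conj (u x) * v x * conj (f x) = conj (u x * f x * conj (v x)) := fun x => by
        simp only [map_mul, Complex.conj_conj]
        ring
      simp only [this]
      rw [integral_conj, Complex.conj_re]
    rw [hF, ← hvar]
    unfold oscInner
    ring
  · refine weakEq_of_re hv fun f hf hc => ?_
    have hfH := memH_of_test hf hc
    have mf := hfH.1.memLp_three hn3 hn5
    have hvar := first_variation_right (m₁ := reInner v f) (m₂ := mass f) (q := oscEnergy κ v)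
      (q₁ := oscInner κ v f) (q₂ := oscEnergy κ f) (k := interaction (u, v))
      (k₁ := interaction (u, f)) (c := oscEnergy 1 u) hμ₂ (by
        have hcont := ((hq μ₂ (reInner v f) (mass f) hμ₂).mul
          (hqc (oscEnergy 1 v) (oscInner 1 v f) (oscEnergy 1 f))).const_add (oscEnergy 1 u)
        have hev := hcont.tendsto.eventually (gt_mem_nhds (by simpa [hμ₂.ne'] using hlt))
        filter_upwards [hpos μ₂ (reInner v f) (mass f) hμ₂, hev] with t ht0 ht
        let c := √(μ₂ / (μ₂ + 2 * t * reInner v f + t ^ 2 * mass f))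
        have hc2 : c ^ 2 = μ₂ / (μ₂ + 2 * t * reInner v f + t ^ 2 * mass f) :=
          Real.sq_sqrt (by positivity)
        have hw : MemH (v + (t : ℂ) • f) := hv.add (hfH.smul _)
        have hS : (u, (c : ℂ) • (v + (t : ℂ) • f)) ∈ energySpace n := ⟨hu, hw.smul _⟩
        have hmem : (u, (c : ℂ) • (v + (t : ℂ) • f))
            ∈ massConstraint n μ₁ μ₂ ∩ energyBall n κ χ := by
          refine ⟨⟨hS, h1, ?_⟩, hS, ?_⟩
          · rw [mass_smul, norm_ofReal_sq, hc2, mass_add_smul hv hfH, h2,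
              div_mul_cancel₀ _ ht0.ne']
          · rw [homNormSq_eq_oscEnergy, oscEnergy_smul _ _ hw, hc2, oscEnergy_add_smul _ hv hfH]
            exact ht.le
        have hle := localInf_le_energy hbdd hmem
        have hK : interaction (u, (c : ℂ) • (v + (t : ℂ) • f))
            = c * interaction (u, v + (t : ℂ) • f) := by
          have := interaction_smul 1 c u (v + (t : ℂ) • f)
          rwa [Complex.ofReal_one, one_smul, one_pow, one_mul] at this
        rw [← hE, energy_eq_oscEnergy, hK, oscEnergy_smul _ _ hw, hc2,
          oscEnergy_add_smul _ hv hfH, interaction_add_smul_right mu mv mf] at hle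
        exact hle)
    have hF : (∫ x, 1 / 2 * u x ^ 2 * conj (f x)).re = 1 / 2 * interaction (u, f) := by
      have : ∀ x, 1 / 2 * u x ^ 2 * conj (f x) = ((1 / 2 : ℝ) : ℂ) * (u x ^ 2 * conj (f x)) :=
        fun x => by push_cast; ring
      simp only [this]
      rw [integral_const_mul, Complex.re_ofReal_mul]
      rfl
    rw [hF, ← hvar]
    unfold oscInner
    ring

/-- The moduli of a minimizer form a minimizer with the same Lagrange multipliers, as none of the
terms of the energy can have changed. -/
theorem modulusPair_minimizer (hκ : 0 < κ)
    (hbdd : BddBelow (energy κ '' (massConstraint n μ₁ μ₂ ∩ energyBall n κ χ)))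
    {p : (Space n → ℂ) × (Space n → ℂ)} (hp : p ∈ localMinimizers n κ χ μ₁ μ₂) :
    modulusPair p ∈ localMinimizers n κ χ μ₁ μ₂ ∧
      oscEnergy 1 (modulusPair p).1 = oscEnergy 1 p.1 ∧
      oscEnergy κ (modulusPair p).2 = oscEnergy κ p.2 ∧
      interaction (modulusPair p) = interaction p := by
  obtain ⟨hm, hle⟩ := modulusPair_mem hκ hp.1
  have hge := localInf_le_energy hbdd hm
  have hE : energy κ (modulusPair p) = localInf n κ χ μ₁ μ₂ :=
    le_antisymm (hle.trans_eq hp.2) hge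
  have o1 : oscEnergy 1 (modulusPair p).1 ≤ oscEnergy 1 p.1 :=
    oscEnergy_norm_le zero_le_one hp.1.1.1.1
  have o2 : oscEnergy κ (modulusPair p).2 ≤ oscEnergy κ p.2 :=
    oscEnergy_norm_le hκ.le hp.1.1.1.2
  have o3 : interaction p ≤ interaction (modulusPair p) := interaction_le_norm p.1 p.2
  have e := hE.trans hp.2.symm
  rw [energy_eq_oscEnergy, energy_eq_oscEnergy] at e
  exact ⟨⟨hm, hE⟩, by linarith, by linarith, by linarith⟩

end PartialConfinement

end

theorem theorem1p2 (n : ℕ) (hn4 : 4 ≤ n) (hn5 : n ≤ 5) (κ : ℝ) (hκ : 0 < κ)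
    (χ : ℝ) (hχ : 0 < χ) :
    ∃ μstar : ℝ, 0 < μstar ∧
      ∀ μ₁ μ₂ : ℝ, 0 < μ₁ → 0 < μ₂ → μ₁ + μ₂ < μstar →
        BddBelow (PartialConfinement.energy κ ''
          (PartialConfinement.massConstraint n μ₁ μ₂ ∩ PartialConfinement.energyBall n κ χ)) ∧
        (PartialConfinement.localMinimizers n κ χ μ₁ μ₂).Nonempty ∧
        ∀ p ∈ PartialConfinement.localMinimizers n κ χ μ₁ μ₂,
          ∃ lam₁ lam₂ : ℝ,
            PartialConfinement.IsComplexWeakSolution κ lam₁ lam₂ p ∧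
            PartialConfinement.modulusPair p ∈ PartialConfinement.localMinimizers n κ χ μ₁ μ₂ ∧
            PartialConfinement.IsWeakSolution κ lam₁ lam₂ (PartialConfinement.modulusPair p) := by
  have hn3 : 3 ≤ n := by omega
  obtain ⟨μstar, hμ, h⟩ := PartialConfinement.exists_small_mass (n := n) hn3 hn5 hκ hχ
  refine ⟨μstar, hμ, fun μ₁ μ₂ hμ₁ hμ₂ hlt => ?_⟩
  obtain ⟨hbdd, hne, hE, hap⟩ := h μ₁ μ₂ hμ₁ hμ₂ hlt
  have hN : 0 < χ / min 1 κ := by positivity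
  -- minimizers lie in the interior of the ball
  have hint : ∀ q ∈ PartialConfinement.localMinimizers n κ χ μ₁ μ₂,
      PartialConfinement.homNormSq q < χ / min 1 κ := fun q hq =>
    (hap q hq.1 (hq.2.trans_le hE.le)).trans_lt (half_lt_self hN)
  refine ⟨hbdd, PartialConfinement.localMinimizers_nonempty hn3 hn5 hκ hχ hμ₁ hμ₂ hbdd hne hE hap,
    fun p hp => ⟨_, _, PartialConfinement.isComplexWeakSolution_of_minimizer hn3 hn5 hμ₁ hμ₂ hbdd
      hp (hint p hp), ?_⟩⟩
  obtain ⟨hm, e1, e2, e3⟩ := PartialConfinement.modulusPair_minimizer hκ hbdd hp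
  refine ⟨hm, ?_⟩
  have hsol := PartialConfinement.isComplexWeakSolution_of_minimizer hn3 hn5 hμ₁ hμ₂ hbdd hm
    (hint _ hm)
  rw [e1, e2, e3] at hsol
  -- for the real-valued pair of moduli the conjugation is trivial
  simpa only [PartialConfinement.IsComplexWeakSolution, PartialConfinement.IsWeakSolution,
    PartialConfinement.modulusPair, Complex.conj_ofReal] using hsol
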